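/- Let $\Omega\subset\mathbb R^2$ be open and connected, and let $\alpha,\beta,\gamma\in L^\infty(\Omega)$ be real and uniformly elliptic: there are constants $a_0,\delta>0$ and $a_1$ with $a_0\le\alpha,\gamma\le a_1$, $|\beta|\le a_1$ and $Q:=\beta/\sqrt{\alpha\gamma}\ge-1+\delta$ a.e. in $\Omega$ (no convexity of the symbol is assumed). Let \[ \mathcal Q(u)=\int_\Omega\big\{\alpha|u_{x_1x_1}|^2+2\beta|u_{x_1x_2}|^2+\gamma|u_{x_2x_2}|^2\big\}\,dx,\qquad u\in H^2_0(\Omega), \] where $H_0^2(\Omega)$ is the closure of $C_c^\infty(\Omega)$ (complex-valued functions) in $H^2(\Omega)$. When $\mathcal Q$ is bounded below and closed in $L^2(\Omega)$, let $H$ be the self-adjoint operator associated with it, formally \[ Hu=\partial_{x_1}^2(\alpha\,\partial_{x_1}^2u)+2\partial_{x_1}\partial_{x_2}(\beta\,\partial_{x_1}\partial_{x_2}u)+\partial_{x_2}^2(\gamma\,\partial_{x_2}^2u) \] with Dirichlet boundary conditions; its heat kernel $G(x,x',t)$ is the integral kernel of $e^{-tH}$, continuous in $(x,x')\in\Omega\times\Omega$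 for each $t>0$. Let $A(x,\xi)=\alpha\xi_1^4+2\beta\xi_1^2\xi_2^2+\gamma\xi_2^4$. For $M>0$ let $\mathcal E_{A,M}$ be the set of real $\varphi\in C^2(\Omega)$ that are bounded together with their first and second derivatives and satisfy $A(y,\nabla\varphi(y))\le1$ for a.e. $y\in\Omega$ and $\|D^\kappa\varphi\|_\infty\le M$ for $|\kappa|=2$, and let \[ d_M(x,x')=\sup\{\varphi(x')-\varphi(x):\varphi\in\mathcal E_{A,M}\}. \] Let \[ k(x)=\begin{cases}8\,\dfrac{1-Q(x)}{(1+Q(x))^2},&-1<Q(x)<0,\\ 8,&0\le Q(x)\le3,\\ Q(x)^2-1,&Q(x)>3,\end{cases}\qquad k^*=\operatorname*{ess\,sup}_{\Omega}k,\qquad \sigma_*=\frac34\Big(\frac1{4k^*}\Big)^{1/3}, \] and let $D$ be the maximum of the $L^\infty(\Omega)$-distances of $\alpha,\beta,\gamma$ from the space of Lipschitz functions on $\Omega$. Then there are constants $c>0$ and $D_0>0$, depending only on $a_0,a_1,\delta$, such that the following holds for all such $\Omega,\alpha,\beta,\gamma$. (a) If $D<D_0$ or $\beta\ge0$ a.e.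 in $\Omega$, then $\mathcal Q$ is bounded below and closed on $H_0^2(\Omega)$. (b) If $\mathcal Q$ is bounded below and closed on $H_0^2(\Omega)$, then $H$ has a heat kernel $G$, and there is $M_0>0$ such that for every $\epsilon\in(0,1)$ there is $c_\epsilon<\infty$, and for every $M\ge M_0$ there is $c_{\epsilon,M}<\infty$, with \[ |G(x,x',t)|\le c_\epsilon\,t^{-1/2}\exp\Big\{-(\sigma_*-cD-\epsilon)\,\frac{d_M(x,x')^{4/3}}{t^{1/3}}+c_{\epsilon,M}\,t\Big\} \] for all $x,x'\in\Omega$ and $t>0$. -/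

import Mathlib

open MeasureTheory Filter Topology Set

noncomputable section

namespace HeatKernelPlanar

/-- The Euclidean plane. -/
abbrev Plane : Type := EuclideanSpace ℝ (Fin 2)

/-- Lebesgue measure on the domain `Ω`. -/
abbrev mu (Ω : Set Plane) : Measure Plane := volume.restrict Ω

/-- The complex Hilbert space `L²(Ω)`. -/
abbrev L2 (Ω : Set Plane) : Type := Lp ℂ 2 (mu Ω)

/-- The partial derivative `∂ᵢ f` (with `i = 0, 1` for `x₁, x₂`). -/
def pd {F : Type*} [NormedAddCommGroup F] [NormedSpace ℝ F] (i : Fin 2) (f : Plane → F) :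
    Plane → F :=
  fun x => fderiv ℝ f x (EuclideanSpace.single i 1)

/-! ### The Sobolev space with Dirichlet boundary conditions -/

/-- `φ ∈ C_c^∞(Ω)`, complex-valued. -/
structure IsTest (Ω : Set Plane) (φ : Plane → ℂ) : Prop where
  smooth : ContDiff ℝ (⊤ : ℕ∞) φ
  compact : HasCompactSupport φ
  supp : tsupport φ ⊆ Ω

/-- `u ∈ H²₀(Ω)`, the closure of `C_c^∞(Ω)` in `H²(Ω)`, with first weak derivatives `∂ᵢ u = g i`
and second weak derivatives `∂ᵢ ∂ⱼ u = h i j`. -/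
def InH20 (Ω : Set Plane) (u : L2 Ω) (g : Fin 2 → L2 Ω) (h : Fin 2 → Fin 2 → L2 Ω) : Prop :=
  ∃ φ : ℕ → Plane → ℂ, (∀ n, IsTest Ω (φ n)) ∧
    Tendsto (fun n => eLpNorm (fun x => φ n x - u x) 2 (mu Ω)) atTop (𝓝 0) ∧
    (∀ i, Tendsto (fun n => eLpNorm (fun x => pd i (φ n) x - g i x) 2 (mu Ω)) atTop (𝓝 0)) ∧
    (∀ i j, Tendsto (fun n => eLpNorm (fun x => pd i (pd j (φ n)) x - h i j x) 2 (mu Ω))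
      atTop (𝓝 0))

/-! ### The coefficients -/

/-- The ratio `Q = β / √(αγ)`. -/
def ratioQ (α β γ : Plane → ℝ) (x : Plane) : ℝ := β x / Real.sqrt (α x * γ x)

/-- `α, β, γ ∈ L^∞(Ω)` are (almost everywhere) uniformly elliptic, with ellipticity constants
`a₀, a₁, δ`: `a₀ ≤ α, γ ≤ a₁`, `|β| ≤ a₁` and `Q ≥ -1 + δ`. -/
structure UniformlyElliptic (a₀ a₁ δ : ℝ) (Ω : Set Plane) (α β γ : Plane → ℝ) : Prop where
  meas_α : AEStronglyMeasurable α (mu Ω)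
  meas_β : AEStronglyMeasurable β (mu Ω)
  meas_γ : AEStronglyMeasurable γ (mu Ω)
  bound_α : ∀ᵐ x ∂(mu Ω), a₀ ≤ α x ∧ α x ≤ a₁
  bound_β : ∀ᵐ x ∂(mu Ω), |β x| ≤ a₁
  bound_γ : ∀ᵐ x ∂(mu Ω), a₀ ≤ γ x ∧ γ x ≤ a₁
  ratio : ∀ᵐ x ∂(mu Ω), -1 + δ ≤ ratioQ α β γ x

/-- The symbol `A(x, ξ)`, `ξ = (p, q)`. -/
def symbolA (α β γ : Plane → ℝ) (x : Plane) (p q : ℝ) : ℝ :=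
  α x * p ^ 4 + 2 * β x * p ^ 2 * q ^ 2 + γ x * q ^ 4

/-! ### The quadratic form, the operator and its heat kernel -/

/-- The sesquilinear form
`∫_Ω (α u₁₁ conj v₁₁ + 2 β u₁₂ conj v₁₂ + γ u₂₂ conj v₂₂)`,
in terms of the second derivatives `h` of `u` and `k` of `v`. -/
def form (Ω : Set Plane) (α β γ : Plane → ℝ) (h k : Fin 2 → Fin 2 → L2 Ω) : ℂ :=
  ∫ x, ((α x : ℂ) * (h 0 0 x * starRingEnd ℂ (k 0 0 x))
      + 2 * (β x : ℂ) * (h 0 1 x * starRingEnd ℂ (k 0 1 x))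
      + (γ x : ℂ) * (h 1 1 x * starRingEnd ℂ (k 1 1 x))) ∂(mu Ω)

/-- The quadratic form, with domain `H²₀(Ω)`, is bounded below and closed in `L²(Ω)`. -/
def FormClosed (Ω : Set Plane) (α β γ : Plane → ℝ) : Prop :=
  (∃ ω : ℝ, ∀ u g h, InH20 Ω u g h → -ω * ‖u‖ ^ 2 ≤ (form Ω α β γ h h).re) ∧
  ∀ (u : ℕ → L2 Ω) (g : ℕ → Fin 2 → L2 Ω) (h : ℕ → Fin 2 → Fin 2 → L2 Ω) (v : L2 Ω),
    (∀ n, InH20 Ω (u n) (g n) (h n)) →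
    Tendsto u atTop (𝓝 v) →
    (∀ η : ℝ, 0 < η → ∃ N, ∀ m ≥ N, ∀ n ≥ N, ‖form Ω α β γ (h m - h n) (h m - h n)‖ < η) →
    ∃ g' h', InH20 Ω v g' h' ∧
      Tendsto (fun n => form Ω α β γ (h n - h') (h n - h')) atTop (𝓝 0)

/-- `u ∈ Dom(H)` and `H u = f`, for the operator `H` associated with the form:
`u ∈ H²₀(Ω)` and `Q(u, v) = ⟨f, v⟩` for all `v ∈ H²₀(Ω)`.
(Mathlib's inner product is conjugate-linear in its first argument.) -/
def OperatorH (Ω : Set Plane) (α β γ : Plane → ℝ) (u f : L2 Ω) : Prop :=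
  ∃ g h, InH20 Ω u g h ∧
    ∀ v g' h', InH20 Ω v g' h' → form Ω α β γ h h' = inner ℂ v f

/-- `T t = e^{-tH}`, `t ≥ 0`: the strongly continuous semigroup on `L²(Ω)` whose generator is
exactly `-H`. -/
structure IsHeatSemigroup (Ω : Set Plane) (α β γ : Plane → ℝ) (T : ℝ → L2 Ω →L[ℂ] L2 Ω) :
    Prop where
  zero : T 0 = ContinuousLinearMap.id ℂ (L2 Ω)
  add : ∀ s t : ℝ, 0 ≤ s → 0 ≤ t → T (s + t) = (T s).comp (T t)
  cont : ∀ f : L2 Ω, Tendsto (fun t => T t f) (𝓝[>] 0) (𝓝 f)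
  generator : ∀ u f : L2 Ω, OperatorH Ω α β γ u f ↔
    Tendsto (fun t : ℝ => ((t⁻¹ : ℝ) : ℂ) • (T t u - u)) (𝓝[>] 0) (𝓝 (-f))

/-- `G(x, x', t)` is the heat kernel of `H`: the integral kernel of `e^{-tH}`, continuous in
`(x, x') ∈ Ω × Ω` for each `t > 0` (so that its values at points are determined). -/
def IsHeatKernel (Ω : Set Plane) (α β γ : Plane → ℝ) (G : Plane → Plane → ℝ → ℂ) : Prop :=
  ∃ T : ℝ → L2 Ω →L[ℂ] L2 Ω, IsHeatSemigroup Ω α β γ T ∧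
    ∀ t : ℝ, 0 < t →
      ContinuousOn (fun p : Plane × Plane => G p.1 p.2 t) (Ω ×ˢ Ω) ∧
      ∀ f : L2 Ω, ∀ᵐ x ∂(mu Ω),
        Integrable (fun y => G x y t * f y) (mu Ω) ∧
        T t f x = ∫ y, G x y t * f y ∂(mu Ω)

/-! ### The distances and the constants -/

/-- The class `E_{A,M}`: real `φ ∈ C²(Ω)`, bounded with bounded derivatives of order at most two,
with `A(y, ∇φ(y)) ≤ 1` for (almost) all `y ∈ Ω` and `|∂ᵢ∂ⱼφ| ≤ M` on `Ω`. -/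
structure ClassE (Ω : Set Plane) (α β γ : Plane → ℝ) (M : ℝ) (φ : Plane → ℝ) : Prop where
  contDiff : ContDiffOn ℝ 2 φ Ω
  bounded : ∃ C : ℝ, ∀ x ∈ Ω, |φ x| ≤ C ∧ (∀ i, |pd i φ x| ≤ C) ∧ ∀ i j, |pd i (pd j φ) x| ≤ C
  symbol_le : ∀ᵐ y ∂(mu Ω), symbolA α β γ y (pd 0 φ y) (pd 1 φ y) ≤ 1
  hessian_le : ∀ x ∈ Ω, ∀ i j, |pd i (pd j φ) x| ≤ M

/-- The Finsler-type distance `d_M(x, x')`. -/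
def dM (Ω : Set Plane) (α β γ : Plane → ℝ) (M : ℝ) (x x' : Plane) : ℝ :=
  sSup {r : ℝ | ∃ φ : Plane → ℝ, ClassE Ω α β γ M φ ∧ r = φ x' - φ x}

/-- The function `k` in terms of the value `q` of `Q(x)`. -/
def kFun (q : ℝ) : ℝ :=
  if q < 0 then 8 * (1 - q) / (1 + q) ^ 2 else if q ≤ 3 then 8 else q ^ 2 - 1

/-- `k^* = sup_Ω k(Q(x))`, an essential supremum. -/
def kStar (Ω : Set Plane) (α β γ : Plane → ℝ) : ℝ :=
  essSup (fun x => kFun (ratioQ α β γ x)) (mu Ω)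

/-- `σ_* = (3/4) (1 / (4 k^*))^{1/3}`. -/
def sigmaStar (Ω : Set Plane) (α β γ : Plane → ℝ) : ℝ :=
  3 / 4 * (1 / (4 * kStar Ω α β γ)) ^ (1 / 3 : ℝ)

/-- The distance in `L^∞(Ω)` of `f` from the Lipschitz functions on `Ω`. -/
def distLip (Ω : Set Plane) (f : Plane → ℝ) : ℝ :=
  sInf {r : ℝ | 0 ≤ r ∧ ∃ (K : NNReal) (g : Plane → ℝ), LipschitzOnWith K g Ω ∧
    ∀ᵐ x ∂(mu Ω), |f x - g x| ≤ r}

/-- The constant `D`. -/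
def constD (Ω : Set Plane) (α β γ : Plane → ℝ) : ℝ :=
  max (distLip Ω α) (max (distLip Ω β) (distLip Ω γ))

end HeatKernelPlanar

end

/-!
# Heat kernel bounds for planar fourth order operators with a sharp constant

Elements of `H²₀(Ω)` are represented by their jets (`H20 Ω`, the closure of the jets of test
functions), so that weak derivatives are the components of an element of a closed subspace, and
every identity is verified on test functions and extended by continuity.

**Null Lagrangians.** The form changes only by lower order terms when `2 m (u₁₁ u₂₂ - |u₁₂|²)` is
added to its density, if the multiplier `m` is close to a Lipschitz function
(`abs_br_hess_hess_le`). With `ρ = √(αγ)` and a large `N`, the choice `m = (ρ + β) / N - ρ` makes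
the density positive definite in `(u₁₁, u₁₂, u₂₂)`; for `β ≥ 0` a small negative constant does the
same. This is Gårding's inequality (`exists_garding_of_constD_lt`, `garding_of_nonneg`), and it
implies that the form is closed (`Garding.formClosed`). Conversely, closedness implies Gårding's
inequality for some constant, by the open mapping theorem (`exists_resolvent`).

**The sharp constant.** For `ψ = λφ` the real part of `Q(e^ψ u, e^{-ψ} u)` is `Q` of the part of
`e^{-ψ} D² (e^ψ u)` that is even in `ψ`, minus `Q` of the odd part (`weightedForm_re`). The
products of first derivatives that occur in the odd part are integrated by parts, which turns the
leading terms into a quadratic form in `(D²u, u)` at each point. After the addition of the null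
Lagrangian with `m = (3ρ + β) / s - ρ`, `s² = 1 + k^*`, this form is bounded from below by
`-k^* λ⁴ A(x, ∇φ) |u|²`: the remainder is a sum of squares under the conditions on `s` that
define the function `k` (`sharp_symbol_nonneg`, `kFun_bounds`). The errors are of order `D` relative
to `‖D²u‖² + λ⁴ ‖u‖²`, and a small share of Gårding's inequality absorbs them
(`weighted_sharp`, `exists_weighted_lower`).

**From forms to kernels.** A closed form defines a holomorphic semigroup, constructed by the
continuous functional calculus of the resolvent (`FormClosed.exists_isHeatFlow`). The energy
estimate along rays, applied to `e^{-ψ} e^{-zH} e^ψ`, gives its growth in a sector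
(`norm_weightedFlow_le`), the Cauchy estimate for the derivative controls the second derivatives
(`hessSq_weightedFlow_le`), and the planar embedding `‖u‖²_∞ ≤ C ‖u‖ ‖D²u‖` (`supBound_le_sqrt`)
bounds the values at points. In this way evaluation of `e^{-tH/2} f` at a point is represented by a
vector of `L²(Ω)`, the heat kernel is the inner product of two such vectors, and Davies' method
gives `|G(x, x', t)| ≤ C t^{-1/2} exp (λ (φ(x) - φ(x')) + (1 + η) m t)` with `m` close to `k^* λ⁴`,
up to a constant (`norm_heatKernel_le`, `sqrt_prefactor_le`). The best `λ` gives the power `4/3` of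
the distance and the constant `(3/4) (4 k^*)^{-1/3}` (`exists_optimal_exponent`), and the bound
passes to the supremum over `φ` (`dM_mem_of_forall`). If `D` is not small, then the constant `c` is
such that the claimed exponent is nonpositive, and the bound without sharp constants suffices
(`exists_const_heatKernel_bound`).
-/


noncomputable section

namespace HeatKernelPlanar

/-! ### Multiplication by bounded real functions on `L²` -/

section Multiplication

open scoped ENNReal

variable {X : Type*} [MeasurableSpace X] {μ : Measure X}

/-- Multiplication by the real function `m` as an operator on `L²`; it is the zero operator unless
`m ∈ L^∞`. -/
def mulOp (μ : Measure X) (m : X → ℝ) : Lp ℂ 2 μ →L[ℂ] Lp ℂ 2 μ :=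
  open Classical in
  if hm : MemLp (fun x => (m x : ℂ)) ∞ μ then
    (ContinuousLinearMap.mul ℂ ℂ).holderL μ ∞ 2 2 (hm.toLp _) else 0

variable {m n : X → ℝ}

lemma bdd_ofReal (hm : MemLp m ∞ μ) : MemLp (fun x => (m x : ℂ)) ∞ μ := hm.ofReal

lemma mulOp_ae (hm : MemLp m ∞ μ) (f : Lp ℂ 2 μ) :
    mulOp μ m f =ᵐ[μ] fun x => (m x : ℂ) * f x := by
  have h := bdd_ofReal hm
  rw [mulOp, dif_pos h]
  have h1 := (ContinuousLinearMap.mul ℂ ℂ).coeFn_holder (r := 2) (h.toLp _) f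
  filter_upwards [h1, h.coeFn_toLp] with x hx hx2
  simpa [hx2] using hx

lemma norm_mulOp_le (hm : MemLp m ∞ μ) {C : ℝ} (hC : ∀ᵐ x ∂μ, |m x| ≤ C) (f : Lp ℂ 2 μ) :
    ‖mulOp μ m f‖ ≤ C * ‖f‖ := by
  apply Lp.norm_le_mul_norm_of_ae_le_mul
  filter_upwards [mulOp_ae hm f, hC] with x hx hx2
  rw [hx, norm_mul, Complex.norm_real, Real.norm_eq_abs]
  gcongr

lemma bdd_const (c : ℝ) : MemLp (fun _ : X => c) ∞ μ := memLp_top_const c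

lemma bdd_mul (hm : MemLp m ∞ μ) (hn : MemLp n ∞ μ) : MemLp (fun x => m x * n x) ∞ μ :=
  hn.mul hm

lemma bdd_add (hm : MemLp m ∞ μ) (hn : MemLp n ∞ μ) : MemLp (fun x => m x + n x) ∞ μ :=
  hm.add hn

lemma bdd_sub (hm : MemLp m ∞ μ) (hn : MemLp n ∞ μ) : MemLp (fun x => m x - n x) ∞ μ :=
  hm.sub hn

lemma bdd_const_mul (c : ℝ) (hm : MemLp m ∞ μ) : MemLp (fun x => c * m x) ∞ μ :=
  bdd_mul (bdd_const c) hm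

lemma bdd_pow (hm : MemLp m ∞ μ) (k : ℕ) : MemLp (fun x => m x ^ k) ∞ μ := by
  induction k with
  | zero => simpa using bdd_const (μ := μ) 1
  | succ k ih => simpa only [pow_succ] using bdd_mul ih hm

lemma bdd_of_le (hm : AEStronglyMeasurable m μ) {C : ℝ} (hC : ∀ᵐ x ∂μ, |m x| ≤ C) :
    MemLp m ∞ μ := memLp_top_of_bound hm C hC

lemma mulOp_mulOp (hm : MemLp m ∞ μ) (hn : MemLp n ∞ μ) (f : Lp ℂ 2 μ) :
    mulOp μ m (mulOp μ n f) = mulOp μ (fun x => m x * n x) f := by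
  apply Lp.ext
  filter_upwards [mulOp_ae hm (mulOp μ n f), mulOp_ae hn f, mulOp_ae (bdd_mul hm hn) f]
    with x h1 h2 h3
  rw [h1, h2, h3]; push_cast; ring

lemma mulOp_one (f : Lp ℂ 2 μ) : mulOp μ (fun _ => 1) f = f := by
  apply Lp.ext
  filter_upwards [mulOp_ae (bdd_const 1) f] with x h1
  rw [h1]; simp

lemma mulOp_congr (hm : MemLp m ∞ μ) (hn : MemLp n ∞ μ) (h : m =ᵐ[μ] n) (f : Lp ℂ 2 μ) :
    mulOp μ m f = mulOp μ n f := by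
  apply Lp.ext
  filter_upwards [mulOp_ae hm f, mulOp_ae hn f, h] with x h1 h2 h3
  rw [h1, h2, h3]

lemma mulOp_add_left (hm : MemLp m ∞ μ) (hn : MemLp n ∞ μ) (f : Lp ℂ 2 μ) :
    mulOp μ (fun x => m x + n x) f = mulOp μ m f + mulOp μ n f := by
  apply Lp.ext
  filter_upwards [mulOp_ae hm f, mulOp_ae hn f, mulOp_ae (bdd_add hm hn) f,
    Lp.coeFn_add (mulOp μ m f) (mulOp μ n f)] with x h1 h2 h3 h4
  rw [h3, h4, Pi.add_apply, h1, h2]; push_cast; ring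

lemma mulOp_const_mul (c : ℝ) (hm : MemLp m ∞ μ) (f : Lp ℂ 2 μ) :
    mulOp μ (fun x => c * m x) f = (c : ℂ) • mulOp μ m f := by
  apply Lp.ext
  filter_upwards [mulOp_ae hm f, mulOp_ae (bdd_const_mul c hm) f,
    Lp.coeFn_smul (c : ℂ) (mulOp μ m f)] with x h1 h2 h4
  rw [h2, h4, Pi.smul_apply, h1, smul_eq_mul]; push_cast; ring

/-- The real bracket `∫ m Re (f conj g)`, for a bounded real function `m`. -/
def br (μ : Measure X) (m : X → ℝ) (f g : Lp ℂ 2 μ) : ℝ := (inner ℂ g (mulOp μ m f)).re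

variable {f g f' g' : Lp ℂ 2 μ}

lemma inner_mulOp (hm : MemLp m ∞ μ) (f g : Lp ℂ 2 μ) :
    Integrable (fun x => (m x : ℂ) * (f x * starRingEnd ℂ (g x))) μ ∧
    inner ℂ g (mulOp μ m f) = ∫ x, (m x : ℂ) * (f x * starRingEnd ℂ (g x)) ∂μ := by
  have h : (fun x => (inner ℂ (g x) (mulOp μ m f x) : ℂ)) =ᵐ[μ]
      fun x => (m x : ℂ) * (f x * starRingEnd ℂ (g x)) := by
    filter_upwards [mulOp_ae hm f] with x hx
    rw [hx, RCLike.inner_apply]; ring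
  refine ⟨(L2.integrable_inner g (mulOp μ m f)).congr h, ?_⟩
  rw [L2.inner_def, integral_congr_ae h]

lemma br_eq_integral (hm : MemLp m ∞ μ) (f g : Lp ℂ 2 μ) :
    Integrable (fun x => m x * (f x * starRingEnd ℂ (g x)).re) μ ∧
    br μ m f g = ∫ x, m x * (f x * starRingEnd ℂ (g x)).re ∂μ := by
  obtain ⟨h1, h2⟩ := inner_mulOp hm f g
  have h3 : (fun x => ((m x : ℂ) * (f x * starRingEnd ℂ (g x))).re) =
      fun x => m x * (f x * starRingEnd ℂ (g x)).re := by
    ext x; rw [Complex.re_ofReal_mul]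
  refine ⟨h3 ▸ h1.re, ?_⟩
  rw [br, h2, ← h3]
  exact (integral_re h1).symm

lemma br_add_left : br μ m (f + f') g = br μ m f g + br μ m f' g := by
  simp [br, inner_add_right]

lemma br_add_right : br μ m f (g + g') = br μ m f g + br μ m f g' := by
  simp [br, inner_add_left]

lemma br_comm (hm : MemLp m ∞ μ) : br μ m f g = br μ m g f := by
  rw [(br_eq_integral hm f g).2, (br_eq_integral hm g f).2]
  congr 1; ext x; simp only [Complex.mul_re, Complex.conj_re, Complex.conj_im]; ring

lemma br_mulOp_left (hm : MemLp m ∞ μ) (hn : MemLp n ∞ μ) :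
    br μ m (mulOp μ n f) g = br μ (fun x => m x * n x) f g := by
  rw [br, mulOp_mulOp hm hn, br]

lemma br_mulOp_right (hm : MemLp m ∞ μ) (hn : MemLp n ∞ μ) :
    br μ m f (mulOp μ n g) = br μ (fun x => m x * n x) f g := by
  rw [br_comm hm, br_mulOp_left hm hn, br_comm (bdd_mul hm hn)]

lemma br_fun_add (hm : MemLp m ∞ μ) (hn : MemLp n ∞ μ) :
    br μ (fun x => m x + n x) f g = br μ m f g + br μ n f g := by
  simp [br, mulOp_add_left hm hn, inner_add_right]

lemma br_fun_const_mul (c : ℝ) (hm : MemLp m ∞ μ) :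
    br μ (fun x => c * m x) f g = c * br μ m f g := by
  rw [br, mulOp_const_mul c hm, inner_smul_right, Complex.re_ofReal_mul, br]

lemma br_fun_sub (hm : MemLp m ∞ μ) (hn : MemLp n ∞ μ) :
    br μ (fun x => m x - n x) f g = br μ m f g - br μ n f g := by
  have h : (fun x => m x - n x) = fun x => m x + (-1) * n x := by ext x; ring
  rw [h, br_fun_add hm (bdd_const_mul _ hn), br_fun_const_mul _ hn]; ring

lemma abs_br_le (hm : MemLp m ∞ μ) {C : ℝ} (hC : ∀ᵐ x ∂μ, |m x| ≤ C) (f g : Lp ℂ 2 μ) :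
    |br μ m f g| ≤ C * (‖f‖ * ‖g‖) :=
  calc |br μ m f g| ≤ ‖inner ℂ g (mulOp μ m f)‖ := Complex.abs_re_le_norm _
    _ ≤ ‖g‖ * ‖mulOp μ m f‖ := norm_inner_le_norm _ _
    _ ≤ ‖g‖ * (C * ‖f‖) := by gcongr; exact norm_mulOp_le hm hC f
    _ = _ := by ring

lemma br_const (c : ℝ) : br μ (fun _ => c) f f = c * ‖f‖ ^ 2 := by
  have h : (fun _ : X => c) = fun x => c * (fun _ : X => (1 : ℝ)) x := by ext; simp
  rw [h, br_fun_const_mul c (bdd_const 1), br, mulOp_one]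
  exact congrArg (c * ·) (norm_sq_eq_re_inner (𝕜 := ℂ) f).symm

lemma br_self_le (hm : MemLp m ∞ μ) {C : ℝ} (hC : ∀ᵐ x ∂μ, m x ≤ C) (f : Lp ℂ 2 μ) :
    br μ m f f ≤ C * ‖f‖ ^ 2 := by
  rw [← br_const, (br_eq_integral hm f f).2, (br_eq_integral (bdd_const C) f f).2]
  apply integral_mono_ae (br_eq_integral hm f f).1 (br_eq_integral (bdd_const C) f f).1
  filter_upwards [hC] with x hx
  apply mul_le_mul_of_nonneg_right hx
  rw [Complex.mul_conj]; exact_mod_cast Complex.normSq_nonneg _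

lemma continuous_br (m : X → ℝ) {Y : Type*} [TopologicalSpace Y] {F G : Y → Lp ℂ 2 μ}
    (hF : Continuous F) (hG : Continuous G) : Continuous fun y => br μ m (F y) (G y) := by
  unfold br
  exact Complex.continuous_re.comp (hG.inner ((mulOp μ m).continuous.comp hF))

/-- A quadratic form with bounded coefficients that is pointwise nonnegative on real vectors is
nonnegative on `L²`: the real and imaginary parts contribute separately. -/
lemma sum_br_nonneg {ι : Type*} [Fintype ι] (K : ι → ι → X → ℝ) (hK : ∀ i j, MemLp (K i j) ∞ μ)
    (f : ι → Lp ℂ 2 μ)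
    (h : ∀ᵐ x ∂μ, ∀ y : ι → ℝ, 0 ≤ ∑ i, ∑ j, K i j x * (y i * y j)) :
    0 ≤ ∑ i, ∑ j, br μ (K i j) (f i) (f j) := by
  have h1 : ∑ i, ∑ j, br μ (K i j) (f i) (f j) =
      ∫ x, ∑ i, ∑ j, K i j x * (f i x * starRingEnd ℂ (f j x)).re ∂μ := by
    rw [integral_finsetSum _ fun i _ => integrable_finsetSum _ fun j _ =>
      (br_eq_integral (hK i j) (f i) (f j)).1]
    refine Finset.sum_congr rfl fun i _ => ?_
    rw [integral_finsetSum _ fun j _ => (br_eq_integral (hK i j) (f i) (f j)).1]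
    exact Finset.sum_congr rfl fun j _ => (br_eq_integral (hK i j) (f i) (f j)).2
  rw [h1]
  apply integral_nonneg_of_ae
  filter_upwards [h] with x hx
  have h2 := add_nonneg (hx fun i => (f i x).re) (hx fun i => (f i x).im)
  rw [← Finset.sum_add_distrib] at h2
  simp_rw [← Finset.sum_add_distrib] at h2
  refine h2.trans_eq (Finset.sum_congr rfl fun i _ => Finset.sum_congr rfl fun j _ => ?_)
  simp [Complex.mul_re]; ring

end Multiplication

/-! ### The space `H²₀(Ω)` as a closed space of jets -/

section Jets

open scoped ContDiff

variable {Ω : Set Plane}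

/-- Triples consisting of a function, its two first and its four second derivatives, all in
`L²(Ω)`. -/
abbrev JetL2 (Ω : Set Plane) : Type := L2 Ω × (Fin 2 → L2 Ω) × (Fin 2 → Fin 2 → L2 Ω)

/-- The class of `f` in `L²(Ω)`, or `0` if `f` is not square integrable. -/
def toL2 (Ω : Set Plane) (f : Plane → ℂ) : L2 Ω :=
  open Classical in if h : MemLp f 2 (mu Ω) then h.toLp f else 0

lemma toL2_ae {f : Plane → ℂ} (hf : MemLp f 2 (mu Ω)) : toL2 Ω f =ᵐ[mu Ω] f := by
  rw [toL2, dif_pos hf]; exact hf.coeFn_toLp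

/-- The classes in `L²(Ω)` of a function and its derivatives of order at most two. -/
def jet (Ω : Set Plane) (ζ : Plane → ℂ) : JetL2 Ω :=
  (toL2 Ω ζ, fun i => toL2 Ω (pd i ζ), fun i j => toL2 Ω (pd i (pd j ζ)))

section pd

variable {F : Type*} [NormedAddCommGroup F] [NormedSpace ℝ F]

lemma contDiff_pd {m n : WithTop ℕ∞} {f : Plane → F} (hf : ContDiff ℝ n f) (hmn : m + 1 ≤ n)
    (i : Fin 2) : ContDiff ℝ m (pd i f) :=
  (hf.fderiv_right hmn).clm_apply contDiff_const

lemma hasCompactSupport_pd {f : Plane → F} (hf : HasCompactSupport f) (i : Fin 2) :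
    HasCompactSupport (pd i f) := by
  refine (hf.fderiv ℝ).comp_left (g := fun L : Plane →L[ℝ] F => L (EuclideanSpace.single i 1)) ?_
  simp

lemma tsupport_pd_subset (f : Plane → F) (i : Fin 2) : tsupport (pd i f) ⊆ tsupport f := by
  refine (closure_mono fun x hx => ?_).trans (tsupport_fderiv_subset ℝ (f := f))
  intro h
  exact hx (by simp [pd, h])

lemma pd_add {f g : Plane → F} {x : Plane} (hf : DifferentiableAt ℝ f x)
    (hg : DifferentiableAt ℝ g x) (i : Fin 2) :
    pd i (fun y => f y + g y) x = pd i f x + pd i g x := by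
  simp [pd, fderiv_fun_add hf hg]

lemma pd_congr {f g : Plane → F} {x : Plane} (h : f =ᶠ[𝓝 x] g) (i : Fin 2) :
    pd i f x = pd i g x := by
  simp [pd, h.fderiv_eq]

lemma pd_mul {𝔸 : Type*} [NormedCommRing 𝔸] [NormedAlgebra ℝ 𝔸] {f g : Plane → 𝔸} {x : Plane}
    (hf : DifferentiableAt ℝ f x) (hg : DifferentiableAt ℝ g x) (i : Fin 2) :
    pd i (fun y => f y * g y) x = f x * pd i g x + g x * pd i f x := by
  simp [pd, fderiv_fun_mul hf hg]

lemma pd_ofReal {f : Plane → ℝ} {x : Plane} (hf : DifferentiableAt ℝ f x) (i : Fin 2) :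
    pd i (fun y => (f y : ℂ)) x = ((pd i f x : ℝ) : ℂ) := by
  have h := (Complex.ofRealCLM.hasFDerivAt.comp x hf.hasFDerivAt).fderiv
  have h2 : (Complex.ofRealCLM ∘ f) = fun y => (f y : ℂ) := rfl
  rw [pd, ← h2, h]; rfl

lemma pd_comm {f : Plane → F} (hf : ContDiff ℝ 2 f) (i j : Fin 2) (x : Plane) :
    pd i (pd j f) x = pd j (pd i f) x := by
  have h2 : ∀ k l : Fin 2, pd k (pd l f) x =
      fderiv ℝ (fderiv ℝ f) x (EuclideanSpace.single k 1) (EuclideanSpace.single l 1) := by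
    intro k l
    have hd : DifferentiableAt ℝ (fderiv ℝ f) x :=
      (hf.fderiv_right (m := 1) (by norm_num)).differentiable (by norm_num) x
    have : pd l f = fun y => fderiv ℝ f y (EuclideanSpace.single l 1) := rfl
    rw [pd, this, fderiv_clm_apply hd (by fun_prop)]
    simp
  rw [h2, h2]
  exact (hf.contDiffAt.isSymmSndFDerivAt (by simp)).eq _ _

end pd

/-- A compactly supported `C²` function with support in `Ω`. -/
structure IsC2c (Ω : Set Plane) (ζ : Plane → ℂ) : Prop where
  smooth : ContDiff ℝ 2 ζ
  compact : HasCompactSupport ζ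
  supp : tsupport ζ ⊆ Ω

lemma IsTest.isC2c {ζ : Plane → ℂ} (h : IsTest Ω ζ) : IsC2c Ω ζ :=
  ⟨h.smooth.of_le ENat.LEInfty.out, h.compact, h.supp⟩

lemma IsTest.pd {ζ : Plane → ℂ} (h : IsTest Ω ζ) (i : Fin 2) : IsTest Ω (pd i ζ) :=
  ⟨contDiff_pd h.smooth (by norm_num) i, hasCompactSupport_pd h.compact i,
    (tsupport_pd_subset ζ i).trans h.supp⟩

lemma memLp_of_continuous {f : Plane → ℂ} (hf : Continuous f) (hc : HasCompactSupport f) :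
    MemLp f 2 (mu Ω) :=
  (hf.memLp_of_hasCompactSupport hc).restrict Ω

section

variable {ζ : Plane → ℂ} (h : IsC2c Ω ζ)
include h

lemma IsC2c.continuous_pd (i : Fin 2) : Continuous (HeatKernelPlanar.pd i ζ) :=
  (contDiff_pd (m := 1) h.smooth (by norm_num) i).continuous

lemma IsC2c.continuous_pd_pd (i j : Fin 2) :
    Continuous (HeatKernelPlanar.pd i (HeatKernelPlanar.pd j ζ)) :=
  (contDiff_pd (m := 0) (contDiff_pd (m := 1) h.smooth (by norm_num) j) (by norm_num) i).continuous

lemma IsC2c.memLp : MemLp ζ 2 (mu Ω) := memLp_of_continuous h.smooth.continuous h.compact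

lemma IsC2c.memLp_pd (i : Fin 2) : MemLp (HeatKernelPlanar.pd i ζ) 2 (mu Ω) :=
  memLp_of_continuous (h.continuous_pd i) (hasCompactSupport_pd h.compact i)

lemma IsC2c.memLp_pd_pd (i j : Fin 2) :
    MemLp (HeatKernelPlanar.pd i (HeatKernelPlanar.pd j ζ)) 2 (mu Ω) :=
  memLp_of_continuous (h.continuous_pd_pd i j)
    (hasCompactSupport_pd (hasCompactSupport_pd h.compact j) i)

end

lemma IsTest.add {ζ η : Plane → ℂ} (h : IsTest Ω ζ) (h' : IsTest Ω η) :
    IsTest Ω (fun x => ζ x + η x) :=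
  ⟨h.smooth.add h'.smooth, h.compact.add h'.compact,
    (tsupport_add ζ η).trans (union_subset h.supp h'.supp)⟩

lemma IsTest.const_mul (c : ℂ) {ζ : Plane → ℂ} (h : IsTest Ω ζ) : IsTest Ω (fun x => c * ζ x) :=
  ⟨contDiff_const.mul h.smooth, h.compact.mul_left,
    (tsupport_mul_subset_right (f := fun _ => c)).trans h.supp⟩

lemma IsTest.zero : IsTest Ω (fun _ => 0) :=
  ⟨contDiff_const, HasCompactSupport.zero, by
    have : tsupport (fun _ : Plane => (0 : ℂ)) = ∅ := tsupport_eq_empty_iff.2 rfl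
    simp [this]⟩

lemma toL2_add {f g : Plane → ℂ} (hf : MemLp f 2 (mu Ω)) (hg : MemLp g 2 (mu Ω)) :
    toL2 Ω (fun x => f x + g x) = toL2 Ω f + toL2 Ω g := by
  have hfg : MemLp (fun x => f x + g x) 2 (mu Ω) := hf.add hg
  rw [toL2, toL2, toL2, dif_pos hf, dif_pos hg, dif_pos hfg]; rfl

lemma toL2_const_mul (c : ℂ) {f : Plane → ℂ} (hf : MemLp f 2 (mu Ω)) :
    toL2 Ω (fun x => c * f x) = c • toL2 Ω f := by
  have hcf : MemLp (fun x => c * f x) 2 (mu Ω) := hf.const_mul c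
  rw [toL2, toL2, dif_pos hf, dif_pos hcf]; rfl

lemma pd_const_mul (c : ℂ) {f : Plane → ℂ} (hf : Differentiable ℝ f) (i : Fin 2) :
    pd i (fun y => c * f y) = fun y => c * pd i f y := by
  ext x
  rw [pd_mul (by fun_prop) (hf x)]
  simp [pd]

lemma pd_fun_add {f g : Plane → ℂ} (hf : Differentiable ℝ f) (hg : Differentiable ℝ g)
    (i : Fin 2) : pd i (fun y => f y + g y) = fun y => pd i f y + pd i g y := by
  ext x; exact pd_add (hf x) (hg x) i

lemma IsTest.differentiable {ζ : Plane → ℂ} (h : IsTest Ω ζ) : Differentiable ℝ ζ :=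
  h.smooth.differentiable (by simp)

lemma jet_add {ζ η : Plane → ℂ} (h : IsTest Ω ζ) (h' : IsTest Ω η) :
    jet Ω (fun x => ζ x + η x) = jet Ω ζ + jet Ω η := by
  ext1
  · exact toL2_add h.isC2c.memLp h'.isC2c.memLp
  ext1
  · funext i
    change toL2 Ω (pd i fun x => ζ x + η x) = _
    rw [pd_fun_add h.differentiable h'.differentiable]
    exact toL2_add (h.isC2c.memLp_pd i) (h'.isC2c.memLp_pd i)
  · funext i j
    change toL2 Ω (pd i (pd j fun x => ζ x + η x)) = _
    rw [pd_fun_add h.differentiable h'.differentiable,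
      pd_fun_add (h.pd j).differentiable (h'.pd j).differentiable]
    exact toL2_add (h.isC2c.memLp_pd_pd i j) (h'.isC2c.memLp_pd_pd i j)

lemma jet_const_mul (c : ℂ) {ζ : Plane → ℂ} (h : IsTest Ω ζ) :
    jet Ω (fun x => c * ζ x) = c • jet Ω ζ := by
  ext1
  · exact toL2_const_mul c h.isC2c.memLp
  ext1
  · funext i
    change toL2 Ω (pd i fun x => c * ζ x) = _
    rw [pd_const_mul c h.differentiable]
    exact toL2_const_mul c (h.isC2c.memLp_pd i)
  · funext i j
    change toL2 Ω (pd i (pd j fun x => c * ζ x)) = _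
    rw [pd_const_mul c h.differentiable, pd_const_mul c (h.pd j).differentiable]
    exact toL2_const_mul c (h.isC2c.memLp_pd_pd i j)

/-- The jets of test functions. -/
def testJets (Ω : Set Plane) : Submodule ℂ (JetL2 Ω) where
  carrier := {F | ∃ ζ, IsTest Ω ζ ∧ jet Ω ζ = F}
  add_mem' := by
    rintro _ _ ⟨ζ, hζ, rfl⟩ ⟨η, hη, rfl⟩
    exact ⟨_, hζ.add hη, jet_add hζ hη⟩
  zero_mem' := by
    refine ⟨fun x => 0 * (0 : ℂ), by simpa using IsTest.zero, ?_⟩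
    rw [jet_const_mul 0 IsTest.zero, zero_smul]
  smul_mem' := by
    rintro c _ ⟨ζ, hζ, rfl⟩
    exact ⟨_, hζ.const_mul c, jet_const_mul c hζ⟩

/-- `H²₀(Ω)`, as the space of the jets of its elements. -/
def H20 (Ω : Set Plane) : Submodule ℂ (JetL2 Ω) := (testJets Ω).topologicalClosure

lemma isClosed_H20 : IsClosed (H20 Ω : Set (JetL2 Ω)) := (testJets Ω).isClosed_topologicalClosure

instance : CompleteSpace (H20 Ω) := isClosed_H20.completeSpace_coe

lemma jet_mem_H20 {ζ : Plane → ℂ} (h : IsTest Ω ζ) : jet Ω ζ ∈ H20 Ω :=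
  (testJets Ω).le_topologicalClosure ⟨ζ, h, rfl⟩

/-- A closed property of jets that holds for test functions holds on `H²₀(Ω)`. -/
lemma H20_induction {P : JetL2 Ω → Prop} (hc : IsClosed {F | P F})
    (h : ∀ ζ, IsTest Ω ζ → P (jet Ω ζ)) {F : JetL2 Ω} (hF : F ∈ H20 Ω) : P F := by
  have : (testJets Ω : Set (JetL2 Ω)) ⊆ {F | P F} := by
    rintro _ ⟨ζ, hζ, rfl⟩; exact h ζ hζ
  exact closure_minimal this hc hF

lemma tendsto_toL2 {f : ℕ → Plane → ℂ} (hf : ∀ n, MemLp (f n) 2 (mu Ω)) (g : L2 Ω) :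
    Tendsto (fun n => toL2 Ω (f n)) atTop (𝓝 g) ↔
      Tendsto (fun n => eLpNorm (fun x => f n x - g x) 2 (mu Ω)) atTop (𝓝 0) := by
  rw [Lp.tendsto_Lp_iff_tendsto_eLpNorm']
  refine tendsto_congr fun n => eLpNorm_congr_ae ?_
  filter_upwards [toL2_ae (hf n)] with x hx
  simp [hx]

/-- The closure in `H²` of the test functions is the closed space `H20 Ω` of jets. -/
lemma inH20_iff (u : L2 Ω) (g : Fin 2 → L2 Ω) (h : Fin 2 → Fin 2 → L2 Ω) :
    InH20 Ω u g h ↔ (u, g, h) ∈ H20 Ω := by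
  have key : ∀ φ : ℕ → Plane → ℂ, (∀ n, IsTest Ω (φ n)) →
      (Tendsto (fun n => jet Ω (φ n)) atTop (𝓝 (u, g, h)) ↔
      Tendsto (fun n => eLpNorm (fun x => φ n x - u x) 2 (mu Ω)) atTop (𝓝 0) ∧
      (∀ i, Tendsto (fun n => eLpNorm (fun x => pd i (φ n) x - g i x) 2 (mu Ω)) atTop (𝓝 0)) ∧
      (∀ i j, Tendsto (fun n => eLpNorm (fun x => pd i (pd j (φ n)) x - h i j x) 2 (mu Ω))
      atTop (𝓝 0))) := by
    intro φ hφ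
    rw [nhds_prod_eq, nhds_prod_eq, tendsto_prod_iff', tendsto_prod_iff']
    refine and_congr (tendsto_toL2 (fun n => (hφ n).isC2c.memLp) u) (and_congr ?_ ?_)
    · rw [tendsto_pi_nhds]
      exact forall_congr' fun i => tendsto_toL2 (fun n => (hφ n).isC2c.memLp_pd i) (g i)
    · rw [tendsto_pi_nhds]
      refine forall_congr' fun i => ?_
      rw [tendsto_pi_nhds]
      exact forall_congr' fun j => tendsto_toL2 (fun n => (hφ n).isC2c.memLp_pd_pd i j) (h i j)
  constructor
  · rintro ⟨φ, hφ, h1⟩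
    exact mem_closure_of_tendsto ((key φ hφ).2 h1) (Eventually.of_forall fun n => ⟨_, hφ n, rfl⟩)
  · intro hm
    obtain ⟨x, hx, hlim⟩ := mem_closure_iff_seq_limit.1 hm
    choose φ hφ hφx using hx
    refine ⟨φ, hφ, (key φ hφ).1 ?_⟩
    simpa only [hφx] using hlim

/-- Test functions have dense span in `L²(Ω)`: nothing is orthogonal to all of them. -/
lemma eq_zero_of_inner_test (hΩ : IsOpen Ω) (f : L2 Ω)
    (h : ∀ ζ : Plane → ℂ, IsTest Ω ζ → inner ℂ (toL2 Ω ζ) f = 0) : f = 0 := by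
  have hloc : LocallyIntegrableOn f Ω volume := by
    rw [locallyIntegrableOn_iff hΩ.isLocallyClosed]
    intro k hk hkc
    have h1 : IntegrableOn f k (mu Ω) := by
      have : IsFiniteMeasure ((mu Ω).restrict k) := ⟨by
        rw [Measure.restrict_apply_univ]
        exact (Measure.restrict_apply_le _ _).trans_lt hkc.measure_lt_top⟩
      exact ((Lp.memLp f).restrict k).integrable (by norm_num)
    rwa [IntegrableOn, Measure.restrict_restrict_of_subset hk] at h1
  have h1 := hΩ.ae_eq_zero_of_integral_contDiff_smul_eq_zero hloc fun g hg hgc hgs => by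
    have hT : IsTest Ω (fun x => (g x : ℂ)) :=
      ⟨Complex.ofRealCLM.contDiff.comp hg, hgc.comp_left (g := fun r : ℝ => (r : ℂ)) (by simp), by
        refine (closure_mono fun x hx => ?_).trans hgs
        intro h0; exact hx (by simp [h0])⟩
    have h2 := h _ hT
    rw [L2.inner_def] at h2
    rw [← setIntegral_eq_integral_of_forall_compl_eq_zero (s := Ω), ← h2]
    · refine integral_congr_ae ?_
      filter_upwards [toL2_ae hT.isC2c.memLp] with x hx
      rw [hx, RCLike.inner_apply]; simp [mul_comm]
    · intro x hx
      have : g x = 0 := by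
        by_contra hne
        exact hx (hgs (subset_tsupport g hne))
      simp [this]
  apply Lp.ext
  filter_upwards [(ae_restrict_iff' hΩ.measurableSet).2 h1, Lp.coeFn_zero ℂ 2 (mu Ω)] with x hx hx2
  rw [hx, hx2]; rfl

end Jets

/-! ### Integration by parts -/

section IntegrationByParts

open scoped ContDiff ENNReal

variable {Ω : Set Plane}

/-- `n ∈ C¹(Ω)` is real and bounded together with its first derivatives. -/
structure IsC1b (Ω : Set Plane) (n : Plane → ℝ) : Prop where
  contDiffOn : ContDiffOn ℝ 1 n Ω
  bound : ∃ C : ℝ, ∀ x ∈ Ω, |n x| ≤ C ∧ ∀ i, |pd i n x| ≤ C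

lemma continuousOn_pd {n : Plane → ℝ} (hΩ : IsOpen Ω) (hn : ContDiffOn ℝ 1 n Ω) (i : Fin 2) :
    ContinuousOn (pd i n) Ω :=
  (hn.continuousOn_fderiv_of_isOpen hΩ le_rfl).clm_apply continuousOn_const

lemma bdd_of_continuousOn {n : Plane → ℝ} (hΩ : IsOpen Ω) (hn : ContinuousOn n Ω) {C : ℝ}
    (hC : ∀ x ∈ Ω, |n x| ≤ C) : MemLp n ∞ (mu Ω) :=
  bdd_of_le (hn.aestronglyMeasurable hΩ.measurableSet)
    ((ae_restrict_iff' hΩ.measurableSet).2 (Eventually.of_forall hC))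

lemma IsC1b.bdd {n : Plane → ℝ} (hΩ : IsOpen Ω) (hn : IsC1b Ω n) : MemLp n ∞ (mu Ω) := by
  obtain ⟨C, hC⟩ := hn.bound
  exact bdd_of_continuousOn hΩ hn.contDiffOn.continuousOn fun x hx => (hC x hx).1

lemma IsC1b.bdd_pd {n : Plane → ℝ} (hΩ : IsOpen Ω) (hn : IsC1b Ω n) (i : Fin 2) :
    MemLp (pd i n) ∞ (mu Ω) := by
  obtain ⟨C, hC⟩ := hn.bound
  exact bdd_of_continuousOn hΩ (continuousOn_pd hΩ hn.contDiffOn i) fun x hx => (hC x hx).2 i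

lemma isC1b_const (c : ℝ) : IsC1b Ω (fun _ => c) :=
  ⟨contDiffOn_const, |c|, fun x _ => ⟨le_rfl, fun i => by simp [pd]⟩⟩

lemma ContDiffOn.differentiableAt_of_isOpen {n : Plane → ℝ} (hΩ : IsOpen Ω)
    (hn : ContDiffOn ℝ 1 n Ω) {x : Plane} (hx : x ∈ Ω) : DifferentiableAt ℝ n x :=
  (hn.contDiffAt (hΩ.mem_nhds hx)).differentiableAt (by simp)

lemma IsC1b.mul {m n : Plane → ℝ} (hΩ : IsOpen Ω) (hm : IsC1b Ω m) (hn : IsC1b Ω n) :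
    IsC1b Ω (fun x => m x * n x) := by
  refine ⟨hm.contDiffOn.mul hn.contDiffOn, ?_⟩
  obtain ⟨C, hC⟩ := hm.bound
  obtain ⟨C', hC'⟩ := hn.bound
  refine ⟨C * C' + C' * C, fun x hx => ?_⟩
  obtain ⟨h1, h2⟩ := hC x hx
  obtain ⟨h3, h4⟩ := hC' x hx
  have hC0 := (abs_nonneg _).trans h1
  have hC0' := (abs_nonneg _).trans h3
  constructor
  · rw [abs_mul]
    have := mul_le_mul h1 h3 (abs_nonneg _) hC0
    nlinarith [mul_nonneg hC0 hC0']
  · intro i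
    rw [pd_mul (ContDiffOn.differentiableAt_of_isOpen hΩ hm.contDiffOn hx)
      (ContDiffOn.differentiableAt_of_isOpen hΩ hn.contDiffOn hx)]
    refine (abs_add_le _ _).trans (add_le_add ?_ ?_) <;> rw [abs_mul]
    · exact mul_le_mul h1 (h4 i) (abs_nonneg _) hC0
    · exact mul_le_mul h3 (h2 i) (abs_nonneg _) hC0'

lemma IsC1b.add {m n : Plane → ℝ} (hΩ : IsOpen Ω) (hm : IsC1b Ω m) (hn : IsC1b Ω n) :
    IsC1b Ω (fun x => m x + n x) := by
  refine ⟨hm.contDiffOn.add hn.contDiffOn, ?_⟩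
  obtain ⟨C, hC⟩ := hm.bound
  obtain ⟨C', hC'⟩ := hn.bound
  refine ⟨C + C', fun x hx => ⟨?_, fun i => ?_⟩⟩
  · exact (abs_add_le _ _).trans (add_le_add (hC x hx).1 (hC' x hx).1)
  · rw [pd_add (ContDiffOn.differentiableAt_of_isOpen hΩ hm.contDiffOn hx)
      (ContDiffOn.differentiableAt_of_isOpen hΩ hn.contDiffOn hx)]
    exact (abs_add_le _ _).trans (add_le_add ((hC x hx).2 i) ((hC' x hx).2 i))

/-- The square root of a function bounded away from zero. -/
lemma IsC1b.sqrt {m : Plane → ℝ} (hΩ : IsOpen Ω) (hm : IsC1b Ω m) {a : ℝ} (ha : 0 < a)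
    (hma : ∀ x ∈ Ω, a ≤ m x) : IsC1b Ω (fun x => Real.sqrt (m x)) := by
  have hne : ∀ x ∈ Ω, m x ≠ 0 := fun x hx => (ha.trans_le (hma x hx)).ne'
  refine ⟨hm.contDiffOn.sqrt hne, ?_⟩
  obtain ⟨C, hC⟩ := hm.bound
  refine ⟨Real.sqrt C + (2 * Real.sqrt a)⁻¹ * C, fun x hx => ?_⟩
  obtain ⟨h1, h2⟩ := hC x hx
  have hC0 := (abs_nonneg _).trans h1
  have hsa := Real.sqrt_pos.2 ha
  constructor
  · rw [abs_of_nonneg (Real.sqrt_nonneg _)]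
    have := Real.sqrt_le_sqrt ((le_abs_self _).trans h1)
    have : 0 ≤ (2 * Real.sqrt a)⁻¹ * C := by positivity
    linarith
  · intro i
    have hd := (ContDiffOn.differentiableAt_of_isOpen hΩ hm.contDiffOn hx).hasFDerivAt.sqrt
      (hne x hx)
    rw [pd, hd.fderiv]
    have h3 : Real.sqrt a ≤ Real.sqrt (m x) := Real.sqrt_le_sqrt (hma x hx)
    have h4 : |(1 / (2 * Real.sqrt (m x))) * pd i m x| ≤ (2 * Real.sqrt a)⁻¹ * C := by
      rw [abs_mul, abs_of_nonneg (by positivity), one_div]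
      gcongr
      exact h2 i
    refine le_trans ?_ (h4.trans (le_add_of_nonneg_left (Real.sqrt_nonneg _)))
    simp [pd]

/-- Integration by parts against a compactly supported function. -/
lemma integral_mul_pd (hΩ : IsOpen Ω) {n G : Plane → ℝ} (hn : IsC1b Ω n) (hG : ContDiff ℝ 1 G)
    (hGc : HasCompactSupport G) (hGs : tsupport G ⊆ Ω) (i : Fin 2) :
    Integrable (fun x => n x * pd i G x) (mu Ω) ∧ Integrable (fun x => pd i n x * G x) (mu Ω) ∧
    ∫ x, n x * pd i G x ∂(mu Ω) = - ∫ x, pd i n x * G x ∂(mu Ω) := by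
  have hpG : Continuous (pd i G) := (contDiff_pd (m := 0) hG (by norm_num) i).continuous
  have hpGs := (tsupport_pd_subset G i).trans hGs
  have aux : ∀ {m H : Plane → ℝ}, MemLp m ∞ (mu Ω) → Continuous H → HasCompactSupport H →
      tsupport H ⊆ Ω → Integrable (fun x => m x * H x) (mu Ω) ∧
      Integrable (fun x => m x * H x) ∧ ∫ x, m x * H x ∂(mu Ω) = ∫ x, m x * H x := by
    intro m H hm hH hHc hHs
    have h0 : ∀ x, x ∉ Ω → m x * H x = 0 := fun x hx => by
      rw [image_eq_zero_of_notMem_tsupport fun h => hx (hHs h), mul_zero]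
    have h1 : MemLp H 1 (mu Ω) := memLp_one_iff_integrable.2
      (hH.integrable_of_hasCompactSupport hHc).restrict
    have h2 : Integrable (fun x => m x * H x) (mu Ω) := memLp_one_iff_integrable.1 (h1.mul hm)
    refine ⟨h2, ?_, setIntegral_eq_integral_of_forall_compl_eq_zero h0⟩
    exact (integrableOn_iff_integrable_of_support_subset fun x hx => by
      by_contra h; exact hx (h0 x h)).1 h2
  obtain ⟨a1, a2, a3⟩ := aux (hn.bdd hΩ) hpG (hasCompactSupport_pd hGc i) hpGs
  obtain ⟨b1, b2, b3⟩ := aux (hn.bdd_pd hΩ i) hG.continuous hGc hGs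
  obtain ⟨-, c2, -⟩ := aux (hn.bdd hΩ) hG.continuous hGc hGs
  refine ⟨a1, b1, ?_⟩
  rw [a3, b3]
  exact integral_mul_fderiv_eq_neg_fderiv_mul_of_integrable b2 a2 c2
    (fun x hx => ContDiffOn.differentiableAt_of_isOpen hΩ hn.contDiffOn (hGs hx))
    (fun x _ => hG.differentiable (by simp) x)

lemma br_toL2 {m : Plane → ℝ} (hm : MemLp m ∞ (mu Ω)) {f g : Plane → ℂ}
    (hf : MemLp f 2 (mu Ω)) (hg : MemLp g 2 (mu Ω)) :
    Integrable (fun x => m x * (f x * starRingEnd ℂ (g x)).re) (mu Ω) ∧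
    br (mu Ω) m (toL2 Ω f) (toL2 Ω g) = ∫ x, m x * (f x * starRingEnd ℂ (g x)).re ∂(mu Ω) := by
  obtain ⟨h1, h2⟩ := br_eq_integral hm (toL2 Ω f) (toL2 Ω g)
  have h : (fun x => m x * (toL2 Ω f x * starRingEnd ℂ (toL2 Ω g x)).re) =ᵐ[mu Ω]
      fun x => m x * (f x * starRingEnd ℂ (g x)).re := by
    filter_upwards [toL2_ae hf, toL2_ae hg] with x h1 h2
    rw [h1, h2]
  exact ⟨h1.congr h, h2.trans (integral_congr_ae h)⟩

lemma br_pd_test (hΩ : IsOpen Ω) {n : Plane → ℝ} (hn : IsC1b Ω n) {ζ η : Plane → ℂ}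
    (hζ : IsTest Ω ζ) (hη : IsTest Ω η) (i : Fin 2) :
    br (mu Ω) n (toL2 Ω (pd i ζ)) (toL2 Ω η) + br (mu Ω) n (toL2 Ω ζ) (toL2 Ω (pd i η)) +
      br (mu Ω) (pd i n) (toL2 Ω ζ) (toL2 Ω η) = 0 := by
  set G : Plane → ℝ := fun x => (ζ x * starRingEnd ℂ (η x)).re with hGdef
  have hηc : ContDiff ℝ ∞ (fun x => starRingEnd ℂ (η x)) :=
    Complex.conjCLE.contDiff.comp hη.smooth
  have hG : ContDiff ℝ ∞ G := Complex.reCLM.contDiff.comp (hζ.smooth.mul hηc)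
  have hsupp : Function.support G ⊆ Function.support ζ := fun x hx h0 => hx (by simp [G, h0])
  have hGs : tsupport G ⊆ tsupport ζ := closure_mono hsupp
  have hGc : HasCompactSupport G := hζ.compact.mono hsupp
  have hpd : ∀ x, pd i G x = (pd i ζ x * starRingEnd ℂ (η x)).re +
      (ζ x * starRingEnd ℂ (pd i η x)).re := by
    intro x
    have h1 := (hζ.differentiable x).hasFDerivAt
    have h2 := Complex.conjCLE.hasFDerivAt.comp x (hη.differentiable x).hasFDerivAt
    have h3 := (Complex.reCLM.hasFDerivAt.comp x (h1.mul h2)).fderiv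
    have h4 : fderiv ℝ G x = _ := h3
    rw [pd, h4]
    simp [pd]
    ring
  obtain ⟨a1, a2, a3⟩ := integral_mul_pd hΩ hn
    (hG.of_le ENat.LEInfty.out : ContDiff ℝ 1 G) hGc (hGs.trans hζ.supp) i
  have mζ := hζ.isC2c.memLp
  have mη := hη.isC2c.memLp
  obtain ⟨e1, e1'⟩ := br_toL2 (hn.bdd hΩ) (hζ.isC2c.memLp_pd i) mη
  obtain ⟨e2, e2'⟩ := br_toL2 (hn.bdd hΩ) mζ (hη.isC2c.memLp_pd i)
  obtain ⟨e3, e3'⟩ := br_toL2 (hn.bdd_pd hΩ i) mζ mη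
  rw [e1', e2', e3', ← integral_add e1 e2]
  have : (fun x => n x * pd i G x) = fun x => n x * (pd i ζ x * starRingEnd ℂ (η x)).re +
      n x * (ζ x * starRingEnd ℂ (pd i η x)).re := by
    ext x; rw [hpd]; ring
  rw [← this, a3]
  simp [G]

/-- Integration by parts for `∂ᵢ (n ∂ⱼu conj u)`. -/
lemma br_hess_fst (hΩ : IsOpen Ω) {n : Plane → ℝ} (hn : IsC1b Ω n) {F : JetL2 Ω}
    (hF : F ∈ H20 Ω) (i j : Fin 2) :
    br (mu Ω) n (F.2.2 i j) F.1 + br (mu Ω) n (F.2.1 j) (F.2.1 i) +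
      br (mu Ω) (pd i n) (F.2.1 j) F.1 = 0 := by
  refine H20_induction (P := fun F => br (mu Ω) n (F.2.2 i j) F.1 +
      br (mu Ω) n (F.2.1 j) (F.2.1 i) + br (mu Ω) (pd i n) (F.2.1 j) F.1 = 0) ?_ ?_ hF
  · refine isClosed_eq (((continuous_br n ?_ ?_).add (continuous_br n ?_ ?_)).add
      (continuous_br _ ?_ ?_)) continuous_const <;> fun_prop
  · intro ζ hζ
    exact br_pd_test hΩ hn (hζ.pd j) hζ i

/-- The weak derivatives commute. -/
lemma hess_symm {F : JetL2 Ω} (hF : F ∈ H20 Ω) : F.2.2 1 0 = F.2.2 0 1 := by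
  refine H20_induction (P := fun F => F.2.2 1 0 = F.2.2 0 1) (isClosed_eq ?_ ?_) ?_ hF
  · fun_prop
  · fun_prop
  · intro ζ hζ
    change toL2 Ω _ = toL2 Ω _
    congr 1
    funext x
    exact pd_comm hζ.isC2c.smooth 1 0 x

/-- `|u₁₂|²` and `Re u₁₁ conj u₂₂` differ by a divergence. -/
lemma br_hess_hess (hΩ : IsOpen Ω) {m : Plane → ℝ} (hm : IsC1b Ω m) {F : JetL2 Ω}
    (hF : F ∈ H20 Ω) :
    br (mu Ω) m (F.2.2 0 0) (F.2.2 1 1) - br (mu Ω) m (F.2.2 0 1) (F.2.2 0 1) =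
      br (mu Ω) (pd 1 m) (F.2.1 0) (F.2.2 0 1) - br (mu Ω) (pd 0 m) (F.2.1 0) (F.2.2 1 1) := by
  refine H20_induction (P := fun F =>
      br (mu Ω) m (F.2.2 0 0) (F.2.2 1 1) - br (mu Ω) m (F.2.2 0 1) (F.2.2 0 1) =
      br (mu Ω) (pd 1 m) (F.2.1 0) (F.2.2 0 1) - br (mu Ω) (pd 0 m) (F.2.1 0) (F.2.2 1 1)) ?_ ?_ hF
  · refine isClosed_eq ((continuous_br m ?_ ?_).sub (continuous_br m ?_ ?_))
      ((continuous_br _ ?_ ?_).sub (continuous_br _ ?_ ?_)) <;> fun_prop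
  · intro ζ hζ
    have h1 := br_pd_test hΩ hm (hζ.pd 0) ((hζ.pd 1).pd 1) 0
    have h2 := br_pd_test hΩ hm (hζ.pd 0) ((hζ.pd 1).pd 0) 1
    have e1 : pd 1 (pd 0 ζ) = pd 0 (pd 1 ζ) := funext fun x => pd_comm hζ.isC2c.smooth 1 0 x
    have e2 : pd 1 (pd 0 (pd 1 ζ)) = pd 0 (pd 1 (pd 1 ζ)) :=
      funext fun x => pd_comm (hζ.pd 1).isC2c.smooth 1 0 x
    rw [e1, e2] at h2
    change br (mu Ω) m (toL2 Ω _) (toL2 Ω _) - br (mu Ω) m (toL2 Ω _) (toL2 Ω _) =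
      br (mu Ω) _ (toL2 Ω _) (toL2 Ω _) - br (mu Ω) _ (toL2 Ω _) (toL2 Ω _)
    linarith

/-- Interpolation between `u` and its second derivatives. -/
lemma norm_grad_sq_le (hΩ : IsOpen Ω) {F : JetL2 Ω} (hF : F ∈ H20 Ω) (i : Fin 2) :
    ‖F.2.1 i‖ ^ 2 ≤ ‖F.1‖ * ‖F.2.2 i i‖ := by
  have h := br_hess_fst hΩ (isC1b_const 1) hF i i
  have h0 : br (mu Ω) (pd i fun _ => (1 : ℝ)) (F.2.1 i) F.1 = 0 := by
    have : pd i (fun _ : Plane => (1 : ℝ)) = fun _ => 0 * 1 := by ext x; simp [pd]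
    rw [this, br_fun_const_mul 0 (bdd_const 1), zero_mul]
  have h1 := abs_br_le (bdd_const (μ := mu Ω) 1) (C := 1) (by simp) (F.2.2 i i) F.1
  rw [h0, br_const] at h
  have := neg_abs_le (br (mu Ω) (fun _ => 1) (F.2.2 i i) F.1)
  nlinarith [le_abs_self (br (mu Ω) (fun _ => 1) (F.2.2 i i) F.1)]

/-- Weak derivatives are unique. -/
lemma H20_ext (hΩ : IsOpen Ω) {F : JetL2 Ω} (hF : F ∈ H20 Ω) (h : F.1 = 0) : F = 0 := by
  have hg : ∀ i, F.2.1 i = 0 := fun i => by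
    have h1 := norm_grad_sq_le hΩ hF i
    rw [h, norm_zero, zero_mul] at h1
    have : ‖F.2.1 i‖ = 0 := by nlinarith [norm_nonneg (F.2.1 i), sq_nonneg ‖F.2.1 i‖]
    exact norm_eq_zero.1 this
  have hr : ∀ i j, ∀ ζ : Plane → ℂ, IsTest Ω ζ →
      (inner ℂ (toL2 Ω ζ) (F.2.2 i j)).re = 0 := fun i j ζ hζ => by
    have key : ∀ {F : JetL2 Ω}, F ∈ H20 Ω →
        br (mu Ω) (fun _ => 1) (F.2.2 i j) (toL2 Ω ζ) +
        br (mu Ω) (fun _ => 1) (F.2.1 j) (toL2 Ω (pd i ζ)) = 0 := fun {F} hF => by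
      refine H20_induction (P := fun F => br (mu Ω) (fun _ => 1) (F.2.2 i j) (toL2 Ω ζ) +
        br (mu Ω) (fun _ => 1) (F.2.1 j) (toL2 Ω (pd i ζ)) = 0) ?_ ?_ hF
      · refine isClosed_eq ((continuous_br _ ?_ ?_).add (continuous_br _ ?_ ?_))
          continuous_const <;> fun_prop
      · intro η hη
        have h1 := br_pd_test hΩ (isC1b_const 1) (hη.pd j) hζ i
        have : pd i (fun _ : Plane => (1 : ℝ)) = fun _ => 0 * 1 := by ext x; simp [pd]
        rw [this, br_fun_const_mul 0 (bdd_const 1), zero_mul, add_zero] at h1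
        exact h1
    have h2 := key hF
    rw [hg j] at h2
    simpa [br, mulOp_one] using h2
  have hh : ∀ i j, F.2.2 i j = 0 := fun i j => by
    refine eq_zero_of_inner_test hΩ _ fun ζ hζ => Complex.ext (hr i j ζ hζ) ?_
    have h3 := hr i j _ (hζ.const_mul Complex.I)
    rw [toL2_const_mul _ hζ.isC2c.memLp, inner_smul_left] at h3
    simpa using h3
  ext1
  · exact h
  ext1
  · exact funext hg
  · exact funext fun i => funext fun j => hh i j

end IntegrationByParts

/-! ### Mollification -/

section Mollification

open scoped ContDiff ENNReal Convolution

variable {Ω : Set Plane}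

/-- The convolution of `f` with a normalised bump function. -/
def mollify {F : Type*} [NormedAddCommGroup F] [NormedSpace ℝ F]
    (φ : ContDiffBump (0 : Plane)) (f : Plane → F) : Plane → F :=
  φ.normed volume ⋆[ContinuousLinearMap.lsmul ℝ ℝ, volume] f

section

variable {F : Type*} [NormedAddCommGroup F] [NormedSpace ℝ F]
  (φ : ContDiffBump (0 : Plane))

lemma contDiff_mollify {f : Plane → F} (hf : Continuous f) : ContDiff ℝ ∞ (mollify φ f) :=
  φ.hasCompactSupport_normed.contDiff_convolution_left _ φ.contDiff_normed hf.locallyIntegrable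

lemma locallyIntegrable_normed : LocallyIntegrable (φ.normed volume) volume :=
  φ.continuous_normed.locallyIntegrable

lemma pd_mollify {f : Plane → F} (hf : ContDiff ℝ 1 f) (hc : HasCompactSupport f) (i : Fin 2) :
    pd i (mollify φ f) = mollify φ (pd i f) := by
  funext x
  rw [pd, mollify, (hc.hasFDerivAt_convolution_right _ (locallyIntegrable_normed φ) hf x).fderiv]
  exact convolution_precompR_apply _ (locallyIntegrable_normed φ) (hc.fderiv ℝ)
    (hf.continuous_fderiv (by simp)) x _

lemma dist_mollify_le [CompleteSpace F] {f : Plane → F} (hf : Continuous f) {x : Plane} {ε : ℝ}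
    (h : ∀ y ∈ Metric.ball x φ.rOut, dist (f y) (f x) ≤ ε) : dist (mollify φ f x) (f x) ≤ ε :=
  φ.dist_normed_convolution_le hf.aestronglyMeasurable h

lemma support_mollify_subset [CompleteSpace F] {f : Plane → F} (hf : Continuous f) :
    Function.support (mollify φ f) ⊆ Metric.cthickening φ.rOut (tsupport f) := by
  intro x hx
  by_contra hn
  apply hx
  have h0 : ∀ y ∈ Metric.ball x φ.rOut, f y = 0 := by
    intro y hy
    by_contra h
    exact hn (Metric.mem_cthickening_of_dist_le x y _ _ (subset_tsupport f h)
      (by rw [dist_comm]; exact (Metric.mem_ball.1 hy).le))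
  have h1 := h0 x (Metric.mem_ball_self φ.rOut_pos)
  have h2 := dist_mollify_le φ hf (x := x) (ε := 0) fun y hy => by rw [h0 y hy, h1, dist_self]
  rw [h1, dist_zero_right] at h2
  exact norm_eq_zero.1 (le_antisymm h2 (norm_nonneg _))

end

lemma dist_toL2_le {f g : Plane → ℂ} (hf : MemLp f 2 (mu Ω)) (hg : MemLp g 2 (mu Ω))
    {K : Set Plane} (hK : IsCompact K) {ε : ℝ} (hε : 0 ≤ ε) (h : ∀ x ∈ K, dist (f x) (g x) ≤ ε)
    (h0 : ∀ x, x ∉ K → f x = 0 ∧ g x = 0) :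
    dist (toL2 Ω f) (toL2 Ω g) ≤ ε * (mu Ω).real K ^ (1 / (2 : ℝ≥0∞).toReal) := by
  have hμ : mu Ω K ≠ ⊤ := ((Measure.restrict_apply_le _ _).trans_lt hK.measure_lt_top).ne
  rw [dist_eq_norm]
  have h1 : ‖indicatorConstLp (E := ℂ) 2 hK.measurableSet hμ (ε : ℂ)‖ =
      ε * (mu Ω).real K ^ (1 / (2 : ℝ≥0∞).toReal) := by
    rw [norm_indicatorConstLp (by norm_num) (by norm_num)]
    simp [abs_of_nonneg hε]
  rw [← h1]
  apply Lp.norm_le_norm_of_ae_le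
  filter_upwards [Lp.coeFn_sub (toL2 Ω f) (toL2 Ω g), toL2_ae hf, toL2_ae hg,
    indicatorConstLp_coeFn (p := 2) (hs := hK.measurableSet) (hμs := hμ) (c := (ε : ℂ))]
    with x e1 e2 e3 e4
  rw [e1, e4, Pi.sub_apply, e2, e3]
  by_cases hx : x ∈ K
  · rw [indicator_of_mem hx, ← dist_eq_norm]
    simpa [abs_of_nonneg hε] using h x hx
  · simp [h0 x hx]

lemma tendsto_toL2_of_uniform {f : ℕ → Plane → ℂ} {g : Plane → ℂ}
    (hf : ∀ n, MemLp (f n) 2 (mu Ω)) (hg : MemLp g 2 (mu Ω)) {K : Set Plane} (hK : IsCompact K)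
    (h : ∀ ε > 0, ∀ᶠ n in atTop, ∀ x, dist (f n x) (g x) ≤ ε)
    (hf0 : ∀ n x, x ∉ K → f n x = 0) (hg0 : ∀ x, x ∉ K → g x = 0) :
    Tendsto (fun n => toL2 Ω (f n)) atTop (𝓝 (toL2 Ω g)) := by
  rw [Metric.tendsto_nhds]
  intro ε hε
  set c := (mu Ω).real K ^ (1 / (2 : ℝ≥0∞).toReal)
  have hc : 0 ≤ c := by positivity
  filter_upwards [h (ε / (c + 1)) (by positivity)] with n hn
  refine (dist_toL2_le (hf n) hg hK (by positivity) (fun x _ => hn x)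
    fun x hx => ⟨hf0 n x hx, hg0 x hx⟩).trans_lt ?_
  rw [div_mul_eq_mul_div, div_lt_iff₀ (by positivity)]
  exact mul_lt_mul_of_pos_left (lt_add_one c) hε

/-- Compactly supported `C²` functions belong to `H²₀(Ω)`. -/
lemma IsC2c.jet_mem {ζ : Plane → ℂ} (h : IsC2c Ω ζ) (hΩ : IsOpen Ω) : jet Ω ζ ∈ H20 Ω := by
  obtain ⟨δ, hδ, hδΩ⟩ := h.compact.isCompact.exists_cthickening_subset_open hΩ h.supp
  set K := Metric.cthickening δ (tsupport ζ)
  have hK : IsCompact K := h.compact.isCompact.cthickening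
  let r : ℕ → ℝ := fun n => δ / (n + 1)
  have hr : ∀ n, 0 < r n := fun n => by positivity
  have hrδ : ∀ n, r n ≤ δ := fun n => by
    apply div_le_self hδ.le
    have : (0 : ℝ) ≤ n := n.cast_nonneg
    linarith
  have hr0 : Tendsto r atTop (𝓝 0) := by
    have := tendsto_one_div_add_atTop_nhds_zero_nat (𝕜 := ℝ)
    have h2 := this.const_mul δ
    simpa [r, div_eq_mul_inv] using h2
  let φ : ℕ → ContDiffBump (0 : Plane) := fun n =>
    ⟨r n / 2, r n, half_pos (hr n), half_lt_self (hr n)⟩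
  have hsub : ∀ (f : Plane → ℂ), Continuous f → tsupport f ⊆ tsupport ζ → ∀ n,
      Function.support (mollify (φ n) f) ⊆ K := fun f hf hs n =>
    (support_mollify_subset (φ n) hf).trans
      ((Metric.cthickening_mono (hrδ n) _).trans (Metric.cthickening_subset_of_subset _ hs))
  have htest : ∀ n, IsTest Ω (mollify (φ n) ζ) := fun n =>
    ⟨contDiff_mollify _ h.smooth.continuous,
      HasCompactSupport.of_support_subset_isCompact hK (hsub ζ h.smooth.continuous le_rfl n),
      (closure_minimal (hsub ζ h.smooth.continuous le_rfl n)
        Metric.isClosed_cthickening).trans hδΩ⟩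
  have key : ∀ (f : Plane → ℂ), Continuous f → HasCompactSupport f → tsupport f ⊆ tsupport ζ →
      (∀ n, MemLp (mollify (φ n) f) 2 (mu Ω)) →
      Tendsto (fun n => toL2 Ω (mollify (φ n) f)) atTop (𝓝 (toL2 Ω f)) := by
    intro f hf hc hs hm
    refine tendsto_toL2_of_uniform hm (memLp_of_continuous hf hc) hK ?_ ?_ ?_
    · intro ε hε
      obtain ⟨η, hη, hu⟩ := Metric.uniformContinuous_iff.1
        (hc.uniformContinuous_of_continuous hf) ε hε
      filter_upwards [hr0.eventually (gt_mem_nhds hη)] with n hn x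
      exact dist_mollify_le (φ n) hf fun y hy => (hu ((Metric.mem_ball.1 hy).trans hn)).le
    · intro n x hx
      by_contra hne
      exact hx (hsub f hf hs n hne)
    · intro x hx
      by_contra hne
      exact hx (Metric.self_subset_cthickening _ (hs (subset_tsupport f hne)))
  have h1 : ∀ i, ContDiff ℝ 1 (pd i ζ) := fun i => contDiff_pd h.smooth (by norm_num) i
  have e1 : ∀ n i, pd i (mollify (φ n) ζ) = mollify (φ n) (pd i ζ) := fun n i =>
    pd_mollify _ (h.smooth.of_le (by norm_num)) h.compact i
  have e2 : ∀ n i j, pd i (pd j (mollify (φ n) ζ)) = mollify (φ n) (pd i (pd j ζ)) :=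
    fun n i j => by rw [e1, pd_mollify _ (h1 j) (hasCompactSupport_pd h.compact j)]
  refine isClosed_H20.mem_of_tendsto (f := fun n => jet Ω (mollify (φ n) ζ)) (b := atTop) ?_
    (Eventually.of_forall fun n => jet_mem_H20 (htest n))
  refine Tendsto.prodMk_nhds ?_ (Tendsto.prodMk_nhds ?_ ?_)
  · exact key ζ h.smooth.continuous h.compact le_rfl fun n => (htest n).isC2c.memLp
  · rw [tendsto_pi_nhds]
    intro i
    simp_rw [e1]
    exact key _ (h.continuous_pd i) (hasCompactSupport_pd h.compact i) (tsupport_pd_subset _ _)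
      fun n => e1 n i ▸ (htest n).isC2c.memLp_pd i
  · rw [tendsto_pi_nhds]
    intro i
    rw [tendsto_pi_nhds]
    intro j
    simp_rw [e2]
    exact key _ (h.continuous_pd_pd i j)
      (hasCompactSupport_pd (hasCompactSupport_pd h.compact j) i)
      ((tsupport_pd_subset _ _).trans (tsupport_pd_subset _ _))
      fun n => e2 n i j ▸ (htest n).isC2c.memLp_pd_pd i j

/-- A Lipschitz function on `Ω` is uniformly close to a `C¹` function with bounded gradient. -/
lemma exists_isC1b_near {K : NNReal} {g : Plane → ℝ} (hg : LipschitzOnWith K g Ω)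
    {B : ℝ} (hB : ∀ x ∈ Ω, |g x| ≤ B) {η : ℝ} (hη : 0 < η) :
    ∃ f : Plane → ℝ, IsC1b Ω f ∧ ∀ x ∈ Ω, |g x - f x| ≤ η := by
  obtain ⟨g', hg', hgg'⟩ := hg.extend_real
  set r : ℝ := η / (K + 1)
  have hr : 0 < r := by positivity
  set φ : ContDiffBump (0 : Plane) := ⟨r / 2, r, half_pos hr, half_lt_self hr⟩
  have hd : ∀ x, dist (mollify φ g' x) (g' x) ≤ η := fun x =>
    dist_mollify_le φ hg'.continuous fun y hy => by
      refine (hg'.dist_le_mul y x).trans ?_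
      calc (K : ℝ) * dist y x ≤ (K + 1) * r := by
            gcongr
            · linarith
            · exact (Metric.mem_ball.1 hy).le
        _ = η := mul_div_cancel₀ η (by positivity)
  have hex := φ.hasCompactSupport_normed.convolutionExists_left_of_continuous_right
    (μ := (volume : Measure Plane)) (ContinuousLinearMap.lsmul ℝ ℝ) (locallyIntegrable_normed φ)
    hg'.continuous
  have hlip : LipschitzWith K (mollify φ g') := by
    refine LipschitzWith.of_dist_le_mul fun x y => ?_
    rw [dist_eq_norm, mollify, convolution_def, convolution_def, ← integral_sub (hex x) (hex y)]
    calc _ ≤ ∫ t, φ.normed volume t * (K * dist x y) := by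
          refine norm_integral_le_of_norm_le (φ.integrable_normed.mul_const _)
            (Eventually.of_forall fun t => ?_)
          rw [ContinuousLinearMap.lsmul_apply, ContinuousLinearMap.lsmul_apply, ← smul_sub,
            norm_smul, Real.norm_of_nonneg (φ.nonneg_normed t)]
          refine mul_le_mul_of_nonneg_left ?_ (φ.nonneg_normed t)
          rw [← dist_eq_norm]
          simpa using hg'.dist_le_mul (x - t) (y - t)
      _ = K * dist x y := by rw [integral_mul_const, φ.integral_normed, one_mul]
  refine ⟨mollify φ g', ⟨((contDiff_mollify φ hg'.continuous).of_le ENat.LEInfty.out).contDiffOn,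
    (B + η) + K, fun x hx => ⟨?_, fun i => ?_⟩⟩, fun x hx => ?_⟩
  · have h1 := hd x
    rw [Real.dist_eq, ← hgg' hx] at h1
    have h2 := hB x hx
    have : (0 : ℝ) ≤ K := K.2
    rw [abs_le] at *
    constructor <;> linarith
  · have h1 : |pd i (mollify φ g') x| ≤ K := by
      have h3 := (fderiv ℝ (mollify φ g') x).le_opNorm (EuclideanSpace.single i 1)
      rw [PiLp.norm_single, norm_one, mul_one] at h3
      exact h3.trans (norm_fderiv_le_of_lipschitz ℝ hlip)
    have h2 := (abs_nonneg _).trans (hB x hx)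
    linarith
  · rw [hgg' hx, abs_sub_comm]; exact hd x

end Mollification

/-! ### Multiplication of `H²₀(Ω)` by bounded `C²` functions -/

section Leibniz

open scoped ENNReal

variable {Ω : Set Plane}

/-- `χ ∈ C²(Ω)` is real and bounded together with its derivatives of order at most two. -/
structure IsC2b (Ω : Set Plane) (χ : Plane → ℝ) : Prop where
  contDiffOn : ContDiffOn ℝ 2 χ Ω
  bound : ∃ C : ℝ, ∀ x ∈ Ω, |χ x| ≤ C ∧ (∀ i, |pd i χ x| ≤ C) ∧ ∀ i j, |pd i (pd j χ) x| ≤ C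

lemma IsC2b.isC1b {χ : Plane → ℝ} (h : IsC2b Ω χ) : IsC1b Ω χ := by
  obtain ⟨C, hC⟩ := h.bound
  exact ⟨h.contDiffOn.of_le (by norm_num), C, fun x hx => ⟨(hC x hx).1, (hC x hx).2.1⟩⟩

lemma contDiffOn_pd (hΩ : IsOpen Ω) {χ : Plane → ℝ} (h : ContDiffOn ℝ 2 χ Ω) (i : Fin 2) :
    ContDiffOn ℝ 1 (pd i χ) Ω :=
  (h.fderiv_of_isOpen hΩ (by norm_num)).clm_apply contDiffOn_const

lemma IsC2b.isC1b_pd (hΩ : IsOpen Ω) {χ : Plane → ℝ} (h : IsC2b Ω χ) (i : Fin 2) :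
    IsC1b Ω (pd i χ) := by
  obtain ⟨C, hC⟩ := h.bound
  exact ⟨contDiffOn_pd hΩ h.contDiffOn i, C,
    fun x hx => ⟨(hC x hx).2.1 i, fun j => (hC x hx).2.2 j i⟩⟩

lemma IsC2b.bdd_pd_pd (hΩ : IsOpen Ω) {χ : Plane → ℝ} (h : IsC2b Ω χ) (i j : Fin 2) :
    MemLp (pd i (pd j χ)) ∞ (mu Ω) := (h.isC1b_pd hΩ j).bdd_pd hΩ i

/-- The jet of `χ u`, by the Leibniz rule. -/
def mulJet (χ : Plane → ℝ) (F : JetL2 Ω) : JetL2 Ω :=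
  (mulOp (mu Ω) χ F.1,
    fun i => mulOp (mu Ω) χ (F.2.1 i) + mulOp (mu Ω) (pd i χ) F.1,
    fun i j => mulOp (mu Ω) χ (F.2.2 i j) + (mulOp (mu Ω) (pd i χ) (F.2.1 j) +
      mulOp (mu Ω) (pd j χ) (F.2.1 i)) + mulOp (mu Ω) (pd i (pd j χ)) F.1)

lemma continuous_mulJet (χ : Plane → ℝ) : Continuous (mulJet χ : JetL2 Ω → JetL2 Ω) := by
  unfold mulJet
  fun_prop

lemma isC2c_mul {χ : Plane → ℝ} (hΩ : IsOpen Ω) (h : ContDiffOn ℝ 2 χ Ω) {ζ : Plane → ℂ}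
    (hζ : IsC2c Ω ζ) : IsC2c Ω (fun x => (χ x : ℂ) * ζ x) := by
  have hs : Function.support (fun x => (χ x : ℂ) * ζ x) ⊆ Function.support ζ :=
    fun x hx h0 => hx (by simp [h0])
  refine ⟨?_, hζ.compact.mono hs, (closure_mono hs).trans hζ.supp⟩
  rw [contDiff_iff_contDiffAt]
  intro x
  by_cases hx : x ∈ tsupport ζ
  · exact (Complex.ofRealCLM.contDiff.contDiffAt.comp x
      (h.contDiffAt (hΩ.mem_nhds (hζ.supp hx)))).mul hζ.smooth.contDiffAt
  · have h0 : (fun x => (χ x : ℂ) * ζ x) =ᶠ[𝓝 x] fun _ => 0 := by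
      filter_upwards [notMem_tsupport_iff_eventuallyEq.1 hx] with y hy
      rw [hy]; simp
    exact contDiffAt_const.congr_of_eventuallyEq h0

/-- `H²₀(Ω)` is a module over the real functions in `C²(Ω)` with bounded derivatives. -/
lemma mulJet_mem (hΩ : IsOpen Ω) {χ : Plane → ℝ} (h : IsC2b Ω χ) {F : JetL2 Ω}
    (hF : F ∈ H20 Ω) : mulJet χ F ∈ H20 Ω := by
  refine H20_induction (P := fun F => mulJet χ F ∈ H20 Ω)
    (isClosed_H20.preimage (continuous_mulJet χ)) ?_ hF
  intro ζ hζ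
  have hξ := isC2c_mul hΩ h.contDiffOn hζ.isC2c
  have hmem : ∀ᵐ x ∂(mu Ω), x ∈ Ω := ae_restrict_mem hΩ.measurableSet
  have hχ : ∀ x ∈ Ω, DifferentiableAt ℝ χ x := fun x hx =>
    ContDiffOn.differentiableAt_of_isOpen hΩ h.isC1b.contDiffOn hx
  have hχ1 : ∀ i, ∀ x ∈ Ω, DifferentiableAt ℝ (pd i χ) x := fun i x hx =>
    ContDiffOn.differentiableAt_of_isOpen hΩ (h.isC1b_pd hΩ i).contDiffOn hx
  have cd : ∀ {f : Plane → ℝ} {x : Plane}, DifferentiableAt ℝ f x →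
      DifferentiableAt ℝ (fun y => (f y : ℂ)) x := fun {f x} hf =>
    Complex.ofRealCLM.differentiableAt.comp x hf
  have d1 : ∀ j, ∀ x ∈ Ω, pd j (fun x => (χ x : ℂ) * ζ x) x =
      (χ x : ℂ) * pd j ζ x + ((pd j χ x : ℝ) : ℂ) * ζ x := fun j x hx => by
    rw [pd_mul (cd (hχ x hx)) (hζ.differentiable x), pd_ofReal (hχ x hx)]; ring
  have d2 : ∀ i j, ∀ x ∈ Ω, pd i (pd j fun x => (χ x : ℂ) * ζ x) x =
      (χ x : ℂ) * pd i (pd j ζ) x + (((pd i χ x : ℝ) : ℂ) * pd j ζ x +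
        ((pd j χ x : ℝ) : ℂ) * pd i ζ x) + ((pd i (pd j χ) x : ℝ) : ℂ) * ζ x := fun i j x hx => by
    have e : pd j (fun x => (χ x : ℂ) * ζ x) =ᶠ[𝓝 x]
        fun x => (χ x : ℂ) * pd j ζ x + ((pd j χ x : ℝ) : ℂ) * ζ x := by
      filter_upwards [hΩ.mem_nhds hx] with y hy using d1 j y hy
    rw [pd_congr e, pd_add ((cd (hχ x hx)).fun_mul ((hζ.pd j).differentiable x))
      ((cd (hχ1 j x hx)).fun_mul (hζ.differentiable x)), pd_mul (cd (hχ x hx))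
      ((hζ.pd j).differentiable x), pd_mul (cd (hχ1 j x hx)) (hζ.differentiable x),
      pd_ofReal (hχ x hx), pd_ofReal (hχ1 j x hx)]
    ring
  have key : jet Ω (fun x => (χ x : ℂ) * ζ x) = mulJet χ (jet Ω ζ) := by
    have m0 := toL2_ae hζ.isC2c.memLp
    have m1 := fun i => toL2_ae (hζ.isC2c.memLp_pd i)
    have m2 := fun i j => toL2_ae (hζ.isC2c.memLp_pd_pd i j)
    ext1
    · apply Lp.ext
      filter_upwards [toL2_ae hξ.memLp, m0, mulOp_ae (h.isC1b.bdd hΩ) (toL2 Ω ζ)] with x a b c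
      exact a.trans (by rw [show (mulJet χ (jet Ω ζ)).1 = mulOp (mu Ω) χ (toL2 Ω ζ) from rfl, c, b])
    ext1
    · funext i
      apply Lp.ext
      filter_upwards [toL2_ae (hξ.memLp_pd i), m0, m1 i,
        mulOp_ae (h.isC1b.bdd hΩ) (toL2 Ω (pd i ζ)),
        mulOp_ae (h.isC1b.bdd_pd hΩ i) (toL2 Ω ζ),
        Lp.coeFn_add (mulOp (mu Ω) χ (toL2 Ω (pd i ζ))) (mulOp (mu Ω) (pd i χ) (toL2 Ω ζ)),
        hmem] with x a b b1 c1 c2 s hx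
      refine a.trans ?_
      rw [show (mulJet χ (jet Ω ζ)).2.1 i = mulOp (mu Ω) χ (toL2 Ω (pd i ζ)) +
        mulOp (mu Ω) (pd i χ) (toL2 Ω ζ) from rfl, s, Pi.add_apply, c1, c2, b, b1, d1 i x hx]
    · funext i j
      apply Lp.ext
      filter_upwards [toL2_ae (hξ.memLp_pd_pd i j), m0, m1 i, m1 j, m2 i j,
        mulOp_ae (h.isC1b.bdd hΩ) (toL2 Ω (pd i (pd j ζ))),
        mulOp_ae (h.isC1b.bdd_pd hΩ i) (toL2 Ω (pd j ζ)),
        mulOp_ae (h.isC1b.bdd_pd hΩ j) (toL2 Ω (pd i ζ)),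
        mulOp_ae (h.bdd_pd_pd hΩ i j) (toL2 Ω ζ),
        Lp.coeFn_add (mulOp (mu Ω) (pd i χ) (toL2 Ω (pd j ζ)))
          (mulOp (mu Ω) (pd j χ) (toL2 Ω (pd i ζ))),
        Lp.coeFn_add (mulOp (mu Ω) χ (toL2 Ω (pd i (pd j ζ))))
          (mulOp (mu Ω) (pd i χ) (toL2 Ω (pd j ζ)) + mulOp (mu Ω) (pd j χ) (toL2 Ω (pd i ζ))),
        Lp.coeFn_add (mulOp (mu Ω) χ (toL2 Ω (pd i (pd j ζ))) +
          (mulOp (mu Ω) (pd i χ) (toL2 Ω (pd j ζ)) + mulOp (mu Ω) (pd j χ) (toL2 Ω (pd i ζ))))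
          (mulOp (mu Ω) (pd i (pd j χ)) (toL2 Ω ζ)), hmem]
        with x a b b1 b2 b3 c1 c2 c3 c4 s1 s2 s3 hx
      refine a.trans ?_
      rw [show (mulJet χ (jet Ω ζ)).2.2 i j = mulOp (mu Ω) χ (toL2 Ω (pd i (pd j ζ))) +
        (mulOp (mu Ω) (pd i χ) (toL2 Ω (pd j ζ)) + mulOp (mu Ω) (pd j χ) (toL2 Ω (pd i ζ))) +
        mulOp (mu Ω) (pd i (pd j χ)) (toL2 Ω ζ) from rfl, s3, Pi.add_apply, s2, Pi.add_apply, s1,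
        Pi.add_apply, c1, c2, c3, c4, b, b1, b2, b3, d2 i j x hx]
  rw [← key]
  exact hξ.jet_mem hΩ

end Leibniz

/-! ### The Sobolev embedding in dimension two -/

section Sobolev

open scoped ContDiff ENNReal

variable {Ω : Set Plane}

/-- The `i`-th unit vector. -/
abbrev unitVec (i : Fin 2) : Plane := EuclideanSpace.single i 1

lemma measurePreserving_coords : MeasurePreserving
    (fun p : ℝ × ℝ => p.1 • unitVec 0 + p.2 • unitVec 1) := by
  have h1 := (volume_preserving_finTwoArrow ℝ).symm
  have h2 := (PiLp.volume_preserving_toLp (Fin 2)).comp h1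
  have e : (fun p : ℝ × ℝ => p.1 • unitVec 0 + p.2 • unitVec 1) =
      WithLp.toLp 2 ∘ MeasurableEquiv.finTwoArrow.symm := by
    funext p
    ext i
    fin_cases i <;> simp [MeasurableEquiv.finTwoArrow]
  rw [e]
  exact h2

lemma lintegral_lintegral_lines {H : Plane → ℝ≥0∞} (hH : Measurable H) (p : Plane) {i j : Fin 2}
    (hij : i ≠ j) :
    ∫⁻ s : ℝ, ∫⁻ r : ℝ, H (p + s • unitVec i + r • unitVec j) = ∫⁻ x, H x := by
  have hm : ∀ k l : Fin 2, Measurable fun q : ℝ × ℝ => H (p + q.1 • unitVec k + q.2 • unitVec l) :=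
    fun k l => hH.comp (by fun_prop)
  have h01 : ∫⁻ s : ℝ, ∫⁻ r : ℝ, H (p + s • unitVec 0 + r • unitVec 1) = ∫⁻ x, H x := by
    calc ∫⁻ s : ℝ, ∫⁻ r : ℝ, H (p + s • unitVec 0 + r • unitVec 1)
        = ∫⁻ q : ℝ × ℝ, H (p + q.1 • unitVec 0 + q.2 • unitVec 1) := by
          rw [← lintegral_prod _ (hm 0 1).aemeasurable]; rfl
      _ = ∫⁻ q : ℝ × ℝ, H (p + (q.1 • unitVec 0 + q.2 • unitVec 1)) := by simp_rw [add_assoc]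
      _ = ∫⁻ x, H (p + x) :=
          measurePreserving_coords.lintegral_comp (f := fun x => H (p + x)) (by fun_prop)
      _ = ∫⁻ x, H x := lintegral_add_left_eq_self H p
  have : (i = 0 ∧ j = 1) ∨ (i = 1 ∧ j = 0) := by omega
  rcases this with ⟨rfl, rfl⟩ | ⟨rfl, rfl⟩
  · exact h01
  · rw [← h01, lintegral_lintegral_swap (hm 1 0).aemeasurable]
    simp_rw [add_right_comm p]

/-- The value at a point is bounded by the integral of a partial derivative along a line. -/
lemma enorm_le_lintegral_line {W : Plane → ℂ} (hW : ContDiff ℝ 1 W) (hc : HasCompactSupport W)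
    (p : Plane) (i : Fin 2) : ‖W p‖ₑ ≤ ∫⁻ s : ℝ, ‖pd i W (p + s • unitVec i)‖ₑ := by
  have hiso : Isometry fun s : ℝ => p + s • unitVec i := by
    refine Isometry.of_dist_eq fun s r => ?_
    rw [dist_add_left, dist_eq_norm, ← sub_smul, norm_smul]
    simp [Real.dist_eq]
  have hf : ContDiff ℝ 1 (W ∘ fun s : ℝ => p + s • unitVec i) := hW.comp (by fun_prop)
  have hfc := hc.comp_isClosedEmbedding hiso.isClosedEmbedding
  have h := hfc.enorm_le_lintegral_Ici_deriv hf 0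
  simp only [Function.comp_apply, zero_smul, add_zero] at h
  refine h.trans ((setLIntegral_le_lintegral _ _).trans_eq ?_)
  congr 1; funext s
  have hd : HasDerivAt (fun s : ℝ => p + s • unitVec i) (unitVec i) s := by
    simpa using ((hasDerivAt_id s).smul_const (unitVec i)).const_add p
  rw [((hW.differentiable (by simp) _).hasFDerivAt.comp_hasDerivAt s hd).deriv]
  rfl

lemma lintegral_mul_le {f g : Plane → ℂ} (hf : MemLp f 2 (mu Ω)) (hg : MemLp g 2 (mu Ω))
    (hs : ∀ x, x ∉ Ω → f x = 0) :
    ∫⁻ x, ‖f x * g x‖ₑ ≤ ENNReal.ofReal (‖toL2 Ω f‖ * ‖toL2 Ω g‖) := by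
  have h1 : ∫⁻ x, ‖f x * g x‖ₑ = ∫⁻ x in Ω, ‖f x * g x‖ₑ := by
    symm
    apply setLIntegral_eq_of_support_subset
    intro x hx
    by_contra h
    exact hx (by simp [hs x h])
  have h2 : ∀ {f : Plane → ℂ}, MemLp f 2 (mu Ω) → ENNReal.ofReal ‖toL2 Ω f‖ = eLpNorm f 2 (mu Ω) :=
    fun {f} hf => by
      rw [toL2, dif_pos hf, Lp.norm_toLp, ENNReal.ofReal_toReal hf.eLpNorm_ne_top]
  rw [h1, ENNReal.ofReal_mul (norm_nonneg _), h2 hf, h2 hg, ← eLpNorm_one_eq_lintegral_enorm]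
  have h3 := eLpNorm_smul_le_mul_eLpNorm (p := 2) (q := 2) (r := 1) hg.1 hf.1
  exact h3

section

variable {ζ : Plane → ℂ} (hζ : IsTest Ω ζ)
include hζ

lemma IsTest.eq_zero_of_notMem {x : Plane} (hx : x ∉ Ω) : ζ x = 0 :=
  image_eq_zero_of_notMem_tsupport fun h => hx (hζ.supp h)

lemma enorm_sq_le_line (q : Plane) (j : Fin 2) :
    ‖ζ q‖ₑ ^ 2 ≤ 2 * ∫⁻ r : ℝ, ‖ζ (q + r • unitVec j) * pd j ζ (q + r • unitVec j)‖ₑ := by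
  have hW : ContDiff ℝ 1 fun x => ζ x * ζ x := (hζ.smooth.mul hζ.smooth).of_le ENat.LEInfty.out
  have h := enorm_le_lintegral_line hW hζ.compact.mul_left q j
  rw [enorm_mul, ← pow_two] at h
  refine h.trans_eq ?_
  rw [← lintegral_const_mul' _ _ (by simp)]
  congr 1; funext r
  rw [pd_mul (hζ.differentiable _) (hζ.differentiable _), ← two_mul, enorm_mul]
  congr 1
  rw [← ofReal_norm]
  simp

/-- `|ζ(p)|² ≤ 2 ∫∫ |∂₀ (ζ ∂₁ζ)|`, by integration along the two coordinate axes. -/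
lemma enorm_sq_le_plane (p : Plane) : ‖ζ p‖ₑ ^ 2 ≤ ENNReal.ofReal
    (2 * (‖toL2 Ω ζ‖ * ‖toL2 Ω (pd 0 (pd 1 ζ))‖ + ‖toL2 Ω (pd 0 ζ)‖ * ‖toL2 Ω (pd 1 ζ)‖)) := by
  have h1 := enorm_sq_le_line hζ p 1
  have hW : ContDiff ℝ 1 fun x => ζ x * pd 1 ζ x :=
    (hζ.smooth.mul (hζ.pd 1).smooth).of_le ENat.LEInfty.out
  have h2 : ∀ q, ‖ζ q * pd 1 ζ q‖ₑ ≤ ∫⁻ r : ℝ,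
      (‖ζ (q + r • unitVec 0) * pd 0 (pd 1 ζ) (q + r • unitVec 0)‖ₑ +
      ‖pd 0 ζ (q + r • unitVec 0) * pd 1 ζ (q + r • unitVec 0)‖ₑ) := fun q => by
    refine (enorm_le_lintegral_line hW hζ.compact.mul_right q 0).trans (lintegral_mono fun r => ?_)
    rw [pd_mul (hζ.differentiable _) ((hζ.pd 1).differentiable _), mul_comm (pd 1 ζ _)]
    exact enorm_add_le _ _
  have hm : ∀ {f g : Plane → ℂ}, IsTest Ω f → IsTest Ω g → Measurable fun x => ‖f x * g x‖ₑ :=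
    fun hf hg => (hf.smooth.continuous.mul hg.smooth.continuous).enorm.measurable
  rw [ENNReal.ofReal_mul (by norm_num), ENNReal.ofReal_add (by positivity) (by positivity),
    ENNReal.ofReal_ofNat]
  refine h1.trans (mul_le_mul_right ((lintegral_mono fun r => h2 _).trans ?_) _)
  have h3 := lintegral_lintegral_lines
    (H := fun x => ‖ζ x * pd 0 (pd 1 ζ) x‖ₑ + ‖pd 0 ζ x * pd 1 ζ x‖ₑ)
    ((hm hζ ((hζ.pd 1).pd 0)).add (hm (hζ.pd 0) (hζ.pd 1))) p (i := 1) (j := 0) (by decide)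
  refine h3.le.trans ?_
  rw [lintegral_add_left (hm hζ ((hζ.pd 1).pd 0))]
  exact add_le_add (lintegral_mul_le hζ.isC2c.memLp (hζ.isC2c.memLp_pd_pd 0 1)
    fun x hx => hζ.eq_zero_of_notMem hx) (lintegral_mul_le (hζ.isC2c.memLp_pd 0)
    (hζ.isC2c.memLp_pd 1) fun x hx => (hζ.pd 0).eq_zero_of_notMem hx)

/-- Hölder continuity of order `1/2` along the coordinate axes: the Cauchy–Schwarz inequality on a
segment, and the previous bound for `∂ᵢζ` on the line that contains it. -/
lemma enorm_sub_sq_le (p : Plane) (s : ℝ) {i j : Fin 2} (hij : i ≠ j) :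
    ‖ζ (p + s • unitVec i) - ζ p‖ₑ ^ 2 ≤ ENNReal.ofReal
      (2 * |s| * (‖toL2 Ω (pd i ζ)‖ * ‖toL2 Ω (pd j (pd i ζ))‖)) := by
  set f : ℝ → ℂ := fun r => pd i ζ (p + r • unitVec i) with hf
  have hfc : Continuous f := (hζ.pd i).smooth.continuous.comp (by fun_prop)
  have hd : ∀ r, HasDerivAt (fun r : ℝ => ζ (p + r • unitVec i)) (f r) r := fun r => by
    have h0 : HasDerivAt (fun s : ℝ => p + s • unitVec i) (unitVec i) r := by
      simpa using ((hasDerivAt_id r).smul_const (unitVec i)).const_add p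
    exact (hζ.differentiable _).hasFDerivAt.comp_hasDerivAt r h0
  have h1 : ζ (p + s • unitVec i) - ζ p = ∫ r in (0 : ℝ)..s, f r := by
    rw [intervalIntegral.integral_eq_sub_of_hasDerivAt (fun r _ => hd r)
      (hfc.intervalIntegrable _ _)]
    simp
  set ν : Measure ℝ := volume.restrict (uIoc 0 s) with hν
  have hν1 : ν univ = ENNReal.ofReal |s| := by
    rw [hν, Measure.restrict_apply_univ, Real.volume_uIoc, sub_zero]
  have h2 : ‖ζ (p + s • unitVec i) - ζ p‖ₑ ≤ eLpNorm f 1 ν := by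
    rw [h1, eLpNorm_one_eq_lintegral_enorm, ← ofReal_norm,
      intervalIntegral.norm_intervalIntegral_eq, ofReal_norm]
    exact enorm_integral_le_lintegral_enorm _
  have h3 := eLpNorm_le_eLpNorm_mul_rpow_measure_univ (μ := ν) (p := 1) (q := 2) (f := f)
    (by norm_num) hfc.aestronglyMeasurable
  have h4 : eLpNorm f 2 ν ^ 2 = ∫⁻ r, ‖f r‖ₑ ^ 2 ∂ν := by
    have := eLpNorm_nnreal_pow_eq_lintegral (f := f) (μ := ν) (p := 2) (by norm_num)
    simpa using this
  have h5 : ∫⁻ r, ‖f r‖ₑ ^ 2 ∂ν ≤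
      2 * ENNReal.ofReal (‖toL2 Ω (pd i ζ)‖ * ‖toL2 Ω (pd j (pd i ζ))‖) := by
    refine (setLIntegral_le_lintegral _ _).trans ?_
    refine (lintegral_mono fun r => enorm_sq_le_line (hζ.pd i) (p + r • unitVec i) j).trans ?_
    rw [lintegral_const_mul' _ _ (by simp)]
    refine mul_le_mul_right ?_ _
    rw [lintegral_lintegral_lines (H := fun x => ‖pd i ζ x * pd j (pd i ζ) x‖ₑ)
      ((hζ.pd i).smooth.continuous.mul ((hζ.pd i).pd j).smooth.continuous).enorm.measurable p hij]
    exact lintegral_mul_le (hζ.isC2c.memLp_pd i) (hζ.isC2c.memLp_pd_pd j i)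
      fun x hx => (hζ.pd i).eq_zero_of_notMem hx
  calc ‖ζ (p + s • unitVec i) - ζ p‖ₑ ^ 2
      ≤ (eLpNorm f 2 ν * ν univ ^ (1 / (1 : ℝ≥0∞).toReal - 1 / (2 : ℝ≥0∞).toReal)) ^ 2 :=
        pow_le_pow_left' (h2.trans h3) 2
    _ = eLpNorm f 2 ν ^ 2 * ν univ := by
        rw [mul_pow, ← ENNReal.rpow_natCast (ν univ ^ _), ← ENNReal.rpow_mul]
        norm_num
    _ ≤ (2 * ENNReal.ofReal (‖toL2 Ω (pd i ζ)‖ * ‖toL2 Ω (pd j (pd i ζ))‖)) *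
        ENNReal.ofReal |s| := by
        rw [h4, hν1]; exact mul_le_mul_left h5 _
    _ = _ := by
        rw [ENNReal.ofReal_mul (p := 2 * |s|) (by positivity),
          ENNReal.ofReal_mul (p := 2) (by norm_num), ENNReal.ofReal_ofNat]
        ring

end

lemma le_of_enorm_sq_le {z : ℂ} {B : ℝ} (hB : 0 ≤ B) (h : ‖z‖ₑ ^ 2 ≤ ENNReal.ofReal B) :
    ‖z‖ ^ 2 ≤ B := by
  rw [← ofReal_norm, ← ENNReal.ofReal_pow (norm_nonneg _)] at h
  exact (ENNReal.ofReal_le_ofReal_iff hB).1 h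

lemma norm_jet_fst_le (F : JetL2 Ω) : ‖F.1‖ ≤ ‖F‖ := norm_fst_le F

lemma norm_jet_grad_le (F : JetL2 Ω) (i : Fin 2) : ‖F.2.1 i‖ ≤ ‖F‖ :=
  (norm_le_pi_norm _ i).trans ((norm_fst_le F.2).trans (norm_snd_le F))

lemma norm_jet_hess_le (F : JetL2 Ω) (i j : Fin 2) : ‖F.2.2 i j‖ ≤ ‖F‖ :=
  (norm_le_pi_norm (F.2.2 i) j).trans ((norm_le_pi_norm F.2.2 i).trans
    ((norm_snd_le F.2).trans (norm_snd_le F)))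

/-- The pointwise bound of the embedding `H²₀(Ω) ⊂ C`, squared. -/
def supBound (F : JetL2 Ω) : ℝ :=
  2 * (‖F.1‖ * ‖F.2.2 0 1‖ + ‖F.2.1 0‖ * ‖F.2.1 1‖)

lemma supBound_nonneg (F : JetL2 Ω) : 0 ≤ supBound F := by unfold supBound; positivity

lemma supBound_le (F : JetL2 Ω) : supBound F ≤ 4 * ‖F‖ ^ 2 := by
  have h1 := mul_le_mul (norm_jet_fst_le F) (norm_jet_hess_le F 0 1) (norm_nonneg _) (norm_nonneg _)
  have h2 := mul_le_mul (norm_jet_grad_le F 0) (norm_jet_grad_le F 1) (norm_nonneg _)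
    (norm_nonneg _)
  unfold supBound
  nlinarith

lemma norm_sq_le_supBound {ζ : Plane → ℂ} (hζ : IsTest Ω ζ) (p : Plane) :
    ‖ζ p‖ ^ 2 ≤ supBound (jet Ω ζ) :=
  le_of_enorm_sq_le (supBound_nonneg _) (enorm_sq_le_plane hζ p)

lemma norm_sub_sq_le {ζ : Plane → ℂ} (hζ : IsTest Ω ζ) (p : Plane) (s : ℝ) (i : Fin 2) :
    ‖ζ (p + s • unitVec i) - ζ p‖ ^ 2 ≤ 2 * |s| * ‖jet Ω ζ‖ ^ 2 := by
  obtain ⟨j, hij⟩ : ∃ j : Fin 2, i ≠ j := exists_ne i |>.imp fun _ h => h.symm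
  refine le_of_enorm_sq_le (by positivity) ((enorm_sub_sq_le hζ p s hij).trans
    (ENNReal.ofReal_le_ofReal ?_))
  have h2 := mul_le_mul (norm_jet_grad_le (jet Ω ζ) i) (norm_jet_hess_le (jet Ω ζ) j i)
    (norm_nonneg _) (norm_nonneg _)
  rw [pow_two]
  exact mul_le_mul_of_nonneg_left h2 (by positivity)

lemma continuous_supBound : Continuous (supBound : JetL2 Ω → ℝ) := by
  unfold supBound; fun_prop

/-- Elements of `H²₀(Ω)` have Hölder continuous representatives. -/
lemma exists_rep {F : JetL2 Ω} (hF : F ∈ H20 Ω) : ∃ w : Plane → ℂ, w =ᵐ[mu Ω] F.1 ∧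
    (∀ p, ‖w p‖ ^ 2 ≤ supBound F) ∧
    (∀ p q, ‖w p - w q‖ ≤ 3 * Real.sqrt (dist p q) * ‖F‖) := by
  obtain ⟨G, hG, hlim⟩ := mem_closure_iff_seq_limit.1 (show F ∈ closure _ from hF)
  choose ζ hζ hζG using hG
  have hsub : ∀ n m p, ‖ζ n p - ζ m p‖ ^ 2 ≤ 4 * ‖G n - G m‖ ^ 2 := fun n m p => by
    have hT := (hζ n).add ((hζ m).const_mul (-1))
    have h1 := norm_sq_le_supBound hT p
    rw [jet_add (hζ n) ((hζ m).const_mul (-1)), jet_const_mul _ (hζ m), hζG, hζG] at h1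
    have h2 := h1.trans (supBound_le _)
    simpa [sub_eq_add_neg] using h2
  have hC : CauchySeq G := hlim.cauchySeq
  have hcau : ∀ p, CauchySeq fun n => ζ n p := fun p => by
    rw [Metric.cauchySeq_iff'] at hC ⊢
    intro ε hε
    obtain ⟨N, hN⟩ := hC (ε / 2) (by positivity)
    refine ⟨N, fun n hn => ?_⟩
    have h1 := hsub n N p
    have h2 := hN n hn
    rw [dist_eq_norm] at h2 ⊢
    nlinarith [norm_nonneg (ζ n p - ζ N p), norm_nonneg (G n - G N)]
  choose w hw using fun p => cauchySeq_tendsto_of_complete (hcau p)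
  have hsup : ∀ p, ‖w p‖ ^ 2 ≤ supBound F := fun p =>
    le_of_tendsto_of_tendsto' ((hw p).norm.pow 2) ((continuous_supBound.tendsto F).comp hlim)
      fun n => by
        have := norm_sq_le_supBound (hζ n) p
        rwa [hζG] at this
  have hline : ∀ p s i, ‖w (p + s • unitVec i) - w p‖ ≤ Real.sqrt (2 * |s|) * ‖F‖ := fun p s i => by
    have h1 : ‖w (p + s • unitVec i) - w p‖ ^ 2 ≤ 2 * |s| * ‖F‖ ^ 2 :=
      le_of_tendsto_of_tendsto' (((hw _).sub (hw p)).norm.pow 2)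
        ((hlim.norm.pow 2).const_mul (2 * |s|)) fun n => by
          have := norm_sub_sq_le (hζ n) p s i
          rwa [hζG] at this
    refine le_of_sq_le_sq ?_ (by positivity)
    rwa [mul_pow, Real.sq_sqrt (by positivity)]
  refine ⟨w, ?_, hsup, fun p q => ?_⟩
  · have h1 : Tendsto (fun n => (G n).1) atTop (𝓝 F.1) := (continuous_fst.tendsto F).comp hlim
    obtain ⟨ns, hns, hae⟩ := (tendstoInMeasure_of_tendsto_Lp h1).exists_seq_tendsto_ae
    have h2 : ∀ᵐ x ∂(mu Ω), ∀ n, (G n).1 x = ζ n x := ae_all_iff.2 fun n => by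
      rw [← hζG n]; exact toL2_ae (hζ n).isC2c.memLp
    filter_upwards [hae, h2] with x hx hx2
    simp_rw [hx2] at hx
    exact tendsto_nhds_unique ((hw x).comp hns.tendsto_atTop) hx
  · set v := p - q with hv
    have hp : p = q + v 0 • unitVec 0 + v 1 • unitVec 1 := by
      ext i; fin_cases i <;> simp [hv]
    have h1 := hline (q + v 0 • unitVec 0) (v 1) 1
    have h2 := hline q (v 0) 0
    rw [← hp] at h1
    have hvi : ∀ i, |v i| ≤ dist p q := fun i => by
      rw [dist_eq_norm]; exact PiLp.norm_apply_le v i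
    have h3 : ∀ i, Real.sqrt (2 * |v i|) ≤ Real.sqrt 2 * Real.sqrt (dist p q) := fun i => by
      rw [← Real.sqrt_mul (by norm_num)]
      exact Real.sqrt_le_sqrt (by linarith [hvi i])
    have h4 : Real.sqrt 2 ≤ 3 / 2 := by
      rw [Real.sqrt_le_left (by norm_num)]; norm_num
    have h5 : ∀ i, Real.sqrt (2 * |v i|) * ‖F‖ ≤ 3 / 2 * Real.sqrt (dist p q) * ‖F‖ := fun i =>
      mul_le_mul_of_nonneg_right ((h3 i).trans
        (mul_le_mul_of_nonneg_right h4 (Real.sqrt_nonneg _))) (norm_nonneg _)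
    calc ‖w p - w q‖ ≤ ‖w p - w (q + v 0 • unitVec 0)‖ + ‖w (q + v 0 • unitVec 0) - w q‖ :=
          norm_sub_le_norm_sub_add_norm_sub _ _ _
      _ ≤ _ := by linarith [h5 0, h5 1]

end Sobolev

/-! ### Closed forms on a Banach space -/

section ClosedForm

/-- A copy of `V`, to carry the inner product defined by a form. -/
def FormSpace (V : Type*) : Type _ := V

instance (V : Type*) [AddCommGroup V] : AddCommGroup (FormSpace V) := inferInstanceAs (AddCommGroup V)

instance (V : Type*) [AddCommGroup V] [Module ℂ V] : Module ℂ (FormSpace V) :=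
  inferInstanceAs (Module ℂ V)

variable {V L : Type*} [NormedAddCommGroup V] [NormedSpace ℂ V] [CompleteSpace V]
  [NormedAddCommGroup L] [InnerProductSpace ℂ L] [CompleteSpace L]

/-- A bounded symmetric form that dominates the norm of `L` and for which the domain is complete
is coercive, by the open mapping theorem, and the equation `b(x, v) = ⟨J x, f⟩` is uniquely
solvable, by the Riesz representation theorem. -/
lemma exists_resolvent (J : V →L[ℂ] L) (b : V →ₗ⋆[ℂ] V →ₗ[ℂ] ℂ)
    (hsymm : ∀ x y, starRingEnd ℂ (b y x) = b x y) {C : ℝ} (hC : ∀ x, (b x x).re ≤ C * ‖x‖ ^ 2)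
    (hpos : ∀ x, ‖J x‖ ^ 2 ≤ (b x x).re) (hJ : ∀ x, J x = 0 → x = 0)
    (hcomplete : ∀ x : ℕ → V,
      (∀ ε : ℝ, 0 < ε → ∃ N, ∀ m ≥ N, ∀ n ≥ N, (b (x m - x n) (x m - x n)).re < ε) →
      ∃ y, Tendsto (fun n => (b (x n - y) (x n - y)).re) atTop (𝓝 0)) :
    (∃ c : ℝ, 0 < c ∧ ∀ x, c * ‖x‖ ^ 2 ≤ (b x x).re) ∧
    ∃ R : L →L[ℂ] V, ∀ x f, b x (R f) = inner ℂ (J x) f := by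
  let core : InnerProductSpace.Core ℂ (FormSpace V) :=
    { inner := fun x y => b x y
      conj_inner_symm := hsymm
      re_inner_nonneg := fun x => (sq_nonneg _).trans (hpos x)
      add_left := fun x y z => by
        exact (congrArg (fun l => l z) (map_add b x y))
      smul_left := fun x y r => by
        exact (congrArg (fun l => l y) (map_smulₛₗ b r x))
      definite := fun x hx => by
        have h1 := hpos x
        have hx' : b x x = 0 := hx
        rw [hx'] at h1
        apply hJ x
        have : ‖J x‖ ^ 2 = 0 := le_antisymm h1 (sq_nonneg _)
        simpa using this }
  let _ : NormedAddCommGroup (FormSpace V) := core.toNormedAddCommGroup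
  let _ : InnerProductSpace ℂ (FormSpace V) := InnerProductSpace.ofCore core.toCore
  have hnorm : ∀ x : FormSpace V, ‖x‖ ^ 2 = (b x x).re := fun x => norm_sq_eq_re_inner (𝕜 := ℂ) x
  have hlt : ∀ (x : FormSpace V) {ε : ℝ}, 0 < ε → (‖x‖ < ε ↔ (b x x).re < ε ^ 2) := by
    intro x ε hε
    rw [← hnorm]
    exact (sq_lt_sq₀ (norm_nonneg _) hε.le).symm
  have : CompleteSpace (FormSpace V) := by
    refine Metric.complete_of_cauchySeq_tendsto fun x hx => ?_
    rw [Metric.cauchySeq_iff] at hx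
    obtain ⟨y, hy⟩ := hcomplete x fun ε hε => by
      obtain ⟨N, hN⟩ := hx (Real.sqrt ε) (Real.sqrt_pos.2 hε)
      refine ⟨N, fun m hm n hn => ?_⟩
      have := hN m hm n hn
      rw [dist_eq_norm] at this
      have h2 := (hlt _ (Real.sqrt_pos.2 hε)).1 this
      rwa [Real.sq_sqrt hε.le] at h2
    let y' : FormSpace V := y
    refine ⟨y', Metric.tendsto_atTop.2 fun ε hε => ?_⟩
    obtain ⟨N, hN⟩ := Metric.tendsto_atTop.1 hy (ε ^ 2) (by positivity)
    refine ⟨N, fun n hn => ?_⟩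
    have := hN n hn
    rw [Real.dist_eq, sub_zero] at this
    have h2 : ‖x n - y'‖ < ε := (hlt _ hε).2 ((le_abs_self _).trans_lt this)
    rwa [← dist_eq_norm] at h2
  let e : V ≃ₗ[ℂ] FormSpace V := LinearEquiv.refl ℂ V
  have he : Continuous e := by
    have hb : ∀ x : V, ‖e x‖ ≤ Real.sqrt C * ‖x‖ := fun x => by
      rcases eq_or_ne x 0 with rfl | hx
      · simp
      have hC0 : 0 ≤ C := by
        have h1 := (sq_nonneg _).trans ((hpos x).trans (hC x))
        have h2 : 0 < ‖x‖ ^ 2 := by positivity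
        exact nonneg_of_mul_nonneg_left h1 h2
      refine le_of_sq_le_sq ?_ (by positivity)
      rw [hnorm, mul_pow, Real.sq_sqrt hC0]
      exact hC x
    exact AddMonoidHomClass.continuous_of_bound e _ hb
  let E := e.toContinuousLinearEquivOfContinuous he
  constructor
  · set K := ‖(E.symm : FormSpace V →L[ℂ] V)‖
    refine ⟨((K + 1) ^ 2)⁻¹, by positivity, fun x => ?_⟩
    have h1 : ‖x‖ ≤ K * ‖e x‖ := (E.symm : FormSpace V →L[ℂ] V).le_opNorm (e x)
    have h2 : ‖x‖ ≤ (K + 1) * ‖e x‖ := h1.trans (by gcongr; linarith)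
    have h3 : (b x x).re = ‖e x‖ ^ 2 := (hnorm (e x)).symm
    rw [inv_mul_le_iff₀ (by positivity), h3, ← mul_pow]
    gcongr
  · let J' : FormSpace V →L[ℂ] L := J.comp (E.symm : FormSpace V →L[ℂ] V)
    refine ⟨(E.symm : FormSpace V →L[ℂ] V).comp (ContinuousLinearMap.adjoint J'), fun x f => ?_⟩
    exact ContinuousLinearMap.adjoint_inner_right J' (e x) f

end ClosedForm

/-! ### The semigroup generated by an operator with positive resolvent -/

section Semigroup

/-- The functions `e^{-z/r} r^{-k}` of `r > 0`, extended by zero. -/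
def expInv (k : ℕ) (z : ℂ) (r : ℝ) : ℂ := if r ≤ 0 then 0 else Complex.exp (-z / r) / r ^ k

lemma expInv_of_pos {k : ℕ} {z : ℂ} {r : ℝ} (hr : 0 < r) :
    expInv k z r = Complex.exp (-z / r) / r ^ k := if_neg hr.not_ge

lemma norm_exp_neg_div (z : ℂ) (r : ℝ) : ‖Complex.exp (-z / r)‖ = Real.exp (-(z.re / r)) := by
  rw [Complex.norm_exp, Complex.div_ofReal_re, Complex.neg_re, neg_div]

/-- `e^{-x/r} r^{-k} ≤ (k+1)! r / x^{k+1}`. -/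
lemma exp_neg_div_le (k : ℕ) {x r : ℝ} (hx : 0 < x) (hr : 0 < r) :
    Real.exp (-(x / r)) / r ^ k ≤ (k + 1).factorial / x ^ (k + 1) * r := by
  have h := Real.pow_div_factorial_le_exp (x / r) (by positivity) (k + 1)
  rw [Real.exp_neg, div_le_iff₀ (by positivity), inv_le_comm₀ (Real.exp_pos _) (by positivity)]
  refine le_trans (le_of_eq ?_) h
  rw [div_pow]
  field_simp
  ring

lemma norm_expInv_le (k : ℕ) {z : ℂ} (hz : 0 < z.re) (r : ℝ) :
    ‖expInv k z r‖ ≤ (k + 1).factorial / z.re ^ (k + 1) * |r| := by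
  rcases le_or_gt r 0 with hr | hr
  · rw [expInv, if_pos hr, norm_zero]; positivity
  · rw [expInv_of_pos hr, norm_div, norm_pow, norm_exp_neg_div, Complex.norm_real,
      Real.norm_of_nonneg hr.le, abs_of_pos hr]
    exact exp_neg_div_le k hz hr

lemma continuous_expInv (k : ℕ) {z : ℂ} (hz : 0 < z.re) : Continuous (expInv k z) := by
  rw [continuous_iff_continuousAt]
  intro r
  rcases lt_trichotomy r 0 with hr | rfl | hr
  · have : expInv k z =ᶠ[𝓝 r] fun _ => 0 := by
      filter_upwards [gt_mem_nhds hr] with s hs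
      exact if_pos hs.le
    exact continuousAt_const.congr this.symm
  · have h0 : expInv k z 0 = 0 := if_pos le_rfl
    rw [ContinuousAt, h0]
    refine squeeze_zero_norm (norm_expInv_le k hz) ?_
    have : Tendsto (fun r : ℝ => (k + 1).factorial / z.re ^ (k + 1) * |r|) (𝓝 0)
        (𝓝 ((k + 1).factorial / z.re ^ (k + 1) * |0|)) :=
      (continuous_const.mul continuous_abs).tendsto 0
    simpa using this
  · have : expInv k z =ᶠ[𝓝 r] fun s => Complex.exp (-z / s) / s ^ k := by
      filter_upwards [lt_mem_nhds hr] with s hs using expInv_of_pos hs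
    refine ContinuousAt.congr ?_ this.symm
    have hr' : (r : ℂ) ≠ 0 := by exact_mod_cast hr.ne'
    have hc : ContinuousAt (fun s : ℝ => (s : ℂ)) r := Complex.continuous_ofReal.continuousAt
    exact ((continuousAt_const.div hc hr').cexp).div (hc.pow k) (pow_ne_zero k hr')

variable {L : Type*} [NormedAddCommGroup L] [InnerProductSpace ℂ L] [CompleteSpace L]

/-- The hypotheses on the resolvent `R = (H + ω)⁻¹`. -/
structure IsResolvent (R : L →L[ℂ] L) : Prop where
  nonneg : 0 ≤ R
  norm_le : ‖R‖ ≤ 1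
  inj : ∀ f, R f = 0 → f = 0

/-- `e^{-z R⁻¹} R^{-k}`, by the continuous functional calculus. -/
def semi (R : L →L[ℂ] L) (k : ℕ) (z : ℂ) : L →L[ℂ] L := cfc (fun w : ℂ => expInv k z w.re) R

variable {R : L →L[ℂ] L} (hR : IsResolvent R)
include hR

lemma IsResolvent.isSelfAdjoint : IsSelfAdjoint R := .of_nonneg hR.nonneg

lemma IsResolvent.spectrum {w : ℂ} (hw : w ∈ spectrum ℂ R) : ∃ r : ℝ, 0 ≤ r ∧ r ≤ 1 ∧ w = r := by
  have h1 := hR.isSelfAdjoint.spectrumRestricts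
  have h2 := h1.rightInvOn hw
  have h3 : w.re ∈ _root_.spectrum ℝ R := h1.apply_mem hw
  have h4 := spectrum_nonneg_of_nonneg hR.nonneg h3
  refine ⟨w.re, h4, ?_, h2.symm⟩
  have h5 := IsometricContinuousFunctionalCalculus.norm_spectrum_le R hw hR.isSelfAdjoint.isStarNormal
  exact (Complex.re_le_norm w).trans (h5.trans hR.norm_le)

omit hR in
lemma continuous_symbol (k : ℕ) {z : ℂ} (hz : 0 < z.re) :
    Continuous fun w : ℂ => expInv k z w.re := (continuous_expInv k hz).comp Complex.continuous_re

lemma IsResolvent.norm_cfc_le {f : ℂ → ℂ} {c : ℝ} (hc : 0 ≤ c)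
    (h : ∀ r : ℝ, 0 ≤ r → r ≤ 1 → ‖f r‖ ≤ c) : ‖cfc f R‖ ≤ c := by
  refine _root_.norm_cfc_le hc fun w hw => ?_
  obtain ⟨r, hr, hr1, rfl⟩ := hR.spectrum hw
  exact h r hr hr1

lemma semi_add {z z' : ℂ} (hz : 0 < z.re) (hz' : 0 < z'.re) :
    semi R 0 (z + z') = semi R 0 z * semi R 0 z' := by
  have := hR.isSelfAdjoint.isStarNormal
  rw [semi, semi, semi, ← cfc_mul _ _ R (continuous_symbol 0 hz).continuousOn
    (continuous_symbol 0 hz').continuousOn]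
  refine cfc_congr fun w _ => ?_
  rcases le_or_gt w.re 0 with h | h
  · simp [expInv, h]
  · rw [expInv_of_pos h, expInv_of_pos h, expInv_of_pos h, neg_add, add_div, Complex.exp_add]
    simp

lemma mul_semi {z : ℂ} (hz : 0 < z.re) : R * semi R 1 z = semi R 0 z := by
  have := hR.isSelfAdjoint.isStarNormal
  nth_rw 1 [← cfc_id' ℂ R]
  rw [semi, semi, ← cfc_mul (fun w => w) (fun w => expInv 1 z w.re) R
    continuousOn_id (continuous_symbol 1 hz).continuousOn]
  refine cfc_congr fun w hw => ?_
  obtain ⟨r, hr, -, rfl⟩ := hR.spectrum hw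
  simp only [Complex.ofReal_re]
  rcases hr.eq_or_lt with rfl | h
  · simp [expInv]
  · have : (r : ℂ) ≠ 0 := by exact_mod_cast h.ne'
    rw [expInv_of_pos h, expInv_of_pos h]; field_simp

lemma semi_comm {z : ℂ} (k : ℕ) (f : L) : semi R k z (R f) = R (semi R k z f) := by
  have := (cfc_commute_cfc (fun w : ℂ => expInv k z w.re) (fun w => w) R).eq
  rw [cfc_id' ℂ R hR.isSelfAdjoint.isStarNormal] at this
  exact congrArg (fun A : L →L[ℂ] L => A f) this

lemma norm_semi_le {z : ℂ} (hz : 0 < z.re) : ‖semi R 0 z‖ ≤ 1 := by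
  refine hR.norm_cfc_le zero_le_one fun r hr _ => ?_
  rcases hr.eq_or_lt with rfl | h
  · simp [expInv]
  · rw [Complex.ofReal_re, expInv_of_pos h, pow_zero, div_one, norm_exp_neg_div]
    exact Real.exp_le_one_iff.2 (neg_nonpos.2 (by positivity))

omit hR in
lemma semi_isSelfAdjoint (t : ℝ) : IsSelfAdjoint (semi R 0 (t : ℂ)) := by
  rw [IsSelfAdjoint, semi, ← cfc_star]
  refine cfc_congr fun w _ => ?_
  rcases le_or_gt w.re 0 with h | h
  · simp [expInv, h]
  · rw [expInv_of_pos h, pow_zero, div_one, Complex.star_def, ← Complex.exp_conj]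
    simp

/-- The semigroup is holomorphic in the right half-plane. -/
lemma hasDerivAt_semi {z : ℂ} (hz : 0 < z.re) : HasDerivAt (semi R 0) (-semi R 1 z) z := by
  have hstar := hR.isSelfAdjoint.isStarNormal
  set C : ℝ := 6 / (z.re / 2) ^ 3
  have key : ∀ h : ℂ, ‖h‖ < z.re / 2 →
      ‖semi R 0 (z + h) - semi R 0 z - h • (-semi R 1 z)‖ ≤ C * ‖h‖ ^ 2 := by
    intro h hh
    have hre : 0 < (z + h).re := by
      rw [Complex.add_re]
      have := (abs_le.1 (Complex.abs_re_le_norm h)).1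
      linarith
    have e : semi R 0 (z + h) - semi R 0 z - h • (-semi R 1 z) =
        cfc (fun w : ℂ => expInv 0 (z + h) w.re - expInv 0 z w.re - (-h) * expInv 1 z w.re) R := by
      have c0 := (continuous_symbol 0 hre).continuousOn (s := _root_.spectrum ℂ R)
      have c1 := (continuous_symbol 0 hz).continuousOn (s := _root_.spectrum ℂ R)
      have c2 := (continuous_symbol 1 hz).continuousOn (s := _root_.spectrum ℂ R)
      rw [cfc_sub (fun w : ℂ => expInv 0 (z + h) w.re - expInv 0 z w.re)
        (fun w : ℂ => (-h) * expInv 1 z w.re) R (c0.fun_sub c1) (continuousOn_const.mul c2),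
        cfc_sub _ _ R c0 c1, cfc_const_mul _ _ R c2]
      simp [semi]
    rw [e]
    refine hR.norm_cfc_le (by positivity) fun r hr hr1 => ?_
    rw [Complex.ofReal_re]
    rcases hr.eq_or_lt with rfl | hr
    · simp only [expInv, le_refl, if_true]
      simp; positivity
    have hrc : (r : ℂ) ≠ 0 := by exact_mod_cast hr.ne'
    have e2 : expInv 0 (z + h) r - expInv 0 z r - (-h) * expInv 1 z r =
        Complex.exp (-z / r) * (Complex.exp (-h / r) - ∑ m ∈ Finset.range 2,
          (-h / r) ^ m / (m.factorial : ℂ)) := by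
      rw [expInv_of_pos hr, expInv_of_pos hr, expInv_of_pos hr, neg_add, add_div, Complex.exp_add]
      simp [Finset.sum_range_succ]
      field_simp
      ring
    rw [e2, norm_mul, norm_exp_neg_div]
    have h1 := Complex.norm_exp_sub_sum_le_norm_mul_exp (-h / r) 2
    have hn : ‖-h / (r : ℂ)‖ = ‖h‖ / r := by
      rw [norm_div, norm_neg, Complex.norm_real, Real.norm_of_nonneg hr.le]
    rw [hn] at h1
    have h2 := exp_neg_div_le 2 (half_pos hz) hr
    calc _ ≤ Real.exp (-(z.re / r)) * ((‖h‖ / r) ^ 2 * Real.exp (‖h‖ / r)) := by gcongr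
      _ ≤ Real.exp (-(z.re / r)) * ((‖h‖ / r) ^ 2 * Real.exp (z.re / 2 / r)) := by gcongr
      _ = ‖h‖ ^ 2 * (Real.exp (-(z.re / 2 / r)) / r ^ 2) := by
          have : Real.exp (-(z.re / 2 / r)) = Real.exp (-(z.re / r)) * Real.exp (z.re / 2 / r) := by
            rw [← Real.exp_add]; congr 1; ring
          rw [this]; ring
      _ ≤ ‖h‖ ^ 2 * (C * 1) := by
          gcongr
          refine h2.trans (mul_le_mul (le_of_eq ?_) hr1 hr.le (by positivity))
          norm_num [C, Nat.factorial]
      _ = C * ‖h‖ ^ 2 := by ring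
  rw [hasDerivAt_iff_isLittleO_nhds_zero]
  have hO : (fun h : ℂ => semi R 0 (z + h) - semi R 0 z - h • (-semi R 1 z)) =O[𝓝 0]
      fun h => ‖h‖ ^ 2 := by
    refine Asymptotics.IsBigO.of_bound C ?_
    filter_upwards [Metric.ball_mem_nhds (0 : ℂ) (half_pos hz)] with h hh
    rw [Real.norm_of_nonneg (by positivity)]
    exact key h (by simpa using hh)
  refine hO.trans_isLittleO ?_
  have h3 := Asymptotics.isLittleO_pow_id (𝕜 := ℂ) (n := 2) (by norm_num)
  have h4 := h3.norm_left
  simpa only [norm_pow] using h4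

/-- The operator form of `|e^{-z/r} - 1| r ≤ |z|`. -/
lemma norm_semi_mul_sub_le {z : ℂ} (hz : 0 < z.re) : ‖semi R 0 z * R - R‖ ≤ ‖z‖ := by
  have hstar := hR.isSelfAdjoint.isStarNormal
  have e : semi R 0 z * R - R = cfc (fun w : ℂ => expInv 0 z w.re * w - w) R := by
    have c0 := (continuous_symbol 0 hz).continuousOn (s := _root_.spectrum ℂ R)
    have c1 := (continuous_id' (X := ℂ)).continuousOn (s := _root_.spectrum ℂ R)
    rw [cfc_sub (fun w : ℂ => expInv 0 z w.re * w) (fun w => w) R (c0.fun_mul c1) c1,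
      cfc_mul _ (fun w => w) R c0 c1, cfc_id' ℂ R]
    rfl
  rw [e]
  refine hR.norm_cfc_le (norm_nonneg _) fun r hr _ => ?_
  rw [Complex.ofReal_re]
  rcases hr.eq_or_lt with rfl | hr
  · simp
  rw [expInv_of_pos hr, pow_zero, div_one, ← sub_one_mul, norm_mul, Complex.norm_real,
    Real.norm_of_nonneg hr.le]
  have h1 : ‖Complex.exp (-z / r) - 1‖ ≤ ‖z‖ / r := by
    -- the mean value inequality on the left half-plane, where the exponential is a contraction
    have hconv : Convex ℝ {w : ℂ | w.re ≤ 0} := convex_halfSpace_re_le 0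
    have := hconv.norm_image_sub_le_of_norm_hasDerivWithin_le (f := Complex.exp)
      (f' := Complex.exp) (C := 1) (x := 0) (y := -z / r)
      (fun w _ => (Complex.hasDerivAt_exp w).hasDerivWithinAt)
      (fun w hw => by rw [Complex.norm_exp]; exact Real.exp_le_one_iff.2 hw) (by simp)
      (by
        change (-z / r : ℂ).re ≤ 0
        rw [Complex.div_ofReal_re, Complex.neg_re]
        exact div_nonpos_of_nonpos_of_nonneg (by linarith) hr.le)
    rw [Complex.exp_zero, sub_zero, one_mul, norm_div, norm_neg, Complex.norm_real,
      Real.norm_of_nonneg hr.le] at this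
    exact this
  calc _ ≤ ‖z‖ / r * r := by gcongr
    _ = ‖z‖ := by field_simp

/-- The operator form of `0 ≤ e^{-y} - 1 + y ≤ y²`, `y = t / r`, multiplied by `r²`. -/
lemma norm_semi_second_order {t : ℝ} (ht : 0 < t) :
    ‖semi R 0 t * R * R - R * R + (t : ℂ) • R‖ ≤ t ^ 2 := by
  have hstar := hR.isSelfAdjoint.isStarNormal
  have hz : 0 < (t : ℂ).re := by simpa using ht
  have e : semi R 0 t * R * R - R * R + (t : ℂ) • R =
      cfc (fun w : ℂ => expInv 0 t w.re * w * w - w * w + t * w) R := by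
    have c0 := (continuous_symbol 0 hz).continuousOn (s := _root_.spectrum ℂ R)
    have c1 := (continuous_id' (X := ℂ)).continuousOn (s := _root_.spectrum ℂ R)
    rw [cfc_add R (fun w : ℂ => expInv 0 t w.re * w * w - w * w) (fun w => t * w)
        (((c0.fun_mul c1).fun_mul c1).fun_sub (c1.fun_mul c1)) (continuousOn_const.mul c1),
      cfc_sub (fun w : ℂ => expInv 0 t w.re * w * w) (fun w => w * w) R
        ((c0.fun_mul c1).fun_mul c1) (c1.fun_mul c1),
      cfc_mul (fun w : ℂ => expInv 0 t w.re * w) (fun w => w) R (c0.fun_mul c1) c1,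
      cfc_mul _ (fun w => w) R c0 c1, cfc_mul (fun w => w) (fun w => w) R c1 c1,
      cfc_const_mul _ (fun w => w) R c1, cfc_id' ℂ R]
    rfl
  rw [e]
  refine hR.norm_cfc_le (by positivity) fun r hr hr1 => ?_
  rw [Complex.ofReal_re]
  rcases hr.eq_or_lt with rfl | hr
  · simp; positivity
  have hrc : (r : ℂ) ≠ 0 := by exact_mod_cast hr.ne'
  have e2 : expInv 0 t r * r * r - r * r + t * r =
      (((Real.exp (-(t / r)) - 1 + t / r) * r ^ 2 : ℝ) : ℂ) := by
    rw [expInv_of_pos hr]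
    push_cast
    rw [neg_div]
    field_simp
  rw [e2, Complex.norm_real, Real.norm_eq_abs, abs_mul, abs_of_pos (pow_pos hr 2)]
  have hy : 0 < t / r := by positivity
  have h1 : |Real.exp (-(t / r)) - 1 + t / r| ≤ (t / r) ^ 2 := by
    have h0 : 0 ≤ Real.exp (-(t / r)) - 1 + t / r := by
      linarith [Real.add_one_le_exp (-(t / r))]
    rw [abs_of_nonneg h0]
    rcases le_or_gt (t / r) 1 with h | h
    · have := Real.abs_exp_sub_one_sub_id_le (x := -(t / r)) (by rw [abs_neg, abs_of_pos hy]; exact h)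
      rw [neg_sq] at this
      linarith [(abs_le.1 this).2]
    · have : Real.exp (-(t / r)) ≤ 1 := Real.exp_le_one_iff.2 (by linarith)
      nlinarith
  calc _ ≤ (t / r) ^ 2 * r ^ 2 := by gcongr
    _ = t ^ 2 := by field_simp

lemma IsResolvent.denseRange : DenseRange R := by
  have h1 : (LinearMap.range (R : L →ₗ[ℂ] L)).topologicalClosure = ⊤ := by
    rw [Submodule.topologicalClosure_eq_top_iff, Submodule.eq_bot_iff]
    intro f hf
    refine hR.inj f (inner_self_eq_zero (𝕜 := ℂ).1 ?_)
    have h2 := (Submodule.mem_orthogonal _ _).1 hf (R (R f)) ⟨R f, rfl⟩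
    have h3 : inner ℂ (R (R f)) f = inner ℂ (R f) (R f) :=
      hR.isSelfAdjoint.isSymmetric (R f) f
    rw [← h3, h2]
  intro x
  have h2 : x ∈ (LinearMap.range (R : L →ₗ[ℂ] L)).topologicalClosure := h1 ▸ Submodule.mem_top
  exact h2

/-- Strong convergence to zero of a bounded family of operators can be tested on the range
of `R`. -/
lemma IsResolvent.tendsto_of_range {ι : Type*} {l : Filter ι} {D : ι → L →L[ℂ] L} {B : ℝ}
    (hD : ∀ᶠ i in l, ‖D i‖ ≤ B) (h : ∀ k, Tendsto (fun i => D i (R k)) l (𝓝 0)) (g : L) :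
    Tendsto (fun i => D i g) l (𝓝 0) := by
  rw [Metric.tendsto_nhds]
  intro ε hε
  set B' := max B 0
  have hB' : 0 ≤ B' := le_max_right _ _
  obtain ⟨_, ⟨k, rfl⟩, hk⟩ := Metric.mem_closure_iff.1 (hR.denseRange g) (ε / (2 * (B' + 1)))
    (by positivity)
  filter_upwards [hD, Metric.tendsto_nhds.1 (h k) (ε / 2) (by positivity)] with i h1 h2
  rw [dist_zero_right] at h2 ⊢
  have h3 : ‖D i (g - R k)‖ ≤ ε / 2 := by
    refine ((D i).le_opNorm _).trans ?_
    rw [dist_eq_norm] at hk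
    calc ‖D i‖ * ‖g - R k‖ ≤ (B' + 1) * (ε / (2 * (B' + 1))) := by
          gcongr
          exact h1.trans ((le_max_left _ _).trans (le_add_of_nonneg_right zero_le_one))
      _ = ε / 2 := by field_simp
  have h4 : D i g = D i (g - R k) + D i (R k) := by rw [map_sub]; abel
  rw [h4]
  linarith [norm_add_le (D i (g - R k)) (D i (R k))]

/-- Strong continuity at the vertex of the right half-plane. -/
lemma tendsto_semi (g : L) : Tendsto (fun z => semi R 0 z g) (𝓝[{z | 0 < z.re}] 0) (𝓝 g) := by
  have h := hR.tendsto_of_range (l := 𝓝[{z : ℂ | 0 < z.re}] 0)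
    (D := fun z => semi R 0 z - 1) (B := 2) ?_ ?_ g
  · have h2 := h.add_const g
    simpa using h2
  · filter_upwards [self_mem_nhdsWithin] with z hz
    have h1 : ‖(1 : L →L[ℂ] L)‖ ≤ 1 := ContinuousLinearMap.norm_id_le
    linarith [norm_sub_le (semi R 0 z) 1, norm_semi_le hR hz]
  · intro k
    have h1 : Tendsto (fun z : ℂ => ‖z‖ * ‖k‖) (𝓝[{z | 0 < z.re}] 0) (𝓝 0) := by
      have : Tendsto (fun z : ℂ => ‖z‖ * ‖k‖) (𝓝 0) (𝓝 (‖(0 : ℂ)‖ * ‖k‖)) :=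
        (continuous_norm.mul continuous_const).tendsto 0
      rw [norm_zero, zero_mul] at this
      exact this.mono_left nhdsWithin_le_nhds
    refine squeeze_zero_norm' ?_ h1
    filter_upwards [self_mem_nhdsWithin] with z hz
    have h2 := (semi R 0 z * R - R).le_of_opNorm_le (norm_semi_mul_sub_le hR hz) k
    simpa using h2

/-- The difference quotient at zero on the range of `R`. -/
lemma tendsto_semi_quotient (g : L) : Tendsto
    (fun t : ℝ => ((t⁻¹ : ℝ) : ℂ) • (semi R 0 t (R g) - R g)) (𝓝[>] 0) (𝓝 (-g)) := by
  have h := hR.tendsto_of_range (l := 𝓝[>] (0 : ℝ))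
    (D := fun t => ((t⁻¹ : ℝ) : ℂ) • (semi R 0 t * R - R) + 1) (B := 2) ?_ ?_ g
  · have h2 := h.add_const (-g)
    simpa using h2
  · filter_upwards [self_mem_nhdsWithin] with t ht
    have ht' : 0 < t := ht
    have h1 : ‖(1 : L →L[ℂ] L)‖ ≤ 1 := ContinuousLinearMap.norm_id_le
    have h2 := norm_semi_mul_sub_le hR (z := (t : ℂ)) (by simpa using ht')
    have h3 : ‖((t⁻¹ : ℝ) : ℂ) • (semi R 0 t * R - R)‖ ≤ 1 := by
      rw [norm_smul, Complex.norm_real, Real.norm_of_nonneg (by positivity)]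
      rw [Complex.norm_real, Real.norm_of_nonneg ht'.le] at h2
      calc t⁻¹ * _ ≤ t⁻¹ * t := by gcongr
        _ = 1 := by field_simp
    linarith [norm_add_le (((t⁻¹ : ℝ) : ℂ) • (semi R 0 t * R - R)) 1]
  · intro k
    have h1 : Tendsto (fun t : ℝ => t * ‖k‖) (𝓝[>] 0) (𝓝 0) := by
      have : Tendsto (fun t : ℝ => t * ‖k‖) (𝓝 0) (𝓝 (0 * ‖k‖)) :=
        (continuous_id.mul continuous_const).tendsto 0
      rw [zero_mul] at this
      exact this.mono_left nhdsWithin_le_nhds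
    refine squeeze_zero_norm' ?_ h1
    filter_upwards [self_mem_nhdsWithin] with t ht
    have ht' : 0 < t := ht
    have htc : (t : ℂ) ≠ 0 := by exact_mod_cast ht'.ne'
    have h2 := (semi R 0 t * R * R - R * R + (t : ℂ) • R).le_of_opNorm_le
      (norm_semi_second_order hR ht') k
    have e : (((t⁻¹ : ℝ) : ℂ) • (semi R 0 t * R - R) + 1) (R k) =
        ((t⁻¹ : ℝ) : ℂ) • (semi R 0 t * R * R - R * R + (t : ℂ) • R) k := by
      have h3 : k = ((t⁻¹ : ℝ) : ℂ) • (t : ℂ) • k := by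
        rw [smul_smul, ← Complex.ofReal_mul, inv_mul_cancel₀ ht'.ne', Complex.ofReal_one, one_smul]
      simp only [add_apply, sub_apply,
        mul_apply_eq_comp, smul_apply,
        one_apply_eq_self, smul_add]
      congr 1
      nth_rw 1 [h3, map_smul, map_smul]
    rw [e, norm_smul, Complex.norm_real, Real.norm_of_nonneg (by positivity)]
    calc t⁻¹ * _ ≤ t⁻¹ * (t ^ 2 * ‖k‖) := by gcongr
      _ = t * ‖k‖ := by field_simp

/-- The generator of the semigroup `e^{ω t} e^{-t R⁻¹}` is `ω - R⁻¹`. -/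
lemma semi_generator (ω : ℝ) (u f : L) : u = R (f + (ω : ℂ) • u) ↔ Tendsto (fun t : ℝ =>
    ((t⁻¹ : ℝ) : ℂ) • (((Real.exp (ω * t) : ℝ) : ℂ) • semi R 0 t u - u)) (𝓝[>] 0) (𝓝 (-f)) := by
  have hd : HasDerivAt (fun t : ℝ => Real.exp (ω * t)) ω 0 := by
    have := ((hasDerivAt_id (0 : ℝ)).const_mul ω).exp
    simpa using this
  have hquot : Tendsto (fun t : ℝ => t⁻¹ * (Real.exp (ω * t) - 1)) (𝓝[>] 0) (𝓝 ω) := by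
    have h1 := hd.tendsto_slope_zero_right
    simpa using h1
  have hexp : Tendsto (fun t : ℝ => Real.exp (ω * t)) (𝓝[>] 0) (𝓝 1) := by
    have := hd.continuousAt.tendsto
    simp only [mul_zero, Real.exp_zero] at this
    exact this.mono_left nhdsWithin_le_nhds
  have key : ∀ g : L, Tendsto (fun t : ℝ => ((t⁻¹ : ℝ) : ℂ) •
      (((Real.exp (ω * t) : ℝ) : ℂ) • semi R 0 t (R g) - R g)) (𝓝[>] 0)
      (𝓝 (-g + (ω : ℂ) • R g)) := by
    intro g
    have h1 := ((Complex.continuous_ofReal.tendsto _).comp hexp).smul (tendsto_semi_quotient hR g)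
    have h2 := ((Complex.continuous_ofReal.tendsto _).comp hquot).smul_const (R g)
    have h3 := h1.add h2
    rw [Complex.ofReal_one, one_smul] at h3
    refine h3.congr fun t => ?_
    simp only [Function.comp_apply]
    push_cast
    module
  constructor
  · intro hu
    have h1 := key (f + (ω : ℂ) • u)
    rw [← hu] at h1
    convert h1 using 2
    abel
  · intro hlim
    have h1 := (R.continuous.tendsto _).comp hlim
    have h2 := key u
    have h3 : (fun t : ℝ => ((t⁻¹ : ℝ) : ℂ) • (((Real.exp (ω * t) : ℝ) : ℂ) •
        semi R 0 t (R u) - R u)) = (R ∘ fun t : ℝ =>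
        ((t⁻¹ : ℝ) : ℂ) • (((Real.exp (ω * t) : ℝ) : ℂ) • semi R 0 t u - u)) := by
      funext t
      simp only [Function.comp_apply, map_smul, map_sub, semi_comm hR]
    rw [h3] at h2
    have h4 := tendsto_nhds_unique h1 h2
    rw [map_neg] at h4
    rw [map_add, map_smul]
    have h5 : R f = u - (ω : ℂ) • R u := by
      rw [← neg_neg (R f), h4]; abel
    rw [h5]; abel

end Semigroup

/-! ### The form and its coefficients -/

section Form

open scoped ENNReal

variable {Ω : Set Plane} {α β γ : Plane → ℝ} {a₀ a₁ δ : ℝ}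

lemma UniformlyElliptic.mono {a₁' δ' : ℝ} (hE : UniformlyElliptic a₀ a₁ δ Ω α β γ)
    (h1 : a₁ ≤ a₁') (hδ : δ' ≤ δ) : UniformlyElliptic a₀ a₁' δ' Ω α β γ where
  meas_α := hE.meas_α
  meas_β := hE.meas_β
  meas_γ := hE.meas_γ
  bound_α := hE.bound_α.mono fun _ h => ⟨h.1, h.2.trans h1⟩
  bound_β := hE.bound_β.mono fun _ h => h.trans h1
  bound_γ := hE.bound_γ.mono fun _ h => ⟨h.1, h.2.trans h1⟩
  ratio := hE.ratio.mono fun _ h => by linarith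

section

variable (hE : UniformlyElliptic a₀ a₁ δ Ω α β γ)
include hE

lemma UniformlyElliptic.abs_α (ha₀ : 0 < a₀) : ∀ᵐ x ∂(mu Ω), |α x| ≤ a₁ :=
  hE.bound_α.mono fun _ h => abs_le.2 ⟨by linarith, h.2⟩

lemma UniformlyElliptic.abs_γ (ha₀ : 0 < a₀) : ∀ᵐ x ∂(mu Ω), |γ x| ≤ a₁ :=
  hE.bound_γ.mono fun _ h => abs_le.2 ⟨by linarith, h.2⟩

lemma UniformlyElliptic.bdd_α (ha₀ : 0 < a₀) : MemLp α ∞ (mu Ω) :=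
  bdd_of_le hE.meas_α (hE.abs_α ha₀)

lemma UniformlyElliptic.bdd_β : MemLp β ∞ (mu Ω) := bdd_of_le hE.meas_β hE.bound_β

lemma UniformlyElliptic.bdd_γ (ha₀ : 0 < a₀) : MemLp γ ∞ (mu Ω) :=
  bdd_of_le hE.meas_γ (hE.abs_γ ha₀)

end

/-- The sum of the squared norms of the second derivatives. -/
def hessSq (h : Fin 2 → Fin 2 → L2 Ω) : ℝ := ‖h 0 0‖ ^ 2 + ‖h 0 1‖ ^ 2 + ‖h 1 1‖ ^ 2

lemma hessSq_nonneg (h : Fin 2 → Fin 2 → L2 Ω) : 0 ≤ hessSq h := by unfold hessSq; positivity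

section

variable (hα : MemLp α ∞ (mu Ω)) (hβ : MemLp β ∞ (mu Ω)) (hγ : MemLp γ ∞ (mu Ω))
include hα hβ hγ

lemma form_eq (h k : Fin 2 → Fin 2 → L2 Ω) : form Ω α β γ h k =
    inner ℂ (k 0 0) (mulOp (mu Ω) α (h 0 0)) + 2 * inner ℂ (k 0 1) (mulOp (mu Ω) β (h 0 1)) +
      inner ℂ (k 1 1) (mulOp (mu Ω) γ (h 1 1)) := by
  obtain ⟨i1, e1⟩ := inner_mulOp hα (h 0 0) (k 0 0)
  obtain ⟨i2, e2⟩ := inner_mulOp hβ (h 0 1) (k 0 1)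
  obtain ⟨i3, e3⟩ := inner_mulOp hγ (h 1 1) (k 1 1)
  have i4 : Integrable (fun x => (α x : ℂ) * (h 0 0 x * starRingEnd ℂ (k 0 0 x)) +
    2 * ((β x : ℂ) * (h 0 1 x * starRingEnd ℂ (k 0 1 x)))) (mu Ω) := i1.add (i2.const_mul 2)
  rw [e1, e2, e3, ← integral_const_mul, ← integral_add i1 (i2.const_mul 2),
    ← integral_add i4 i3, form]
  congr 1
  ext x
  ring

lemma form_self_re (h : Fin 2 → Fin 2 → L2 Ω) : (form Ω α β γ h h).re =
    br (mu Ω) α (h 0 0) (h 0 0) + 2 * br (mu Ω) β (h 0 1) (h 0 1) +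
      br (mu Ω) γ (h 1 1) (h 1 1) := by
  rw [form_eq hα hβ hγ, br, br, br]
  simp

lemma form_add_left (h h' k : Fin 2 → Fin 2 → L2 Ω) :
    form Ω α β γ (h + h') k = form Ω α β γ h k + form Ω α β γ h' k := by
  simp only [form_eq hα hβ hγ, Pi.add_apply, map_add, inner_add_right]; ring

lemma form_add_right (h k k' : Fin 2 → Fin 2 → L2 Ω) :
    form Ω α β γ h (k + k') = form Ω α β γ h k + form Ω α β γ h k' := by
  simp only [form_eq hα hβ hγ, Pi.add_apply, inner_add_left]; ring

lemma form_smul_left (c : ℂ) (h k : Fin 2 → Fin 2 → L2 Ω) :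
    form Ω α β γ (c • h) k = c * form Ω α β γ h k := by
  simp only [form_eq hα hβ hγ, Pi.smul_apply, map_smul, inner_smul_right]; ring

lemma form_smul_right (c : ℂ) (h k : Fin 2 → Fin 2 → L2 Ω) :
    form Ω α β γ h (c • k) = starRingEnd ℂ c * form Ω α β γ h k := by
  simp only [form_eq hα hβ hγ, Pi.smul_apply, inner_smul_left]; ring

lemma form_sub_right (h k k' : Fin 2 → Fin 2 → L2 Ω) :
    form Ω α β γ h (k - k') = form Ω α β γ h k - form Ω α β γ h k' := by
  simp only [form_eq hα hβ hγ, Pi.sub_apply, inner_sub_left]; ring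

omit hα hβ hγ in
lemma form_conj (h k : Fin 2 → Fin 2 → L2 Ω) :
    starRingEnd ℂ (form Ω α β γ h k) = form Ω α β γ k h := by
  rw [form, form, ← integral_conj]
  congr 1
  ext x
  simp only [map_add, map_mul, Complex.conj_ofReal, Complex.conj_conj, map_ofNat]
  ring

omit hα hβ hγ in
lemma form_self_ofReal (h : Fin 2 → Fin 2 → L2 Ω) :
    form Ω α β γ h h = (((form Ω α β γ h h).re : ℝ) : ℂ) := by
  exact (Complex.conj_eq_iff_re.1 (form_conj h h)).symm

end

lemma norm_inner_mulOp_le {m : Plane → ℝ} (hm : MemLp m ∞ (mu Ω)) {C : ℝ}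
    (hC : ∀ᵐ x ∂(mu Ω), |m x| ≤ C) (f g : L2 Ω) :
    ‖inner ℂ g (mulOp (mu Ω) m f)‖ ≤ C * (‖f‖ * ‖g‖) :=
  calc _ ≤ ‖g‖ * ‖mulOp (mu Ω) m f‖ := norm_inner_le_norm _ _
    _ ≤ ‖g‖ * (C * ‖f‖) := by gcongr; exact norm_mulOp_le hm hC f
    _ = _ := by ring

lemma norm_form_le (hE : UniformlyElliptic a₀ a₁ δ Ω α β γ) (ha₀ : 0 < a₀) (h1 : a₀ ≤ a₁)
    {η : ℝ} (hη : 0 < η)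
    (h k : Fin 2 → Fin 2 → L2 Ω) :
    ‖form Ω α β γ h k‖ ≤ a₁ * (η * hessSq h + η⁻¹ * hessSq k) := by
  have hα := hE.bdd_α ha₀
  have hβ := hE.bdd_β
  have hγ := hE.bdd_γ ha₀
  have e1 := norm_inner_mulOp_le hα (hE.abs_α ha₀) (h 0 0) (k 0 0)
  have e2 := norm_inner_mulOp_le hβ hE.bound_β (h 0 1) (k 0 1)
  have e3 := norm_inner_mulOp_le hγ (hE.abs_γ ha₀) (h 1 1) (k 1 1)
  rw [form_eq hα hβ hγ]
  have aux : ∀ x y : ℝ, 2 * (x * y) ≤ η * x ^ 2 + η⁻¹ * y ^ 2 := fun x y => by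
    have : η * x ^ 2 + η⁻¹ * y ^ 2 - 2 * (x * y) = η⁻¹ * (η * x - y) ^ 2 := by field_simp; ring
    have h2 : 0 ≤ η⁻¹ * (η * x - y) ^ 2 := by positivity
    linarith
  have t1 := aux ‖h 0 0‖ ‖k 0 0‖
  have t2 := aux ‖h 0 1‖ ‖k 0 1‖
  have t3 := aux ‖h 1 1‖ ‖k 1 1‖
  have p1 : 0 ≤ ‖h 0 0‖ * ‖k 0 0‖ := by positivity
  have p3 : 0 ≤ ‖h 1 1‖ * ‖k 1 1‖ := by positivity
  refine (norm_add₃_le).trans ?_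
  rw [norm_mul, Complex.norm_ofNat, hessSq, hessSq]
  have hh : ‖h 0 0‖ * ‖k 0 0‖ + 2 * (‖h 0 1‖ * ‖k 0 1‖) + ‖h 1 1‖ * ‖k 1 1‖ ≤
    η * (‖h 0 0‖ ^ 2 + ‖h 0 1‖ ^ 2 + ‖h 1 1‖ ^ 2) +
      η⁻¹ * (‖k 0 0‖ ^ 2 + ‖k 0 1‖ ^ 2 + ‖k 1 1‖ ^ 2) := by linarith
  have := mul_le_mul_of_nonneg_left hh (ha₀.le.trans h1)
  linarith

end Form

/-! ### Approximation of the coefficients -/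

section Approximation

open scoped ENNReal

variable {Ω : Set Plane} {α β γ : Plane → ℝ} {a₀ a₁ δ : ℝ}

/-- A continuous function on an open set that is nonnegative almost everywhere is nonnegative. -/
lemma le_of_ae_le (hΩ : IsOpen Ω) {f : Plane → ℝ} (hf : ContinuousOn f Ω) {a : ℝ}
    (h : ∀ᵐ x ∂(mu Ω), a ≤ f x) : ∀ x ∈ Ω, a ≤ f x := by
  intro x hx
  by_contra hlt
  rw [not_le] at hlt
  have ho : IsOpen (Ω ∩ f ⁻¹' Iio a) := hf.isOpen_inter_preimage hΩ isOpen_Iio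
  have h0 : volume (Ω ∩ f ⁻¹' Iio a) = 0 := by
    rw [ae_iff, Measure.restrict_apply' hΩ.measurableSet] at h
    refine measure_mono_null ?_ h
    intro y hy
    exact ⟨not_le.2 hy.2, hy.1⟩
  exact (ho.measure_pos volume ⟨x, hx, hlt⟩).ne' h0

lemma abs_le_of_ae_le (hΩ : IsOpen Ω) {f : Plane → ℝ} (hf : ContinuousOn f Ω) {a : ℝ}
    (h : ∀ᵐ x ∂(mu Ω), |f x| ≤ a) : ∀ x ∈ Ω, |f x| ≤ a := fun x hx => by
  have := le_of_ae_le hΩ (f := fun y => -|f y|) (a := -a) hf.abs.neg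
    (h.mono fun y hy => neg_le_neg hy) x hx
  linarith

lemma exists_isC1b_of_distLip (hΩ : IsOpen Ω) {f : Plane → ℝ} {B d : ℝ}
    (hB : ∀ᵐ x ∂(mu Ω), |f x| ≤ B) (hB0 : 0 ≤ B) (hd : distLip Ω f < d) :
    ∃ f' : Plane → ℝ, IsC1b Ω f' ∧ ∀ᵐ x ∂(mu Ω), |f x - f' x| ≤ d := by
  obtain ⟨r, ⟨-, K, g, hg, hr⟩, hrd⟩ := exists_lt_of_csInf_lt
    (s := {r : ℝ | 0 ≤ r ∧ ∃ (K : NNReal) (g : Plane → ℝ), LipschitzOnWith K g Ω ∧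
      ∀ᵐ x ∂(mu Ω), |f x - g x| ≤ r})
    ⟨B, hB0, 0, fun _ => 0, LipschitzWith.const 0 |>.lipschitzOnWith, by simpa using hB⟩ hd
  have hgB := abs_le_of_ae_le hΩ hg.continuousOn (a := B + r) (by
    filter_upwards [hB, hr] with x h1 h2
    rw [abs_le] at *
    constructor <;> linarith)
  obtain ⟨f', hf', h⟩ := exists_isC1b_near hg hgB (sub_pos.2 hrd)
  refine ⟨f', hf', ?_⟩
  filter_upwards [hr, ae_restrict_mem hΩ.measurableSet] with x h1 h2
  have h3 := h x h2
  rw [abs_le] at *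
  constructor <;> linarith

lemma abs_sqrt_sub_le {x y a : ℝ} (ha : 0 < a) (hx : a ^ 2 ≤ x) (hy : 0 ≤ y) :
    |Real.sqrt x - Real.sqrt y| ≤ |x - y| / a := by
  have h1 : a ≤ Real.sqrt x := Real.le_sqrt_of_sq_le hx
  have h2 := Real.sqrt_nonneg y
  rw [le_div_iff₀ ha]
  have e : x - y = (Real.sqrt x - Real.sqrt y) * (Real.sqrt x + Real.sqrt y) := by
    have := Real.mul_self_sqrt (show 0 ≤ x by nlinarith)
    have := Real.mul_self_sqrt hy
    ring_nf; nlinarith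
  rw [e, abs_mul]
  gcongr
  rw [abs_of_nonneg (by linarith)]
  linarith

/-- The coefficients are within `c d` of functions of class `C¹` with bounded derivatives, if they
are within less than `d` of Lipschitz functions. -/
lemma exists_approximation (hΩ : IsOpen Ω) (ha₀ : 0 < a₀) (h1 : a₀ ≤ a₁)
    (hE : UniformlyElliptic a₀ a₁ δ Ω α β γ) {d : ℝ} (hd : constD Ω α β γ < d) (hda : d ≤ a₀ / 2) :
    ∃ α' β' γ' ρ' : Plane → ℝ, IsC1b Ω α' ∧ IsC1b Ω β' ∧ IsC1b Ω γ' ∧ IsC1b Ω ρ' ∧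
      (∀ᵐ x ∂(mu Ω), |α x - α' x| ≤ d) ∧ (∀ᵐ x ∂(mu Ω), |β x - β' x| ≤ d) ∧
      (∀ᵐ x ∂(mu Ω), |γ x - γ' x| ≤ d) ∧
      ∀ᵐ x ∂(mu Ω), |Real.sqrt (α x * γ x) - ρ' x| ≤ 3 * a₁ / a₀ * d := by
  have ha1 : 0 ≤ a₁ := ha₀.le.trans h1
  obtain ⟨hdα, hdβγ⟩ := max_lt_iff.1 hd
  obtain ⟨hdβ, hdγ⟩ := max_lt_iff.1 hdβγ
  obtain ⟨α', hα', hα⟩ := exists_isC1b_of_distLip hΩ (hE.abs_α ha₀) ha1 hdα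
  obtain ⟨β', hβ', hβ⟩ := exists_isC1b_of_distLip hΩ hE.bound_β ha1 hdβ
  obtain ⟨γ', hγ', hγ⟩ := exists_isC1b_of_distLip hΩ (hE.abs_γ ha₀) ha1 hdγ
  have lα := le_of_ae_le hΩ hα'.contDiffOn.continuousOn (a := a₀ / 2) (by
    filter_upwards [hα, hE.bound_α] with x e1 e2
    linarith [(abs_le.1 e1).2])
  have lγ := le_of_ae_le hΩ hγ'.contDiffOn.continuousOn (a := a₀ / 2) (by
    filter_upwards [hγ, hE.bound_γ] with x e1 e2
    linarith [(abs_le.1 e1).2])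
  refine ⟨α', β', γ', fun x => Real.sqrt (α' x * γ' x), hα', hβ', hγ',
    (hα'.mul hΩ hγ').sqrt hΩ (a := a₀ / 2 * (a₀ / 2)) (by positivity) fun x hx =>
      mul_le_mul (lα x hx) (lγ x hx) (by positivity) (by linarith [lα x hx]), hα, hβ, hγ, ?_⟩
  filter_upwards [hα, hγ, hE.bound_α, hE.bound_γ, ae_restrict_mem hΩ.measurableSet]
    with x e1 e2 b1 b2 hx
  have l1 := lα x hx
  have l2 := lγ x hx
  refine (abs_sqrt_sub_le ha₀ (by nlinarith) (mul_nonneg (by linarith) (by linarith))).trans ?_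
  rw [div_mul_eq_mul_div]
  gcongr
  have e : α x * γ x - α' x * γ' x = γ x * (α x - α' x) + α' x * (γ x - γ' x) := by ring
  have hd0 : 0 ≤ d := (abs_nonneg _).trans e1
  have u1 : α' x ≤ 2 * a₁ := by linarith [(abs_le.1 e1).1]
  calc _ ≤ |γ x * (α x - α' x)| + |α' x * (γ x - γ' x)| := by rw [e]; exact abs_add_le _ _
    _ ≤ a₁ * d + 2 * a₁ * d := by
        rw [abs_mul, abs_mul, abs_of_nonneg (show 0 ≤ γ x by linarith),
          abs_of_nonneg (show 0 ≤ α' x by linarith)]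
        gcongr
        exact b2.2
    _ = _ := by ring

end Approximation

/-! ### Lower bounds for the form by null Lagrangians -/

section Garding

open scoped ENNReal

variable {Ω : Set Plane} {α β γ : Plane → ℝ} {a₀ a₁ δ : ℝ}

/-- The null Lagrangian `m (u₁₁ u₂₂ - u₁₂²)` is of lower order, up to the distance from `m` to the
functions with bounded derivatives. -/
lemma abs_br_hess_hess_le (hΩ : IsOpen Ω) {m m' : Plane → ℝ} (hm : MemLp m ∞ (mu Ω))
    (hm' : IsC1b Ω m') {η C : ℝ} (hη : ∀ᵐ x ∂(mu Ω), |m x - m' x| ≤ η)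
    (hC : ∀ x ∈ Ω, ∀ i, |pd i m' x| ≤ C) {F : JetL2 Ω} (hF : F ∈ H20 Ω) :
    |br (mu Ω) m (F.2.2 0 0) (F.2.2 1 1) - br (mu Ω) m (F.2.2 0 1) (F.2.2 0 1)| ≤
      η * hessSq F.2.2 + C * ‖F.2.1 0‖ * (‖F.2.2 0 1‖ + ‖F.2.2 1 1‖) := by
  have hb := hm'.bdd hΩ
  have h1 := br_hess_hess hΩ hm' hF
  have hC' : ∀ i, ∀ᵐ x ∂(mu Ω), |pd i m' x| ≤ C := fun i =>
    (ae_restrict_iff' hΩ.measurableSet).2 (Eventually.of_forall fun x hx => hC x hx i)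
  have e : ∀ f g : L2 Ω, br (mu Ω) m f g = br (mu Ω) m' f g + br (mu Ω) (fun x => m x - m' x) f g :=
    fun f g => by rw [br_fun_sub hm hb]; ring
  rw [e, e]
  have h2 := abs_le.1 (abs_br_le (bdd_sub hm hb) hη (F.2.2 0 0) (F.2.2 1 1))
  have h3 := abs_le.1 (abs_br_le (bdd_sub hm hb) hη (F.2.2 0 1) (F.2.2 0 1))
  have h4 := abs_le.1 (abs_br_le (hm'.bdd_pd hΩ 1) (hC' 1) (F.2.1 0) (F.2.2 0 1))
  have h5 := abs_le.1 (abs_br_le (hm'.bdd_pd hΩ 0) (hC' 0) (F.2.1 0) (F.2.2 1 1))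
  have h6 : η * (‖F.2.2 0 0‖ * ‖F.2.2 1 1‖) + η * (‖F.2.2 0 1‖ * ‖F.2.2 0 1‖) ≤
      η * hessSq F.2.2 := by
    rcases eq_or_ne (mu Ω) 0 with h0 | h0
    · have : ∀ f : L2 Ω, ‖f‖ = 0 := fun f => by
        rw [Lp.norm_def]
        simp [h0]
      simp [hessSq, this]
    · have hη0 : 0 ≤ η := by
        have : (ae (mu Ω)).NeBot := ae_neBot.2 h0
        obtain ⟨x, hx⟩ := hη.exists
        exact (abs_nonneg _).trans hx
      rw [← mul_add]
      refine mul_le_mul_of_nonneg_left ?_ hη0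
      unfold hessSq
      nlinarith [sq_nonneg (‖F.2.2 0 0‖ - ‖F.2.2 1 1‖), sq_nonneg ‖F.2.2 0 0‖]
  rw [abs_le]
  constructor <;> nlinarith

/-- `√(x y³) ≤ ε y² + C x²`. -/
lemma exists_interpolation {ε : ℝ} (C : ℝ) (hε : 0 < ε) : ∃ C' : ℝ, 0 ≤ C' ∧
    ∀ x y z : ℝ, 0 ≤ x → 0 ≤ y → 0 ≤ z → z ^ 2 ≤ x * y → C * (z * y) ≤ ε * y ^ 2 + C' * x ^ 2 := by
  refine ⟨C ^ 4 / ε ^ 3, by positivity, fun x y z hx hy hz h => ?_⟩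
  have h1 : C * (z * y) ≤ ε / 2 * y ^ 2 + C ^ 2 / (2 * ε) * z ^ 2 := by
    have : ε / 2 * y ^ 2 + C ^ 2 / (2 * ε) * z ^ 2 - C * (z * y) =
        (2 * ε)⁻¹ * (ε * y - C * z) ^ 2 := by field_simp; ring
    have h2 : 0 ≤ (2 * ε)⁻¹ * (ε * y - C * z) ^ 2 := by positivity
    linarith
  have h2 : C ^ 2 / (2 * ε) * z ^ 2 ≤ C ^ 2 / (2 * ε) * (x * y) := by gcongr
  have h3 : C ^ 2 / (2 * ε) * (x * y) ≤ ε / 2 * y ^ 2 + C ^ 4 / ε ^ 3 * x ^ 2 := by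
    have e : ε / 2 * y ^ 2 + C ^ 4 / ε ^ 3 * x ^ 2 - C ^ 2 / (2 * ε) * (x * y) =
        (2 * ε)⁻¹ * ((ε * y - C ^ 2 / (2 * ε) * x) ^ 2 + 7 / 4 * (C ^ 2 / ε * x) ^ 2) := by
      field_simp; ring
    have : 0 ≤ (2 * ε)⁻¹ * ((ε * y - C ^ 2 / (2 * ε) * x) ^ 2 + 7 / 4 * (C ^ 2 / ε * x) ^ 2) := by
      positivity
    linarith
  linarith

/-- Gårding's inequality `Q(u) ≥ κ ‖D²u‖² - C ‖u‖²`. -/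
def Garding (Ω : Set Plane) (α β γ : Plane → ℝ) (κ : ℝ) : Prop :=
  ∃ C : ℝ, ∀ F ∈ H20 Ω, κ * hessSq F.2.2 - C * ‖F.1‖ ^ 2 ≤ (form Ω α β γ F.2.2 F.2.2).re

lemma norm_le_sqrt_hessSq {F : JetL2 Ω} (hF : F ∈ H20 Ω) (i j : Fin 2) :
    ‖F.2.2 i j‖ ≤ Real.sqrt (hessSq F.2.2) := by
  have h10 : ‖F.2.2 1 0‖ = ‖F.2.2 0 1‖ := by rw [hess_symm hF]
  refine Real.le_sqrt_of_sq_le ?_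
  have h1 := sq_nonneg ‖F.2.2 0 0‖
  have h2 := sq_nonneg ‖F.2.2 0 1‖
  have h3 := sq_nonneg ‖F.2.2 1 1‖
  unfold hessSq
  fin_cases i <;> fin_cases j <;> simp only [Fin.zero_eta, Fin.mk_one, Fin.isValue, h10] <;> linarith

lemma grad_sq_le_sqrt_hessSq (hΩ : IsOpen Ω) {F : JetL2 Ω} (hF : F ∈ H20 Ω) (i : Fin 2) :
    ‖F.2.1 i‖ ^ 2 ≤ ‖F.1‖ * Real.sqrt (hessSq F.2.2) :=
  (norm_grad_sq_le hΩ hF i).trans (by gcongr; exact norm_le_sqrt_hessSq hF i i)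

/-- Gårding's inequality holds if the symbol is positive after the addition of a null
Lagrangian. -/
lemma garding_of_multiplier (hΩ : IsOpen Ω) (hα : MemLp α ∞ (mu Ω)) (hβ : MemLp β ∞ (mu Ω))
    (hγ : MemLp γ ∞ (mu Ω)) {m m' : Plane → ℝ} (hm : MemLp m ∞ (mu Ω))
    (hm' : IsC1b Ω m') {η κ : ℝ} (hη : ∀ᵐ x ∂(mu Ω), |m x - m' x| ≤ η) (hκ : 0 < κ)
    (hηκ : 8 * η ≤ κ) (hpos : ∀ᵐ x ∂(mu Ω), ∀ p z r : ℝ, κ * (p ^ 2 + z ^ 2 + r ^ 2) ≤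
      α x * p ^ 2 + γ x * r ^ 2 + 2 * m x * (p * r) + (2 * β x - 2 * m x) * z ^ 2) :
    Garding Ω α β γ (κ / 2) := by
  obtain ⟨C, hC⟩ := hm'.bound
  obtain ⟨C', -, hC'⟩ := exists_interpolation (ε := κ / 4) (4 * max C 0) (by positivity)
  refine ⟨C', fun F hF => ?_⟩
  have h1 := abs_br_hess_hess_le hΩ hm hm' hη
    (fun x hx i => ((hC x hx).2 i).trans (le_max_left C 0)) hF
  have h2 := sum_br_nonneg (μ := mu Ω)
    ![![fun x => α x - κ, fun _ => 0, fun x => m x], ![fun _ => 0, fun x => 2 * β x - 2 * m x - κ,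
      fun _ => 0], ![fun x => m x, fun _ => 0, fun x => γ x - κ]]
    (by
      intro i j
      fin_cases i <;> fin_cases j
      exacts [bdd_sub hα (bdd_const κ), bdd_const 0, hm, bdd_const 0,
        bdd_sub (bdd_sub (bdd_const_mul 2 hβ) (bdd_const_mul 2 hm)) (bdd_const κ), bdd_const 0,
        hm, bdd_const 0, bdd_sub hγ (bdd_const κ)])
    ![F.2.2 0 0, F.2.2 0 1, F.2.2 1 1]
    (by
      filter_upwards [hpos] with x hx y
      have := hx (y 0) (y 1) (y 2)
      simp [Fin.sum_univ_three]
      linarith)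
  have z0 : ∀ f g : L2 Ω, br (mu Ω) (fun _ => 0) f g = 0 := fun f g => by
    have := abs_br_le (bdd_const (μ := mu Ω) 0) (C := 0) (by simp) f g
    simpa using this
  simp only [Fin.sum_univ_three, Matrix.cons_val_zero, Matrix.cons_val_one, Matrix.cons_val, z0]
    at h2
  rw [br_fun_sub hα (bdd_const κ), br_fun_sub (bdd_sub (bdd_const_mul 2 hβ) (bdd_const_mul 2 hm))
    (bdd_const κ), br_fun_sub (bdd_const_mul 2 hβ) (bdd_const_mul 2 hm), br_fun_const_mul 2 hβ,
    br_fun_const_mul 2 hm, br_fun_sub hγ (bdd_const κ), br_const, br_const, br_const,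
    br_comm (f := F.2.2 1 1) (g := F.2.2 0 0) hm] at h2
  rw [form_self_re hα hβ hγ]
  have hS := hessSq_nonneg F.2.2
  set S := Real.sqrt (hessSq F.2.2) with hSdef
  have hSS : S ^ 2 = hessSq F.2.2 := Real.sq_sqrt hS
  have h3 := hC' ‖F.1‖ S ‖F.2.1 0‖ (norm_nonneg _) (Real.sqrt_nonneg _) (norm_nonneg _)
    (grad_sq_le_sqrt_hessSq hΩ hF 0)
  have h4 : max C 0 * ‖F.2.1 0‖ * (‖F.2.2 0 1‖ + ‖F.2.2 1 1‖) ≤ max C 0 * ‖F.2.1 0‖ * (S + S) := by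
    gcongr <;> exact norm_le_sqrt_hessSq hF _ _
  have h5 : 2 * (η * hessSq F.2.2) ≤ κ / 4 * hessSq F.2.2 := by nlinarith
  have h6 := (abs_le.1 h1).1
  have h7 := (abs_le.1 h1).2
  have h8 : hessSq F.2.2 = ‖F.2.2 0 0‖ ^ 2 + ‖F.2.2 0 1‖ ^ 2 + ‖F.2.2 1 1‖ ^ 2 := rfl
  rw [hSS] at h3
  nlinarith

lemma abs_multiplier_sub_le {ρ ρ' b b' c N d d' : ℝ} (hN : 1 ≤ N) (hc0 : 0 ≤ c) (hcN : c ≤ N)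
    (hρ : |ρ - ρ'| ≤ d') (hb : |b - b'| ≤ d) :
    |((c * ρ + b) / N - ρ) - ((c * ρ' + b') / N - ρ')| ≤ 2 * d' + d := by
  have hN0 : 0 < N := by linarith
  have h1 : |c / N * (ρ - ρ')| ≤ 1 * d' := by
    rw [abs_mul, abs_of_nonneg (by positivity)]
    gcongr
    exact (div_le_one hN0).2 hcN
  have h2 : |(b - b') / N| ≤ d := by
    rw [abs_div, abs_of_pos hN0]
    exact div_le_of_le_mul₀ hN0.le ((abs_nonneg _).trans hb)
      (hb.trans (le_mul_of_one_le_right ((abs_nonneg _).trans hb) hN))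
  have e : ((c * ρ + b) / N - ρ) - ((c * ρ' + b') / N - ρ') =
      c / N * (ρ - ρ') + (b - b') / N - (ρ - ρ') := by field_simp; ring
  rw [e]
  rw [abs_le] at *
  constructor <;> linarith

lemma sq_bound_of_multiplier {a₀ A G b δ N : ℝ} (ha₀ : 0 < a₀) (hA : a₀ ≤ A) (hG : a₀ ≤ G)
    (hδ : 0 < δ) (hN : 2 ≤ N) (hlow : -1 + δ ≤ b / Real.sqrt (A * G))
    (hhigh : b / Real.sqrt (A * G) ≤ N - 1) (p z r : ℝ) :
    a₀ * δ / N * (p ^ 2 + z ^ 2 + r ^ 2) ≤ A * p ^ 2 + G * r ^ 2 +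
      2 * ((1 * Real.sqrt (A * G) + b) / N - Real.sqrt (A * G)) * (p * r) +
      (2 * b - 2 * ((1 * Real.sqrt (A * G) + b) / N - Real.sqrt (A * G))) * z ^ 2 := by
  have hA0 : 0 < A := by linarith
  have hG0 : 0 < G := by linarith
  have hρ : a₀ ≤ Real.sqrt (A * G) := Real.le_sqrt_of_sq_le (by nlinarith)
  obtain ⟨q, hq⟩ : ∃ q, q = b / Real.sqrt (A * G) := ⟨_, rfl⟩
  rw [← hq] at hlow hhigh
  have hb : b = q * Real.sqrt (A * G) := by
    rw [hq, div_mul_cancel₀ _ (by linarith : Real.sqrt (A * G) ≠ 0)]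
  have hρ2 : Real.sqrt (A * G) = Real.sqrt A * Real.sqrt G := Real.sqrt_mul hA0.le G
  set ρ := Real.sqrt (A * G)
  have hN0 : 0 < N := by linarith
  obtain ⟨θ, hθ⟩ : ∃ θ, θ = (1 + q) / N := ⟨_, rfl⟩
  have hθ1 : δ / N ≤ θ := by rw [hθ]; gcongr; linarith
  have hθ2 : θ ≤ 1 := by rw [hθ, div_le_one hN0]; linarith
  have hm : (1 * ρ + b) / N - ρ = ρ * (θ - 1) := by rw [hb, hθ]; field_simp
  rw [hm]
  have hsA := Real.sq_sqrt hA0.le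
  have hsG := Real.sq_sqrt hG0.le
  have h1 : A * p ^ 2 + G * r ^ 2 + 2 * (ρ * (θ - 1)) * (p * r) - δ / N * (A * p ^ 2 + G * r ^ 2) =
      (θ - δ / N) * (A * p ^ 2 + G * r ^ 2) + (1 - θ) * (Real.sqrt A * p - Real.sqrt G * r) ^ 2 := by
    rw [hρ2]
    linear_combination (-(1 - θ) * p ^ 2) * hsA - (1 - θ) * r ^ 2 * hsG
  have h2 : 0 ≤ (θ - δ / N) * (A * p ^ 2 + G * r ^ 2) +
      (1 - θ) * (Real.sqrt A * p - Real.sqrt G * r) ^ 2 := by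
    have := sub_nonneg.2 hθ1
    have := sub_nonneg.2 hθ2
    positivity
  have h3 : δ / N * (a₀ * (p ^ 2 + r ^ 2)) ≤ δ / N * (A * p ^ 2 + G * r ^ 2) := by
    gcongr
    nlinarith [sq_nonneg p, sq_nonneg r]
  have h4 : a₀ * δ / N ≤ 2 * b - 2 * (ρ * (θ - 1)) := by
    have e : 2 * b - 2 * (ρ * (θ - 1)) = 2 * ρ * (1 + q - θ) := by rw [hb]; ring
    have h5 : θ ≤ (1 + q) / 2 := by rw [hθ]; gcongr; linarith
    have h6 : a₀ * δ / N ≤ a₀ * δ := div_le_self (by positivity) (by linarith)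
    rw [e]
    nlinarith
  have h7 := mul_le_mul_of_nonneg_right h4 (sq_nonneg z)
  have h8 : a₀ * δ / N * (p ^ 2 + z ^ 2 + r ^ 2) =
      δ / N * (a₀ * (p ^ 2 + r ^ 2)) + a₀ * δ / N * z ^ 2 := by ring
  linarith

lemma UniformlyElliptic.ratioQ_le (hE : UniformlyElliptic a₀ a₁ δ Ω α β γ) (ha₀ : 0 < a₀)
    (h1 : a₀ ≤ a₁) : ∀ᵐ x ∂(mu Ω), ratioQ α β γ x ≤ a₁ / a₀ := by
  filter_upwards [hE.bound_α, hE.bound_γ, hE.bound_β] with x h2 h3 h4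
  have hρ : a₀ ≤ Real.sqrt (α x * γ x) := Real.le_sqrt_of_sq_le (by nlinarith)
  exact div_le_div₀ (ha₀.le.trans h1) ((le_abs_self _).trans h4) ha₀ hρ

lemma UniformlyElliptic.bdd_sqrt (hE : UniformlyElliptic a₀ a₁ δ Ω α β γ) (ha₀ : 0 < a₀) :
    MemLp (fun x => Real.sqrt (α x * γ x)) ∞ (mu Ω) := by
  refine bdd_of_le (C := Real.sqrt (a₁ * a₁))
    (Real.continuous_sqrt.comp_aestronglyMeasurable (hE.meas_α.mul hE.meas_γ)) ?_
  filter_upwards [hE.bound_α, hE.bound_γ] with x h1 h2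
  rw [abs_of_nonneg (Real.sqrt_nonneg _)]
  exact Real.sqrt_le_sqrt (mul_le_mul h1.2 h2.2 (by linarith) (by linarith))

/-- Gårding's inequality for nearly Lipschitz coefficients, with a uniform constant. -/
lemma exists_garding_of_constD_lt (ha₀ : 0 < a₀) (h1 : a₀ ≤ a₁) (hδ : 0 < δ) :
    ∃ κ D₀ : ℝ, 0 < κ ∧ 0 < D₀ ∧ ∀ (Ω : Set Plane) (α β γ : Plane → ℝ), IsOpen Ω →
      UniformlyElliptic a₀ a₁ δ Ω α β γ → constD Ω α β γ < D₀ → Garding Ω α β γ κ := by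
  have ha1 : 0 < a₁ := ha₀.trans_le h1
  set N : ℝ := 2 + a₁ / a₀
  have hN : 2 ≤ N := le_add_of_nonneg_right (by positivity)
  set κ : ℝ := a₀ * δ / N
  have hκ : 0 < κ := by positivity
  set c : ℝ := 2 * (3 * a₁ / a₀) + 1
  have hc : 0 < c := by positivity
  refine ⟨κ / 2, min (a₀ / 2) (κ / (8 * c)), by positivity, by positivity,
    fun Ω α β γ hΩ hE hD => ?_⟩
  obtain ⟨-, β', -, ρ', -, hβ', -, hρ', -, hβ, -, hρ⟩ :=
    exists_approximation hΩ ha₀ h1 hE hD (min_le_left _ _)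
  set d := min (a₀ / 2) (κ / (8 * c))
  have hbρ := hE.bdd_sqrt ha₀
  have e : ∀ ρ b : Plane → ℝ, (fun x => (1 * ρ x + b x) / N - ρ x) =
      fun x => N⁻¹ * (1 * ρ x + b x) + (-1) * ρ x := fun ρ b => by ext x; ring
  refine garding_of_multiplier hΩ (hE.bdd_α ha₀) hE.bdd_β (hE.bdd_γ ha₀)
    (m := fun x => (1 * Real.sqrt (α x * γ x) + β x) / N - Real.sqrt (α x * γ x))
    (m' := fun x => (1 * ρ' x + β' x) / N - ρ' x) (η := c * d) ?_ ?_ ?_ hκ ?_ ?_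
  · rw [e (fun x => Real.sqrt (α x * γ x))]
    exact bdd_add (bdd_const_mul _ (bdd_add (bdd_const_mul 1 hbρ) hE.bdd_β)) (bdd_const_mul _ hbρ)
  · rw [e]
    exact ((isC1b_const _).mul hΩ (((isC1b_const 1).mul hΩ hρ').add hΩ hβ')).add hΩ
      ((isC1b_const _).mul hΩ hρ')
  · filter_upwards [hβ, hρ] with x h2 h3
    exact (abs_multiplier_sub_le (by linarith) zero_le_one (by linarith) h3 h2).trans
      (le_of_eq (by ring))
  · have h2 : d ≤ κ / (8 * c) := min_le_right _ _
    rw [le_div_iff₀ (by positivity)] at h2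
    linarith
  · filter_upwards [hE.bound_α, hE.bound_γ, hE.ratio, hE.ratioQ_le ha₀ h1] with x h2 h3 h4 h5
    exact sq_bound_of_multiplier ha₀ h2.1 h3.1 hδ hN h4 (h5.trans (by linarith))

lemma garding_of_nonneg (ha₀ : 0 < a₀) (hΩ : IsOpen Ω) (hE : UniformlyElliptic a₀ a₁ δ Ω α β γ)
    (h : ∀ᵐ x ∂(mu Ω), 0 ≤ β x) : Garding Ω α β γ (a₀ / 2 / 2) := by
  refine garding_of_multiplier hΩ (hE.bdd_α ha₀) hE.bdd_β (hE.bdd_γ ha₀) (bdd_const (-(a₀ / 2)))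
    (isC1b_const (-(a₀ / 2))) (η := 0) (by simp) (by positivity) (by linarith) ?_
  filter_upwards [hE.bound_α, hE.bound_γ, h] with x h2 h3 h4 p z r
  nlinarith [sq_nonneg (p - r), mul_nonneg (sub_nonneg.2 h2.1) (sq_nonneg p),
    mul_nonneg (sub_nonneg.2 h3.1) (sq_nonneg r), mul_nonneg h4 (sq_nonneg z),
    mul_nonneg ha₀.le (sq_nonneg z)]

lemma norm_jet_le (hΩ : IsOpen Ω) {F : JetL2 Ω} (hF : F ∈ H20 Ω) :
    ‖F‖ ≤ ‖F.1‖ + Real.sqrt (hessSq F.2.2) := by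
  have hS := Real.sqrt_nonneg (hessSq F.2.2)
  have hg : ∀ i, ‖F.2.1 i‖ ≤ ‖F.1‖ + Real.sqrt (hessSq F.2.2) := fun i => by
    have h1 := grad_sq_le_sqrt_hessSq hΩ hF i
    refine abs_le_of_sq_le_sq' ?_ (by positivity) |>.2
    nlinarith [norm_nonneg F.1]
  refine norm_prod_le_iff.2 ⟨by linarith, norm_prod_le_iff.2 ⟨?_, ?_⟩⟩
  · exact (pi_norm_le_iff_of_nonneg (by positivity)).2 hg
  · refine (pi_norm_le_iff_of_nonneg (by positivity)).2 fun i =>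
      (pi_norm_le_iff_of_nonneg (by positivity)).2 fun j => ?_
    linarith [norm_le_sqrt_hessSq hF i j, norm_nonneg F.1]

lemma hessSq_le (F : JetL2 Ω) : hessSq F.2.2 ≤ 3 * ‖F‖ ^ 2 := by
  have h : ∀ i j, ‖F.2.2 i j‖ ^ 2 ≤ ‖F‖ ^ 2 := fun i j => by gcongr; exact norm_jet_hess_le F i j
  unfold hessSq
  linarith [h 0 0, h 0 1, h 1 1]

/-- Gårding's inequality implies that the form is bounded below and closed. -/
lemma Garding.formClosed {κ : ℝ} (hG : Garding Ω α β γ κ) (hκ : 0 < κ) (hΩ : IsOpen Ω)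
    (ha₀ : 0 < a₀) (h1 : a₀ ≤ a₁) (hE : UniformlyElliptic a₀ a₁ δ Ω α β γ) :
    FormClosed Ω α β γ := by
  obtain ⟨C, hC⟩ := hG
  refine ⟨⟨C, fun u g h hu => ?_⟩, fun u g h v hu huv hcau => ?_⟩
  · have := hC _ ((inH20_iff u g h).1 hu)
    have h2 := mul_nonneg hκ.le (hessSq_nonneg h)
    simp only at this
    linarith
  let F : ℕ → JetL2 Ω := fun n => (u n, g n, h n)
  have hF : ∀ n, F n ∈ H20 Ω := fun n => (inH20_iff _ _ _).1 (hu n)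
  have hcF : CauchySeq F := by
    rw [Metric.cauchySeq_iff]
    intro ε hε
    -- `‖F‖ ≤ ‖u‖ + ‖D²u‖`, and both parts are controlled by the form and by `‖u‖`
    have hlim := huv.cauchySeq
    rw [Metric.cauchySeq_iff] at hlim
    set η := κ * (ε / 2) ^ 2 / 2
    have hη : 0 < η := by positivity
    obtain ⟨ζ, hζ, hζ1, hζ2⟩ : ∃ ζ : ℝ, 0 < ζ ∧ ζ ≤ ε / 2 ∧ C * ζ ^ 2 ≤ η := by
      refine ⟨min (ε / 2) (min 1 (η / (|C| + 1))), by positivity, min_le_left _ _, ?_⟩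
      set ζ := min (ε / 2) (min 1 (η / (|C| + 1)))
      have hζ0 : 0 < ζ := by positivity
      have e1 : ζ ≤ 1 := (min_le_right _ _).trans (min_le_left _ _)
      have e2 : ζ ≤ η / (|C| + 1) := (min_le_right _ _).trans (min_le_right _ _)
      rw [le_div_iff₀ (by positivity)] at e2
      nlinarith [le_abs_self C, abs_nonneg C, mul_nonneg hζ0.le (sub_nonneg.2 e1),
        mul_nonneg (mul_nonneg hζ0.le (sub_nonneg.2 e1)) (abs_nonneg C),
        mul_le_mul_of_nonneg_right (le_abs_self C) (sq_nonneg ζ)]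
    obtain ⟨N₁, hN₁⟩ := hlim ζ hζ
    obtain ⟨N₂, hN₂⟩ := hcau η hη
    refine ⟨max N₁ N₂, fun m hm n hn => ?_⟩
    have e1 := hN₁ m ((le_max_left _ _).trans hm) n ((le_max_left _ _).trans hn)
    have e2 := hN₂ m ((le_max_right _ _).trans hm) n ((le_max_right _ _).trans hn)
    rw [dist_eq_norm] at e1 ⊢
    have hmn := (H20 Ω).sub_mem (hF m) (hF n)
    have e3 := hC _ hmn
    have e4 := norm_jet_le hΩ hmn
    have e5 : κ * hessSq (h m - h n) - C * ‖u m - u n‖ ^ 2 ≤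
      (form Ω α β γ (h m - h n) (h m - h n)).re := e3
    have e6 : C * ‖u m - u n‖ ^ 2 ≤ η := by
      rcases le_or_gt C 0 with hC0 | hC0
      · exact (mul_nonpos_of_nonpos_of_nonneg hC0 (sq_nonneg _)).trans hη.le
      · refine le_trans ?_ hζ2
        gcongr
    have e7 := (Complex.re_le_norm _).trans_lt e2
    have e8 : hessSq (h m - h n) < (ε / 2) ^ 2 := by
      have : κ * hessSq (h m - h n) < κ * (ε / 2) ^ 2 := by
        have : κ * (ε / 2) ^ 2 = η + η := by ring
        linarith
      exact lt_of_mul_lt_mul_left this hκ.le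
    have e9 : Real.sqrt (hessSq (h m - h n)) < ε / 2 :=
      (Real.sqrt_lt' (by positivity)).2 e8
    have e10 : ‖F m - F n‖ ≤ ‖u m - u n‖ + Real.sqrt (hessSq (h m - h n)) := e4
    linarith
  obtain ⟨G, hG, hlim⟩ := cauchySeq_tendsto_of_isComplete isClosed_H20.isComplete hF hcF
  have hGv : G.1 = v := tendsto_nhds_unique ((continuous_fst.tendsto G).comp hlim) huv
  refine ⟨G.2.1, G.2.2, (inH20_iff _ _ _).2 (by rw [← hGv]; exact hG), ?_⟩
  have hb : ∀ n, ‖form Ω α β γ (h n - G.2.2) (h n - G.2.2)‖ ≤ 6 * a₁ * ‖F n - G‖ ^ 2 := fun n => by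
    have e1 := norm_form_le hE ha₀ h1 one_pos (h n - G.2.2) (h n - G.2.2)
    have e2 : hessSq (h n - G.2.2) ≤ 3 * ‖F n - G‖ ^ 2 := hessSq_le (F n - G)
    have := mul_le_mul_of_nonneg_left e2 (ha₀.le.trans h1)
    rw [inv_one, one_mul] at e1
    linarith
  refine squeeze_zero_norm hb ?_
  have h2 := (tendsto_iff_norm_sub_tendsto_zero.1 hlim).pow 2
  have h3 := h2.const_mul (6 * a₁)
  simpa using h3

end Garding

/-! ### The sharp inequality for the symbol -/

section Symbol

lemma quadratic_nonneg {t k : ℝ} (h : |k| ≤ t) (x y : ℝ) :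
    0 ≤ t * x ^ 2 + 2 * k * (x * y) + t * y ^ 2 := by
  have h1 := abs_le.1 h
  have e : t * x ^ 2 + 2 * k * (x * y) + t * y ^ 2 =
      (t + k) / 2 * (x + y) ^ 2 + (t - k) / 2 * (x - y) ^ 2 := by ring
  have := mul_nonneg (show 0 ≤ (t + k) / 2 by linarith) (sq_nonneg (x + y))
  have := mul_nonneg (show 0 ≤ (t - k) / 2 by linarith) (sq_nonneg (x - y))
  linarith

/-- The pointwise inequality behind the sharp constant `k^*`, with `s² = 1 + k^*`.
The multiplier `n` of the null Lagrangian is such that the part of the form that is symmetric under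
the exchange of the two variables is a perfect square. -/
lemma sharp_symbol_nonneg {A G b s n : ℝ} (hA : 0 < A) (hG : 0 < G)
    (hn : n = (3 * Real.sqrt (A * G) + b) / s - Real.sqrt (A * G)) (hs3 : 3 ≤ s)
    (hsQ : b / Real.sqrt (A * G) ≤ s)
    (hsQ' : 3 - b / Real.sqrt (A * G) ≤ s * (1 + b / Real.sqrt (A * G))) (p z r w a c : ℝ) :
    0 ≤ A * p ^ 2 + G * r ^ 2 + 2 * n * (p * r) + (2 * b - 2 * n) * z ^ 2 +
      (6 * (A * (a * a)) + 2 * (b * (c * c))) * (p * w) +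
      (6 * (G * (c * c)) + 2 * (b * (a * a))) * (r * w) + 8 * (b * (a * c)) * (z * w) +
      s ^ 2 * (A * a ^ 4 + 2 * b * a ^ 2 * c ^ 2 + G * c ^ 4) * w ^ 2 := by
  have hs : 0 < s := by linarith
  have hρ : 0 < Real.sqrt (A * G) := Real.sqrt_pos.2 (mul_pos hA hG)
  obtain ⟨Q, hQ⟩ : ∃ Q, Q = b / Real.sqrt (A * G) := ⟨_, rfl⟩
  rw [← hQ] at hsQ hsQ'
  have hb : b = Q * Real.sqrt (A * G) := by rw [hQ, div_mul_cancel₀ _ hρ.ne']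
  rw [Real.sqrt_mul hA.le] at hb hn hρ
  obtain ⟨x, hx⟩ : ∃ x, x = Real.sqrt A := ⟨_, rfl⟩
  obtain ⟨y, hy⟩ : ∃ y, y = Real.sqrt G := ⟨_, rfl⟩
  rw [← hx, ← hy] at hb hn hρ
  have hA2 : A = x ^ 2 := by rw [hx, Real.sq_sqrt hA.le]
  have hG2 : G = y ^ 2 := by rw [hy, Real.sq_sqrt hG.le]
  have hn2 : n = x * y * ((3 + Q) / s - 1) := by rw [hn, hb]; field_simp
  have h1 := quadratic_nonneg (t := 2 * s - 3 - Q) (k := 3 - Q)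
    (abs_le.2 ⟨by linarith, by linarith⟩) (x * p - y * r) (s * (x * a ^ 2 * w - y * c ^ 2 * w))
  have h2 := quadratic_nonneg (t := s * (1 + Q) - 3 - Q) (k := 2 * Q)
    (abs_le.2 ⟨by linarith, by nlinarith⟩) z (s * (a * c * w))
  have h3 : 0 ≤ (3 + Q) / (2 * s) * (x * p + y * r + s * (x * a ^ 2 * w + y * c ^ 2 * w)) ^ 2 := by
    have : 0 ≤ 3 + Q := by nlinarith
    positivity
  have h4 := mul_nonneg (show 0 ≤ 1 / (2 * s) by positivity) h1
  have h5 := mul_nonneg (show 0 ≤ 2 * (x * y) / s by positivity) h2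
  refine le_of_le_of_eq (add_nonneg (add_nonneg h3 h4) h5) ?_
  rw [hA2, hG2, hn2, hb]
  field_simp
  ring

/-- The function `k` is such that `s = √(1 + k)` has the two properties that the pointwise inequality
requires, together with `s ≥ 3`. -/
lemma kFun_bounds {q k : ℝ} (hq : -1 < q) (hk : kFun q ≤ k) :
    8 ≤ k ∧ q ≤ Real.sqrt (1 + k) ∧ 3 - q ≤ Real.sqrt (1 + k) * (1 + q) := by
  have hq1 : 0 < 1 + q := by linarith
  have aux : 8 ≤ k → 3 ≤ Real.sqrt (1 + k) := fun h => Real.le_sqrt_of_sq_le (by linarith)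
  unfold kFun at hk
  split_ifs at hk with h1 h2
  · rw [div_le_iff₀ (by positivity)] at hk
    have h8 : 8 ≤ k := by
      by_contra hlt
      rw [not_le] at hlt
      nlinarith [mul_pos (sub_pos.2 hlt) (pow_pos hq1 2)]
    have h3 := aux h8
    refine ⟨h8, by linarith, ?_⟩
    have h4 : 0 ≤ 1 + k := by linarith
    rw [← abs_of_pos (show 0 < 3 - q by linarith)]
    refine abs_le_of_sq_le_sq ?_ (by positivity)
    rw [mul_pow, Real.sq_sqrt h4]
    nlinarith
  · have h3 := aux hk
    refine ⟨hk, by linarith, ?_⟩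
    nlinarith
  · rw [not_le] at h2
    have h3 : q ≤ Real.sqrt (1 + k) := Real.le_sqrt_of_sq_le (by linarith)
    refine ⟨by nlinarith, h3, ?_⟩
    nlinarith

variable {Ω : Set Plane} {α β γ : Plane → ℝ} {a₀ a₁ δ : ℝ}

lemma mu_ne_zero (hΩ : IsOpen Ω) (hne : Ω.Nonempty) : mu Ω ≠ 0 := by
  rw [Ne, Measure.restrict_eq_zero]
  exact (hΩ.measure_pos volume hne).ne'

lemma UniformlyElliptic.kFun_le_kStar (hE : UniformlyElliptic a₀ a₁ δ Ω α β γ) (ha₀ : 0 < a₀)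
    (h1 : a₀ ≤ a₁) (hδ : 0 < δ) : ∀ᵐ x ∂(mu Ω), kFun (ratioQ α β γ x) ≤ kStar Ω α β γ := by
  refine ae_le_essSup (f := fun x => kFun (ratioQ α β γ x)) ?_
  refine isBoundedUnder_of_eventually_le (a := 16 / δ ^ 2 + 8 + (a₁ / a₀) ^ 2) ?_
  filter_upwards [hE.ratio, hE.ratioQ_le ha₀ h1] with x h2 h3
  set q := ratioQ α β γ x
  have p1 : 0 ≤ 16 / δ ^ 2 := by positivity
  have p2 : 0 ≤ (a₁ / a₀) ^ 2 := by positivity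
  unfold kFun
  split_ifs with h4 h5
  · by_cases hd : δ ≤ 2
    · have : 8 * (1 - q) / (1 + q) ^ 2 ≤ 16 / δ ^ 2 := by
        gcongr <;> linarith
      linarith
    · linarith
  · linarith
  · have : q ^ 2 ≤ (a₁ / a₀) ^ 2 := by
      rw [not_le] at h5
      gcongr
    linarith

lemma UniformlyElliptic.eight_le_kStar (hE : UniformlyElliptic a₀ a₁ δ Ω α β γ) (ha₀ : 0 < a₀)
    (h1 : a₀ ≤ a₁) (hδ : 0 < δ) (hΩ : IsOpen Ω) (hne : Ω.Nonempty) : 8 ≤ kStar Ω α β γ := by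
  have : (ae (mu Ω)).NeBot := ae_neBot.2 (mu_ne_zero hΩ hne)
  obtain ⟨x, hx1, hx2⟩ := ((hE.kFun_le_kStar ha₀ h1 hδ).and hE.ratio).exists
  exact (kFun_bounds (by linarith) hx1).1

/-- The gradient of an admissible weight is bounded in terms of the ellipticity constants. -/
lemma ClassE.grad_le {M : ℝ} {φ : Plane → ℝ} (hφ : ClassE Ω α β γ M φ) (hΩ : IsOpen Ω)
    (ha₀ : 0 < a₀) (hδ : 0 < δ) (hδ1 : δ ≤ 1) (hE : UniformlyElliptic a₀ a₁ δ Ω α β γ) :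
    ∀ x ∈ Ω, ∀ i, |pd i φ x| ≤ 1 + (δ * a₀)⁻¹ := by
  intro x hx i
  refine abs_le_of_ae_le hΩ (continuousOn_pd hΩ (hφ.contDiff.of_le (by norm_num)) i) ?_ x hx
  filter_upwards [hφ.symbol_le, hE.bound_α, hE.bound_γ, hE.ratio] with y h1 h2 h3 h4
  have hρ : 0 < Real.sqrt (α y * γ y) :=
    Real.sqrt_pos.2 (mul_pos (by linarith) (by linarith))
  have hb : (-1 + δ) * Real.sqrt (α y * γ y) ≤ β y := (le_div_iff₀ hρ).1 h4
  rw [Real.sqrt_mul (by linarith)] at hb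
  have hsα := Real.sq_sqrt (show 0 ≤ α y by linarith)
  have hsγ := Real.sq_sqrt (show 0 ≤ γ y by linarith)
  set s := Real.sqrt (α y)
  set t := Real.sqrt (γ y)
  unfold symbolA at h1
  set p := pd 0 φ y with hp
  set q := pd 1 φ y with hq
  have h5 : δ * a₀ * (p ^ 4 + q ^ 4) ≤ 1 := by
    have e1 : 0 ≤ (β y - (-1 + δ) * (s * t)) * (p ^ 2 * q ^ 2) := mul_nonneg (by linarith) (by positivity)
    have e2 : 0 ≤ (1 - δ) * (s * p ^ 2 - t * q ^ 2) ^ 2 :=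
      mul_nonneg (by linarith) (sq_nonneg _)
    have e3 : 0 ≤ δ * ((α y - a₀) * p ^ 4) :=
      mul_nonneg hδ.le (mul_nonneg (by linarith) (by positivity))
    have e4 : 0 ≤ δ * ((γ y - a₀) * q ^ 4) :=
      mul_nonneg hδ.le (mul_nonneg (by linarith) (by positivity))
    have e5 : (1 - δ) * (s * p ^ 2 - t * q ^ 2) ^ 2 = (1 - δ) * (α y * p ^ 4 + γ y * q ^ 4 -
        2 * (s * t) * (p ^ 2 * q ^ 2)) := by rw [← hsα, ← hsγ]; ring
    rw [e5] at e2
    nlinarith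
  have h6 : ∀ i, |pd i φ y| ^ 4 ≤ p ^ 4 + q ^ 4 := by
    intro i
    rw [show |pd i φ y| ^ 4 = pd i φ y ^ 4 from Even.pow_abs (by decide) _]
    have : 0 ≤ p ^ 4 := by positivity
    have : 0 ≤ q ^ 4 := by positivity
    fin_cases i
    · change p ^ 4 ≤ _; linarith
    · change q ^ 4 ≤ _; linarith
  have h7 : p ^ 4 + q ^ 4 ≤ (δ * a₀)⁻¹ := by
    rw [← one_div, le_div_iff₀ (by positivity)]; linarith
  have h8 := (h6 i).trans h7
  by_contra hlt
  rw [not_le] at hlt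
  have h9 : 0 < (δ * a₀)⁻¹ := by positivity
  have h10 : 1 ≤ |pd i φ y| := by linarith
  have h11 : |pd i φ y| ≤ |pd i φ y| ^ 4 := le_self_pow₀ h10 (by norm_num)
  linarith

end Symbol

/-! ### The weighted form -/

section Weighted

open scoped ENNReal

variable {Ω : Set Plane} {α β γ : Plane → ℝ} {a₀ a₁ δ : ℝ}

lemma br_smul_left {m : Plane → ℝ} (c : ℝ) (f g : L2 Ω) :
    br (mu Ω) m ((c : ℂ) • f) g = c * br (mu Ω) m f g := by
  rw [br, map_smul, inner_smul_right, Complex.re_ofReal_mul, br]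

lemma br_smul_right {m : Plane → ℝ} (c : ℝ) (f g : L2 Ω) :
    br (mu Ω) m f ((c : ℂ) • g) = c * br (mu Ω) m f g := by
  rw [br, inner_smul_left, Complex.conj_ofReal, Complex.re_ofReal_mul, br]

lemma br_mulOp_mulOp {m n n' : Plane → ℝ} (hm : MemLp m ∞ (mu Ω)) (hn : MemLp n ∞ (mu Ω))
    (hn' : MemLp n' ∞ (mu Ω)) (f g : L2 Ω) : br (mu Ω) m (mulOp (mu Ω) n f) (mulOp (mu Ω) n' g) =
      br (mu Ω) (fun x => m x * (n x * n' x)) f g := by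
  rw [br_mulOp_left hm hn, br_mulOp_right (bdd_mul hm hn) hn']
  simp only [mul_assoc]

lemma br_perturb {m n : Plane → ℝ} (hm : MemLp m ∞ (mu Ω)) (hn : MemLp n ∞ (mu Ω)) (t : ℝ)
    (f g : L2 Ω) : br (mu Ω) m (f + (t : ℂ) • mulOp (mu Ω) n g) (f + (t : ℂ) • mulOp (mu Ω) n g) =
      br (mu Ω) m f f + 2 * t * br (mu Ω) (fun x => m x * n x) f g +
        t ^ 2 * br (mu Ω) (fun x => m x * (n x * n x)) g g := by
  rw [br_add_left, br_add_right, br_add_right, br_smul_left, br_smul_right, br_smul_left,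
    br_smul_right, br_mulOp_mulOp hm hn hn, br_mulOp_right hm hn,
    br_comm (f := mulOp (mu Ω) n g) hm, br_mulOp_right hm hn]
  ring

lemma br_mulOp_add {m n n' : Plane → ℝ} (hm : MemLp m ∞ (mu Ω)) (hn : MemLp n ∞ (mu Ω))
    (hn' : MemLp n' ∞ (mu Ω)) (f g : L2 Ω) :
    br (mu Ω) m (mulOp (mu Ω) n f + mulOp (mu Ω) n' g) (mulOp (mu Ω) n f + mulOp (mu Ω) n' g) =
      br (mu Ω) (fun x => m x * (n x * n x)) f f +
        2 * br (mu Ω) (fun x => m x * (n x * n' x)) f g +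
        br (mu Ω) (fun x => m x * (n' x * n' x)) g g := by
  rw [br_add_left, br_add_right, br_add_right, br_mulOp_mulOp hm hn hn, br_mulOp_mulOp hm hn' hn',
    br_comm (f := mulOp (mu Ω) n' g) hm, br_mulOp_mulOp hm hn hn']
  ring

/-- A weight with bounded derivatives, with quantitative bounds. -/
structure IsWeight (Ω : Set Plane) (b M : ℝ) (φ : Plane → ℝ) : Prop where
  isC2b : IsC2b Ω φ
  grad : ∀ x ∈ Ω, ∀ i, |pd i φ x| ≤ b
  hess : ∀ x ∈ Ω, ∀ i j, |pd i (pd j φ) x| ≤ M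

/-- The part of `e^{-ψ} ∂ᵢ∂ⱼ (e^ψ u)`, `ψ = λ φ`, that is even in `ψ`:
`uᵢⱼ + ψᵢ ψⱼ u`. -/
def evenPart (φ : Plane → ℝ) (l : ℝ) (F : JetL2 Ω) (i j : Fin 2) : L2 Ω :=
  F.2.2 i j + ((l ^ 2 : ℝ) : ℂ) • mulOp (mu Ω) (fun x => pd i φ x * pd j φ x) F.1

/-- The derivatives `φᵢ uⱼ + φⱼ uᵢ`. -/
def gradPart (φ : Plane → ℝ) (F : JetL2 Ω) (i j : Fin 2) : L2 Ω :=
  mulOp (mu Ω) (pd i φ) (F.2.1 j) + mulOp (mu Ω) (pd j φ) (F.2.1 i)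

/-- The multiple `φᵢⱼ u`. -/
def zeroPart (φ : Plane → ℝ) (F : JetL2 Ω) (i j : Fin 2) : L2 Ω :=
  mulOp (mu Ω) (pd i (pd j φ)) F.1

/-- The part of `e^{-ψ} ∂ᵢ∂ⱼ (e^ψ u)`, `ψ = λ φ`, that is odd in `ψ`:
`ψᵢ uⱼ + ψⱼ uᵢ + ψᵢⱼ u`. -/
def oddPart (φ : Plane → ℝ) (l : ℝ) (F : JetL2 Ω) : Fin 2 → Fin 2 → L2 Ω :=
  (l : ℂ) • (gradPart φ F + zeroPart φ F)

/-- The form `Q(e^ψ u, e^{-ψ} u)` with `ψ = λ φ`. -/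
def weightedForm (Ω : Set Plane) (α β γ φ : Plane → ℝ) (l : ℝ) (F : JetL2 Ω) : ℂ :=
  form Ω α β γ (evenPart φ l F + oddPart φ l F) (evenPart φ l F - oddPart φ l F)

lemma weightedForm_re (hα : MemLp α ∞ (mu Ω)) (hβ : MemLp β ∞ (mu Ω)) (hγ : MemLp γ ∞ (mu Ω))
    (φ : Plane → ℝ) (l : ℝ) (F : JetL2 Ω) : (weightedForm Ω α β γ φ l F).re =
      (form Ω α β γ (evenPart φ l F) (evenPart φ l F)).re -
        (form Ω α β γ (oddPart φ l F) (oddPart φ l F)).re := by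
  have h : (form Ω α β γ (evenPart φ l F) (oddPart φ l F)).re =
      (form Ω α β γ (oddPart φ l F) (evenPart φ l F)).re := by
    rw [← form_conj (oddPart φ l F), Complex.conj_re]
  rw [weightedForm, form_add_left hα hβ hγ, form_sub_right hα hβ hγ, form_sub_right hα hβ hγ]
  simp only [Complex.add_re, Complex.sub_re, h]
  ring

section Bounds

variable {b M : ℝ} {φ : Plane → ℝ} (hΩ : IsOpen Ω) (hφ : IsWeight Ω b M φ)
  {F : JetL2 Ω} (hF : F ∈ H20 Ω)

include hΩ hφ

lemma IsWeight.bdd_grad (i : Fin 2) : MemLp (pd i φ) ∞ (mu Ω) := hφ.isC2b.isC1b.bdd_pd hΩ i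

lemma IsWeight.ae_grad (i : Fin 2) : ∀ᵐ x ∂(mu Ω), |pd i φ x| ≤ b :=
  (ae_restrict_iff' hΩ.measurableSet).2 (Eventually.of_forall fun x hx => hφ.grad x hx i)

lemma IsWeight.ae_grad_mul (i j : Fin 2) : ∀ᵐ x ∂(mu Ω), |pd i φ x * pd j φ x| ≤ b ^ 2 := by
  filter_upwards [hφ.ae_grad hΩ i, hφ.ae_grad hΩ j] with x h1 h2
  rw [abs_mul, pow_two]
  exact mul_le_mul h1 h2 (abs_nonneg _) ((abs_nonneg _).trans h1)

lemma norm_zeroPart_le (i j : Fin 2) : ‖zeroPart φ F i j‖ ≤ M * ‖F.1‖ :=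
  norm_mulOp_le (hφ.isC2b.bdd_pd_pd hΩ i j)
    ((ae_restrict_iff' hΩ.measurableSet).2 (Eventually.of_forall fun x hx => hφ.hess x hx i j)) _

lemma hessSq_zeroPart_le : hessSq (zeroPart φ F) ≤ 3 * M ^ 2 * ‖F.1‖ ^ 2 := by
  have h : ∀ i j, ‖zeroPart φ F i j‖ ^ 2 ≤ (M * ‖F.1‖) ^ 2 := fun i j => by
    gcongr; exact norm_zeroPart_le hΩ hφ i j
  unfold hessSq
  linarith [h 0 0, h 0 1, h 1 1]

include hF in
lemma hessSq_gradPart_le : hessSq (gradPart φ F) ≤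
    12 * b ^ 2 * (‖F.1‖ * Real.sqrt (hessSq F.2.2)) := by
  have h : ∀ i j, ‖gradPart φ F i j‖ ^ 2 ≤ 4 * b ^ 2 * (‖F.1‖ * Real.sqrt (hessSq F.2.2)) := by
    intro i j
    have h1 := norm_mulOp_le (hφ.bdd_grad hΩ i) (hφ.ae_grad hΩ i) (F.2.1 j)
    have h2 := norm_mulOp_le (hφ.bdd_grad hΩ j) (hφ.ae_grad hΩ j) (F.2.1 i)
    have h3 := grad_sq_le_sqrt_hessSq hΩ hF i
    have h4 := grad_sq_le_sqrt_hessSq hΩ hF j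
    have h5 : ‖gradPart φ F i j‖ ≤ b * ‖F.2.1 j‖ + b * ‖F.2.1 i‖ :=
      (norm_add_le _ _).trans (add_le_add h1 h2)
    calc _ ≤ (b * ‖F.2.1 j‖ + b * ‖F.2.1 i‖) ^ 2 := by gcongr
      _ ≤ 2 * b ^ 2 * (‖F.2.1 j‖ ^ 2 + ‖F.2.1 i‖ ^ 2) := by
        nlinarith [sq_nonneg (b * ‖F.2.1 j‖ - b * ‖F.2.1 i‖)]
      _ ≤ 2 * b ^ 2 * (‖F.1‖ * Real.sqrt (hessSq F.2.2) + ‖F.1‖ * Real.sqrt (hessSq F.2.2)) := by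
        gcongr
      _ = _ := by ring
  unfold hessSq at *
  linarith [h 0 0, h 0 1, h 1 1]

omit hΩ hφ in
lemma hessSq_add_le (h k : Fin 2 → Fin 2 → L2 Ω) :
    hessSq (h + k) ≤ 2 * hessSq h + 2 * hessSq k := by
  have e : ∀ i j, ‖(h + k) i j‖ ^ 2 ≤ 2 * ‖h i j‖ ^ 2 + 2 * ‖k i j‖ ^ 2 := fun i j => by
    have h1 : ‖(h + k) i j‖ ≤ ‖h i j‖ + ‖k i j‖ := norm_add_le _ _
    have h2 : ‖(h + k) i j‖ ^ 2 ≤ (‖h i j‖ + ‖k i j‖) ^ 2 := by gcongr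
    nlinarith [sq_nonneg (‖h i j‖ - ‖k i j‖)]
  unfold hessSq
  linarith [e 0 0, e 0 1, e 1 1]

omit hΩ hφ in
lemma hessSq_smul (c : ℝ) (h : Fin 2 → Fin 2 → L2 Ω) :
    hessSq ((c : ℂ) • h) = c ^ 2 * hessSq h := by
  have e : ∀ i j, ‖((c : ℂ) • h) i j‖ ^ 2 = c ^ 2 * ‖h i j‖ ^ 2 := fun i j => by
    rw [Pi.smul_apply, Pi.smul_apply, norm_smul, Complex.norm_real, mul_pow, Real.norm_eq_abs,
      sq_abs]
  unfold hessSq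
  rw [e, e, e]
  ring

omit hΩ hφ in
lemma hessSq_sub_le (h k : Fin 2 → Fin 2 → L2 Ω) :
    hessSq (h - k) ≤ 2 * hessSq h + 2 * hessSq k := by
  have e : h - k = h + ((-1 : ℝ) : ℂ) • k := by
    rw [Complex.ofReal_neg, Complex.ofReal_one, neg_one_smul, sub_eq_add_neg]
  have h1 := hessSq_add_le h (((-1 : ℝ) : ℂ) • k)
  rw [hessSq_smul] at h1
  rw [e]
  linarith

/-- The products `φᵢ φⱼ u`. -/
def squarePart (φ : Plane → ℝ) (F : JetL2 Ω) (i j : Fin 2) : L2 Ω :=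
  mulOp (mu Ω) (fun x => pd i φ x * pd j φ x) F.1

omit hΩ hφ in
lemma evenPart_eq (l : ℝ) : evenPart φ l F = F.2.2 + ((l ^ 2 : ℝ) : ℂ) • squarePart φ F := rfl

lemma hessSq_squarePart_le : hessSq (squarePart φ F) ≤ 3 * b ^ 4 * ‖F.1‖ ^ 2 := by
  have h : ∀ i j, ‖squarePart φ F i j‖ ^ 2 ≤ (b ^ 2 * ‖F.1‖) ^ 2 := fun i j => by
    gcongr
    exact norm_mulOp_le (bdd_mul (hφ.bdd_grad hΩ i) (hφ.bdd_grad hΩ j)) (hφ.ae_grad_mul hΩ i j) _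
  unfold hessSq
  linarith [h 0 0, h 0 1, h 1 1]

include hF in
/-- The odd part is bounded by `λ² ‖u‖ ‖D²u‖`, up to lower order. -/
lemma hessSq_oddPart_le (l : ℝ) {η : ℝ} (hη : 0 < η) : hessSq (oddPart φ l F) ≤
    η * hessSq F.2.2 + (144 * b ^ 4 / η + 6) * (l ^ 4 * ‖F.1‖ ^ 2) + 6 * M ^ 4 * ‖F.1‖ ^ 2 := by
  have h1 := hessSq_gradPart_le hΩ hφ hF
  have h2 := hessSq_zeroPart_le hΩ hφ (F := F)
  have h3 := hessSq_add_le (gradPart φ F) (zeroPart φ F)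
  have hS := Real.sq_sqrt (hessSq_nonneg F.2.2)
  set S := Real.sqrt (hessSq F.2.2)
  rw [oddPart, hessSq_smul, ← hS]
  set u := ‖F.1‖
  have h4 : l ^ 2 * hessSq (gradPart φ F + zeroPart φ F) ≤
      l ^ 2 * (24 * b ^ 2 * (u * S) + 6 * M ^ 2 * u ^ 2) := by
    gcongr; linarith
  have h5 : l ^ 2 * (24 * b ^ 2 * (u * S)) ≤ η * S ^ 2 + 144 * b ^ 4 / η * (l ^ 4 * u ^ 2) := by
    have e : η * S ^ 2 + 144 * b ^ 4 / η * (l ^ 4 * u ^ 2) - l ^ 2 * (24 * b ^ 2 * (u * S)) =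
        η⁻¹ * (η * S - 12 * b ^ 2 * l ^ 2 * u) ^ 2 := by field_simp; ring
    have : 0 ≤ η⁻¹ * (η * S - 12 * b ^ 2 * l ^ 2 * u) ^ 2 := by positivity
    linarith
  have h6 : l ^ 2 * M ^ 2 * u ^ 2 ≤ (l ^ 4 + M ^ 4) * u ^ 2 := by
    gcongr
    nlinarith [sq_nonneg (l ^ 2 - M ^ 2), sq_nonneg (l ^ 2), sq_nonneg (M ^ 2)]
  nlinarith

include hF in
/-- The weighted form is bounded. -/
lemma norm_weightedForm_le (ha₀ : 0 < a₀) (h1 : a₀ ≤ a₁)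
    (hE : UniformlyElliptic a₀ a₁ δ Ω α β γ) (l : ℝ) :
    ‖weightedForm Ω α β γ φ l F‖ ≤ 4 * a₁ * ((3 + (6 * b ^ 4 + 144 * b ^ 4 + 6)) *
      (hessSq F.2.2 + l ^ 4 * ‖F.1‖ ^ 2) + 6 * M ^ 4 * ‖F.1‖ ^ 2) := by
  have e1 := norm_form_le hE ha₀ h1 one_pos (evenPart φ l F + oddPart φ l F)
    (evenPart φ l F - oddPart φ l F)
  have e2 := hessSq_add_le (evenPart φ l F) (oddPart φ l F)
  have e3 := hessSq_sub_le (evenPart φ l F) (oddPart φ l F)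
  have e4 := hessSq_oddPart_le hΩ hφ hF l one_pos
  have e5 : hessSq (evenPart φ l F) ≤ 2 * hessSq F.2.2 + 6 * b ^ 4 * (l ^ 4 * ‖F.1‖ ^ 2) := by
    rw [evenPart_eq]
    have e6 := hessSq_add_le F.2.2 (((l ^ 2 : ℝ) : ℂ) • squarePart φ F)
    rw [hessSq_smul] at e6
    have e7 : (l ^ 2) ^ 2 * hessSq (squarePart φ F) ≤ (l ^ 2) ^ 2 * (3 * b ^ 4 * ‖F.1‖ ^ 2) := by
      gcongr; exact hessSq_squarePart_le hΩ hφ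
    linarith
  rw [inv_one, one_mul, one_mul] at e1
  have hH := hessSq_nonneg F.2.2
  have hb : 0 ≤ b ^ 4 := by positivity
  have hL : 0 ≤ l ^ 4 * ‖F.1‖ ^ 2 := by positivity
  have e8 : hessSq (evenPart φ l F + oddPart φ l F) + hessSq (evenPart φ l F - oddPart φ l F) ≤
      4 * ((3 + (6 * b ^ 4 + 144 * b ^ 4 + 6)) *
      (hessSq F.2.2 + l ^ 4 * ‖F.1‖ ^ 2) + 6 * M ^ 4 * ‖F.1‖ ^ 2) := by
    rw [div_one] at e4
    nlinarith [mul_nonneg hb hH]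
  have := mul_le_mul_of_nonneg_left e8 (ha₀.le.trans h1)
  unfold weightedForm
  linarith

include hF in
/-- Gårding's inequality for the weighted form. The constant of `λ⁴ ‖u‖²` does not depend on the
second derivatives of the weight. -/
lemma weighted_garding (ha₀ : 0 < a₀) (h1 : a₀ ≤ a₁)
    (hE : UniformlyElliptic a₀ a₁ δ Ω α β γ) {κ C : ℝ} (hκ : 0 < κ)
    (hC : κ * hessSq F.2.2 - C * ‖F.1‖ ^ 2 ≤ (form Ω α β γ F.2.2 F.2.2).re) (l : ℝ) :
    κ / 2 * hessSq F.2.2 - (12 * a₁ + (6 * a₁ + (6 + 288) * a₁ * (8 * a₁ / κ)) * b ^ 4) *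
      (l ^ 4 * ‖F.1‖ ^ 2) - (C + 12 * a₁ * M ^ 4) * ‖F.1‖ ^ 2 ≤
      (weightedForm Ω α β γ φ l F).re := by
  have ha1 : 0 < a₁ := ha₀.trans_le h1
  have hα := hE.bdd_α ha₀
  have hβ := hE.bdd_β
  have hγ := hE.bdd_γ ha₀
  set η := κ / (8 * a₁) with hη
  have hη0 : 0 < η := by positivity
  rw [weightedForm_re hα hβ hγ, evenPart_eq, form_add_left hα hβ hγ, form_add_right hα hβ hγ,
    form_add_right hα hβ hγ]
  set W := ((l ^ 2 : ℝ) : ℂ) • squarePart φ F with hW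
  have hWs : hessSq W ≤ 3 * b ^ 4 * (l ^ 4 * ‖F.1‖ ^ 2) := by
    rw [hW, hessSq_smul]
    have : (l ^ 2) ^ 2 * hessSq (squarePart φ F) ≤ (l ^ 2) ^ 2 * (3 * b ^ 4 * ‖F.1‖ ^ 2) := by
      gcongr; exact hessSq_squarePart_le hΩ hφ
    linarith
  have e1 := norm_form_le hE ha₀ h1 hη0 F.2.2 W
  have e2 := norm_form_le hE ha₀ h1 one_pos W W
  have e3 := norm_form_le hE ha₀ h1 one_pos (oddPart φ l F) (oddPart φ l F)
  have e4 := hessSq_oddPart_le hΩ hφ hF l hη0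
  rw [inv_one, one_mul] at e2 e3
  have e5 : (form Ω α β γ W F.2.2).re = (form Ω α β γ F.2.2 W).re := by
    rw [← form_conj F.2.2 W, Complex.conj_re]
  have e6 := (abs_le.1 (Complex.abs_re_le_norm (form Ω α β γ F.2.2 W))).1
  have e7 := (abs_le.1 (Complex.abs_re_le_norm (form Ω α β γ W W))).1
  have e8 := (abs_le.1 (Complex.abs_re_le_norm (form Ω α β γ (oddPart φ l F) (oddPart φ l F)))).2
  simp only [Complex.add_re, e5]
  have hηi : η⁻¹ = 8 * a₁ / κ := by rw [hη, inv_div]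
  have m1 := mul_le_mul_of_nonneg_left hWs ha1.le
  have m2 := mul_le_mul_of_nonneg_left m1 (inv_nonneg.2 hη0.le)
  have m3 := mul_le_mul_of_nonneg_left e4 ha1.le
  have m4 : a₁ * (η * hessSq F.2.2) = κ / 8 * hessSq F.2.2 := by rw [hη]; field_simp
  have m5 : 144 * b ^ 4 / η = 144 * b ^ 4 * η⁻¹ := div_eq_mul_inv _ _
  rw [m5] at m3
  rw [← hηi]
  nlinarith

end Bounds

end Weighted

/-! ### The sharp lower bound for the weighted form -/

section Sharp

open scoped ENNReal

variable {Ω : Set Plane} {α β γ : Plane → ℝ} {a₀ a₁ δ : ℝ}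

lemma br_quartic_nonneg {k₀ k₁ k₂ k₃ n e₀ e₁ e₂ : Plane → ℝ} (hk₀ : MemLp k₀ ∞ (mu Ω))
    (hk₁ : MemLp k₁ ∞ (mu Ω)) (hk₂ : MemLp k₂ ∞ (mu Ω)) (hk₃ : MemLp k₃ ∞ (mu Ω))
    (hn : MemLp n ∞ (mu Ω)) (he₀ : MemLp e₀ ∞ (mu Ω)) (he₁ : MemLp e₁ ∞ (mu Ω))
    (he₂ : MemLp e₂ ∞ (mu Ω))
    (h : ∀ᵐ x ∂(mu Ω), ∀ p z r w : ℝ, 0 ≤ k₀ x * p ^ 2 + k₁ x * z ^ 2 + k₂ x * r ^ 2 +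
      2 * n x * (p * r) + 2 * e₀ x * (p * w) + 2 * e₁ x * (z * w) + 2 * e₂ x * (r * w) +
      k₃ x * w ^ 2) (f₀ f₁ f₂ f₃ : L2 Ω) :
    0 ≤ br (mu Ω) k₀ f₀ f₀ + br (mu Ω) k₁ f₁ f₁ + br (mu Ω) k₂ f₂ f₂ + 2 * br (mu Ω) n f₀ f₂ +
      2 * br (mu Ω) e₀ f₀ f₃ + 2 * br (mu Ω) e₁ f₁ f₃ + 2 * br (mu Ω) e₂ f₂ f₃ +
      br (mu Ω) k₃ f₃ f₃ := by
  have h2 := sum_br_nonneg (μ := mu Ω)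
    ![![k₀, fun _ => 0, n, e₀], ![fun _ => 0, k₁, fun _ => 0, e₁], ![n, fun _ => 0, k₂, e₂],
      ![e₀, e₁, e₂, k₃]]
    (by
      intro i j
      fin_cases i <;> fin_cases j
      exacts [hk₀, bdd_const 0, hn, he₀, bdd_const 0, hk₁, bdd_const 0, he₁, hn, bdd_const 0, hk₂,
        he₂, he₀, he₁, he₂, hk₃])
    ![f₀, f₁, f₂, f₃]
    (by
      filter_upwards [h] with x hx y
      have := hx (y 0) (y 1) (y 2) (y 3)
      simp [Fin.sum_univ_four]
      linarith)
  have z0 : ∀ f g : L2 Ω, br (mu Ω) (fun _ => 0) f g = 0 := fun f g => by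
    have := abs_br_le (bdd_const (μ := mu Ω) 0) (C := 0) (by simp) f g
    simpa using this
  simp only [Fin.sum_univ_four, Matrix.cons_val_zero, Matrix.cons_val_one, Matrix.cons_val, z0]
    at h2
  rw [br_comm (f := f₂) (g := f₀) hn, br_comm (f := f₃) (g := f₀) he₀,
    br_comm (f := f₃) (g := f₁) he₁, br_comm (f := f₃) (g := f₂) he₂] at h2
  linarith

/-- Integration by parts for `∂ᵢ (m ∂ⱼu conj u)`, where `m` is close to a function with bounded
derivatives. -/
lemma abs_br_grad_grad_le (hΩ : IsOpen Ω) {m m' : Plane → ℝ} (hm : MemLp m ∞ (mu Ω))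
    (hm' : IsC1b Ω m') {η C : ℝ} (hη : ∀ᵐ x ∂(mu Ω), |m x - m' x| ≤ η) (hη0 : 0 ≤ η) (hC0 : 0 ≤ C)
    (hC : ∀ x ∈ Ω, ∀ i, |pd i m' x| ≤ C) {F : JetL2 Ω} (hF : F ∈ H20 Ω) (i j : Fin 2) :
    |br (mu Ω) m (F.2.1 j) (F.2.1 i) + br (mu Ω) m (F.2.2 i j) F.1| ≤
      2 * η * (‖F.1‖ * Real.sqrt (hessSq F.2.2)) +
        C * (Real.sqrt (‖F.1‖ * Real.sqrt (hessSq F.2.2)) * ‖F.1‖) := by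
  have hb := hm'.bdd hΩ
  have h1 := br_hess_fst hΩ hm' hF i j
  have hC' : ∀ᵐ x ∂(mu Ω), |pd i m' x| ≤ C :=
    (ae_restrict_iff' hΩ.measurableSet).2 (Eventually.of_forall fun x hx => hC x hx i)
  have e : ∀ f g : L2 Ω, br (mu Ω) m f g = br (mu Ω) m' f g + br (mu Ω) (fun x => m x - m' x) f g :=
    fun f g => by rw [br_fun_sub hm hb]; ring
  rw [e, e]
  have h2 := abs_le.1 (abs_br_le (bdd_sub hm hb) hη (F.2.1 j) (F.2.1 i))
  have h3 := abs_le.1 (abs_br_le (bdd_sub hm hb) hη (F.2.2 i j) F.1)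
  have h4 := abs_le.1 (abs_br_le (hm'.bdd_pd hΩ i) hC' (F.2.1 j) F.1)
  set G := Real.sqrt (‖F.1‖ * Real.sqrt (hessSq F.2.2))
  have hG : G * G = ‖F.1‖ * Real.sqrt (hessSq F.2.2) := Real.mul_self_sqrt (by positivity)
  have hg : ∀ k, ‖F.2.1 k‖ ≤ G := fun k => Real.le_sqrt_of_sq_le (grad_sq_le_sqrt_hessSq hΩ hF k)
  have h5 : η * (‖F.2.1 j‖ * ‖F.2.1 i‖) ≤ η * (G * G) := by
    gcongr
    exacts [hg j, hg i]
  have h6 : η * (‖F.2.2 i j‖ * ‖F.1‖) ≤ η * (Real.sqrt (hessSq F.2.2) * ‖F.1‖) := by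
    gcongr; exact norm_le_sqrt_hessSq hF i j
  have h7 : C * (‖F.2.1 j‖ * ‖F.1‖) ≤ C * (G * ‖F.1‖) := by gcongr; exact hg j
  rw [hG] at h5
  rw [abs_le]
  constructor <;> linarith

lemma abs_pd_mul_le {f g : Plane → ℝ} (hf : IsC1b Ω f) (hg : IsC1b Ω g) (hΩ : IsOpen Ω)
    {x : Plane} (hx : x ∈ Ω) {A A' B B' : ℝ} (h1 : |f x| ≤ A) (h2 : ∀ i, |pd i f x| ≤ A')
    (h3 : |g x| ≤ B) (h4 : ∀ i, |pd i g x| ≤ B') (i : Fin 2) :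
    |pd i (fun y => f y * g y) x| ≤ A * B' + B * A' := by
  rw [pd_mul (ContDiffOn.differentiableAt_of_isOpen hΩ hf.contDiffOn hx)
    (ContDiffOn.differentiableAt_of_isOpen hΩ hg.contDiffOn hx)]
  refine (abs_add_le _ _).trans ?_
  rw [abs_mul, abs_mul]
  have := (abs_nonneg _).trans h1
  have := (abs_nonneg _).trans h3
  gcongr
  exacts [h4 i, h2 i]

/-- The product of a coefficient with `φᵢ φⱼ`, in the setting of `abs_br_grad_grad_le`. -/
lemma weight_mul_approx (hΩ : IsOpen Ω) {b M : ℝ} {m m' : Plane → ℝ}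
    (hm' : IsC1b Ω m') {d B : ℝ} (hd : ∀ᵐ x ∂(mu Ω), |m x - m' x| ≤ d)
    (hB : ∀ x ∈ Ω, |m' x| ≤ B ∧ ∀ i, |pd i m' x| ≤ B) {φ : Plane → ℝ} (hφ : IsWeight Ω b M φ)
    (i j : Fin 2) : IsC1b Ω (fun x => m' x * (pd i φ x * pd j φ x)) ∧
      (∀ᵐ x ∂(mu Ω), |m x * (pd i φ x * pd j φ x) - m' x * (pd i φ x * pd j φ x)| ≤ b ^ 2 * d) ∧
      ∀ x ∈ Ω, ∀ k, |pd k (fun x => m' x * (pd i φ x * pd j φ x)) x| ≤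
        B * (b * M + b * M) + b ^ 2 * B := by
  have h1 := hφ.isC2b.isC1b_pd hΩ
  refine ⟨hm'.mul hΩ ((h1 i).mul hΩ (h1 j)), ?_, fun x hx k => ?_⟩
  · filter_upwards [hd, hφ.ae_grad_mul hΩ i j] with x e1 e2
    rw [← sub_mul, abs_mul, mul_comm]
    exact mul_le_mul e2 e1 (abs_nonneg _) ((abs_nonneg _).trans e2)
  · refine abs_pd_mul_le hm' ((h1 i).mul hΩ (h1 j)) hΩ hx (hB x hx).1 (hB x hx).2 ?_ ?_ k
    · rw [abs_mul, pow_two]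
      exact mul_le_mul (hφ.grad x hx i) (hφ.grad x hx j) (abs_nonneg _)
        ((abs_nonneg _).trans (hφ.grad x hx i))
    · exact abs_pd_mul_le (h1 i) (h1 j) hΩ hx (hφ.grad x hx i) (fun k => hφ.hess x hx k i)
        (hφ.grad x hx j) (fun k => hφ.hess x hx k j)

section Expansion

variable (hα : MemLp α ∞ (mu Ω)) (hβ : MemLp β ∞ (mu Ω)) (hγ : MemLp γ ∞ (mu Ω))
  {φ : Plane → ℝ} (ha : ∀ i, MemLp (pd i φ) ∞ (mu Ω)) (F : JetL2 Ω)
include hα hβ hγ ha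

lemma form_evenPart_re (l : ℝ) : (form Ω α β γ (evenPart φ l F) (evenPart φ l F)).re =
    (br (mu Ω) α (F.2.2 0 0) (F.2.2 0 0) + 2 * br (mu Ω) β (F.2.2 0 1) (F.2.2 0 1) +
      br (mu Ω) γ (F.2.2 1 1) (F.2.2 1 1)) +
    2 * l ^ 2 * (br (mu Ω) (fun x => α x * (pd 0 φ x * pd 0 φ x)) (F.2.2 0 0) F.1 +
      2 * br (mu Ω) (fun x => β x * (pd 0 φ x * pd 1 φ x)) (F.2.2 0 1) F.1 +
      br (mu Ω) (fun x => γ x * (pd 1 φ x * pd 1 φ x)) (F.2.2 1 1) F.1) +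
    l ^ 4 * br (mu Ω) (fun x => symbolA α β γ x (pd 0 φ x) (pd 1 φ x)) F.1 F.1 := by
  have haa : ∀ i j, MemLp (fun x => pd i φ x * pd j φ x) ∞ (mu Ω) := fun i j => bdd_mul (ha i) (ha j)
  have e : (fun x => symbolA α β γ x (pd 0 φ x) (pd 1 φ x)) = fun x =>
      (α x * ((pd 0 φ x * pd 0 φ x) * (pd 0 φ x * pd 0 φ x)) +
      2 * (β x * ((pd 0 φ x * pd 1 φ x) * (pd 0 φ x * pd 1 φ x)))) +
      γ x * ((pd 1 φ x * pd 1 φ x) * (pd 1 φ x * pd 1 φ x)) := by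
    ext x; unfold symbolA; ring
  rw [form_self_re hα hβ hγ, e, br_fun_add (bdd_add (bdd_mul hα (bdd_mul (haa 0 0) (haa 0 0)))
    (bdd_const_mul 2 (bdd_mul hβ (bdd_mul (haa 0 1) (haa 0 1)))))
    (bdd_mul hγ (bdd_mul (haa 1 1) (haa 1 1))),
    br_fun_add (bdd_mul hα (bdd_mul (haa 0 0) (haa 0 0)))
    (bdd_const_mul 2 (bdd_mul hβ (bdd_mul (haa 0 1) (haa 0 1)))),
    br_fun_const_mul 2 (bdd_mul hβ (bdd_mul (haa 0 1) (haa 0 1)))]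
  unfold evenPart
  rw [br_perturb hα (haa 0 0), br_perturb hβ (haa 0 1), br_perturb hγ (haa 1 1)]
  ring

lemma form_gradPart_re : (form Ω α β γ (gradPart φ F) (gradPart φ F)).re =
    4 * br (mu Ω) (fun x => α x * (pd 0 φ x * pd 0 φ x)) (F.2.1 0) (F.2.1 0) +
    2 * br (mu Ω) (fun x => β x * (pd 0 φ x * pd 0 φ x)) (F.2.1 1) (F.2.1 1) +
    4 * br (mu Ω) (fun x => β x * (pd 0 φ x * pd 1 φ x)) (F.2.1 1) (F.2.1 0) +
    2 * br (mu Ω) (fun x => β x * (pd 1 φ x * pd 1 φ x)) (F.2.1 0) (F.2.1 0) +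
    4 * br (mu Ω) (fun x => γ x * (pd 1 φ x * pd 1 φ x)) (F.2.1 1) (F.2.1 1) := by
  rw [form_self_re hα hβ hγ]
  unfold gradPart
  rw [br_mulOp_add hα (ha 0) (ha 0), br_mulOp_add hβ (ha 0) (ha 1), br_mulOp_add hγ (ha 1) (ha 1)]
  ring

end Expansion

/-- The inequality of `sharp_symbol_nonneg`, integrated. -/
lemma br_sharp_nonneg (ha₀ : 0 < a₀) (h1 : a₀ ≤ a₁) (hδ : 0 < δ)
    (hE : UniformlyElliptic a₀ a₁ δ Ω α β γ) {s : ℝ} (hs : s = Real.sqrt (1 + kStar Ω α β γ))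
    {n : Plane → ℝ} (hn : MemLp n ∞ (mu Ω))
    (hne : n = fun x => (3 * Real.sqrt (α x * γ x) + β x) / s - Real.sqrt (α x * γ x))
    {φ : Plane → ℝ} (ha : ∀ i, MemLp (pd i φ) ∞ (mu Ω)) (l : ℝ) (F : JetL2 Ω) :
    0 ≤ (br (mu Ω) α (F.2.2 0 0) (F.2.2 0 0) + 2 * br (mu Ω) β (F.2.2 0 1) (F.2.2 0 1) +
      br (mu Ω) γ (F.2.2 1 1) (F.2.2 1 1)) +
      2 * (br (mu Ω) n (F.2.2 0 0) (F.2.2 1 1) - br (mu Ω) n (F.2.2 0 1) (F.2.2 0 1)) +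
      l ^ 2 * (6 * br (mu Ω) (fun x => α x * (pd 0 φ x * pd 0 φ x)) (F.2.2 0 0) F.1 +
        2 * br (mu Ω) (fun x => β x * (pd 1 φ x * pd 1 φ x)) (F.2.2 0 0) F.1 +
        8 * br (mu Ω) (fun x => β x * (pd 0 φ x * pd 1 φ x)) (F.2.2 0 1) F.1 +
        6 * br (mu Ω) (fun x => γ x * (pd 1 φ x * pd 1 φ x)) (F.2.2 1 1) F.1 +
        2 * br (mu Ω) (fun x => β x * (pd 0 φ x * pd 0 φ x)) (F.2.2 1 1) F.1) +
      s ^ 2 * (l ^ 4 * br (mu Ω) (fun x => symbolA α β γ x (pd 0 φ x) (pd 1 φ x)) F.1 F.1) := by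
  have hα := hE.bdd_α ha₀
  have hβ := hE.bdd_β
  have hγ := hE.bdd_γ ha₀
  have haa : ∀ i j, MemLp (fun x => pd i φ x * pd j φ x) ∞ (mu Ω) := fun i j => bdd_mul (ha i) (ha j)
  have hαaa := bdd_mul hα (haa 0 0)
  have hβaa := bdd_mul hβ (haa 0 0)
  have hβac := bdd_mul hβ (haa 0 1)
  have hβcc := bdd_mul hβ (haa 1 1)
  have hγcc := bdd_mul hγ (haa 1 1)
  have hA : MemLp (fun x => symbolA α β γ x (pd 0 φ x) (pd 1 φ x)) ∞ (mu Ω) :=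
    bdd_add (bdd_add (bdd_mul hα (bdd_pow (ha 0) 4))
      (bdd_mul (bdd_mul (bdd_const_mul 2 hβ) (bdd_pow (ha 0) 2)) (bdd_pow (ha 1) 2)))
      (bdd_mul hγ (bdd_pow (ha 1) 4))
  have key := br_quartic_nonneg hα (bdd_sub (bdd_const_mul 2 hβ) (bdd_const_mul 2 hn)) hγ
    (bdd_const_mul (s ^ 2) hA) hn (bdd_add (bdd_const_mul 3 hαaa) hβcc) (bdd_const_mul 4 hβac)
    (bdd_add (bdd_const_mul 3 hγcc) hβaa) (by
      filter_upwards [hE.bound_α, hE.bound_γ, hE.ratio, hE.kFun_le_kStar ha₀ h1 hδ]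
        with x b1 b2 b3 b4 p z r w
      obtain ⟨b5, b6, b7⟩ := kFun_bounds (by linarith) b4
      rw [← hs] at b6 b7
      have b8 : 3 ≤ s := by rw [hs]; exact Real.le_sqrt_of_sq_le (by linarith)
      have := sharp_symbol_nonneg (show 0 < α x by linarith) (show 0 < γ x by linarith)
        (congrFun hne x) b8 b6 b7 p z r w (pd 0 φ x) (pd 1 φ x)
      refine this.trans_eq ?_
      unfold symbolA
      ring)
    (F.2.2 0 0) (F.2.2 0 1) (F.2.2 1 1) (((l ^ 2 : ℝ) : ℂ) • F.1)
  rw [br_fun_sub (bdd_const_mul 2 hβ) (bdd_const_mul 2 hn), br_fun_const_mul 2 hβ,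
    br_fun_const_mul 2 hn, br_smul_right, br_smul_right, br_smul_right, br_smul_right,
    br_smul_left, br_fun_const_mul (s ^ 2) hA, br_fun_add (bdd_const_mul 3 hαaa) hβcc,
    br_fun_const_mul 3 hαaa, br_fun_const_mul 4 hβac, br_fun_add (bdd_const_mul 3 hγcc) hβaa,
    br_fun_const_mul 3 hγcc] at key
  refine key.trans_eq ?_
  ring

/-- Cross terms between the first-order and the zero-order part of `oddPart` are of lower order. -/
lemma exists_form_oddPart_le (hΩ : IsOpen Ω) (ha₀ : 0 < a₀) (h1 : a₀ ≤ a₁)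
    (hE : UniformlyElliptic a₀ a₁ δ Ω α β γ) (b M : ℝ) {ε : ℝ} (hε : 0 < ε) :
    ∃ C : ℝ, ∀ φ, IsWeight Ω b M φ → ∀ l : ℝ, ∀ F ∈ H20 Ω,
      (form Ω α β γ (oddPart φ l F) (oddPart φ l F)).re ≤
        l ^ 2 * (form Ω α β γ (gradPart φ F) (gradPart φ F)).re +
        ε * (hessSq F.2.2 + l ^ 4 * ‖F.1‖ ^ 2) + C * ‖F.1‖ ^ 2 := by
  have ha1 : 0 < a₁ := ha₀.trans_le h1
  have hα := hE.bdd_α ha₀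
  have hβ := hE.bdd_β
  have hγ := hE.bdd_γ ha₀
  set η : ℝ := ε / (2 * (12 * a₁ * b ^ 2 + 1)) with hη
  have hb : 0 < 12 * a₁ * b ^ 2 + 1 := by positivity
  have hη0 : 0 < η := by positivity
  set K : ℝ := 6 * a₁ * M ^ 2 * (η⁻¹ + 1)
  refine ⟨K ^ 2 / (2 * ε), fun φ hφ l F hF => ?_⟩
  have e1 := norm_form_le hE ha₀ h1 hη0 (gradPart φ F) (zeroPart φ F)
  have e2 := norm_form_le hE ha₀ h1 one_pos (zeroPart φ F) (zeroPart φ F)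
  rw [inv_one, one_mul] at e2
  have e3 := hessSq_gradPart_le hΩ hφ hF
  have e4 := hessSq_zeroPart_le hΩ hφ (F := F)
  have e5 := (Complex.re_le_norm _).trans e1
  have e6 := (Complex.re_le_norm _).trans e2
  have e7 : (form Ω α β γ (zeroPart φ F) (gradPart φ F)).re =
      (form Ω α β γ (gradPart φ F) (zeroPart φ F)).re := by
    rw [← form_conj (gradPart φ F), Complex.conj_re]
  rw [oddPart, form_smul_left hα hβ hγ, form_smul_right hα hβ hγ, Complex.conj_ofReal, ← mul_assoc,
    ← Complex.ofReal_mul, Complex.re_ofReal_mul, form_add_left hα hβ hγ, form_add_right hα hβ hγ,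
    form_add_right hα hβ hγ]
  simp only [Complex.add_re, e7]
  have hS := Real.sq_sqrt (hessSq_nonneg F.2.2)
  set S := Real.sqrt (hessSq F.2.2)
  rw [← hS]
  set u := ‖F.1‖
  have m1 := mul_le_mul_of_nonneg_left e3 (mul_pos ha1 hη0).le
  have m2 := mul_le_mul_of_nonneg_left e4 (mul_pos ha1 (inv_pos.2 hη0)).le
  have m3 := mul_le_mul_of_nonneg_left e4 ha1.le
  have t : 2 * (form Ω α β γ (gradPart φ F) (zeroPart φ F)).re +
      (form Ω α β γ (zeroPart φ F) (zeroPart φ F)).re ≤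
      2 * (a₁ * η * (12 * b ^ 2 * (u * S))) + K * u ^ 2 := by
    simp only [K]
    linarith
  have t2 := mul_le_mul_of_nonneg_left t (sq_nonneg l)
  have t3 : l ^ 2 * (u * S) ≤ (S ^ 2 + l ^ 4 * u ^ 2) / 2 := by
    nlinarith [sq_nonneg (S - l ^ 2 * u)]
  have t4 : 2 * (12 * a₁ * b ^ 2 * η) ≤ ε := by
    have : η * (2 * (12 * a₁ * b ^ 2 + 1)) = ε := by rw [hη]; field_simp
    linarith
  have t5 : 2 * (12 * a₁ * b ^ 2 * η) * (l ^ 2 * (u * S)) ≤ ε * ((S ^ 2 + l ^ 4 * u ^ 2) / 2) := by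
    have hu : 0 ≤ u := norm_nonneg _
    have hS0 : 0 ≤ S := Real.sqrt_nonneg _
    gcongr
  have t6 : l ^ 2 * (K * u ^ 2) ≤ ε / 2 * (l ^ 4 * u ^ 2) + K ^ 2 / (2 * ε) * u ^ 2 := by
    have e : ε / 2 * (l ^ 4 * u ^ 2) + K ^ 2 / (2 * ε) * u ^ 2 - l ^ 2 * (K * u ^ 2) =
        (2 * ε)⁻¹ * (ε * l ^ 2 * u - K * u) ^ 2 := by field_simp; ring
    have : 0 ≤ (2 * ε)⁻¹ * (ε * l ^ 2 * u - K * u) ^ 2 := by positivity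
    linarith
  have t7 : 0 ≤ ε * S ^ 2 := by positivity
  have t8 : ∀ X : ℝ, l * l * X = l ^ 2 * X := fun X => by ring
  rw [t8]
  nlinarith

/-- The sharp lower bound for the weighted form. -/
lemma weighted_sharp (hΩ : IsOpen Ω) (hne : Ω.Nonempty) (ha₀ : 0 < a₀) (h1 : a₀ ≤ a₁) (hδ : 0 < δ)
    (hE : UniformlyElliptic a₀ a₁ δ Ω α β γ) {d : ℝ} (hd : constD Ω α β γ < d) (hda : d ≤ a₀ / 2)
    (b M : ℝ) (hb : 0 ≤ b) (hM : 0 ≤ M) {ε : ℝ} (hε : 0 < ε) :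
    ∃ C : ℝ, ∀ φ, IsWeight Ω b M φ →
      (∀ᵐ x ∂(mu Ω), symbolA α β γ x (pd 0 φ x) (pd 1 φ x) ≤ 1) → ∀ l : ℝ, ∀ F ∈ H20 Ω,
      -kStar Ω α β γ * (l ^ 4 * ‖F.1‖ ^ 2) -
        ((2 * (6 * a₁ / a₀ + 1) + 16 * b ^ 2) * d + ε) * (hessSq F.2.2 + l ^ 4 * ‖F.1‖ ^ 2) -
        C * ‖F.1‖ ^ 2 ≤ (weightedForm Ω α β γ φ l F).re := by
  have ha1 : 0 < a₁ := ha₀.trans_le h1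
  have hα := hE.bdd_α ha₀
  have hβ := hE.bdd_β
  have hγ := hE.bdd_γ ha₀
  have hk := hE.eight_le_kStar ha₀ h1 hδ hΩ hne
  obtain ⟨α', β', γ', ρ', hα', hβ', hγ', hρ', dα, dβ, dγ, dρ⟩ :=
    exists_approximation hΩ ha₀ h1 hE hd hda
  have hd0 : 0 ≤ d := by
    have : (ae (mu Ω)).NeBot := ae_neBot.2 (mu_ne_zero hΩ hne)
    obtain ⟨x, hx⟩ := dα.exists
    exact (abs_nonneg _).trans hx
  obtain ⟨s, hs⟩ : ∃ s, s = Real.sqrt (1 + kStar Ω α β γ) := ⟨_, rfl⟩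
  have hs3 : 3 ≤ s := by rw [hs]; exact Real.le_sqrt_of_sq_le (by linarith)
  have hs2 : s ^ 2 = 1 + kStar Ω α β γ := by rw [hs, Real.sq_sqrt (by linarith)]
  obtain ⟨n, hn⟩ : ∃ n : Plane → ℝ,
    n = fun x => (3 * Real.sqrt (α x * γ x) + β x) / s - Real.sqrt (α x * γ x) := ⟨_, rfl⟩
  obtain ⟨n', hn'⟩ : ∃ n' : Plane → ℝ,
    n' = fun x => (3 * ρ' x + β' x) / s - ρ' x := ⟨_, rfl⟩
  have e : ∀ ρ b : Plane → ℝ, (fun x => (3 * ρ x + b x) / s - ρ x) =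
      fun x => s⁻¹ * (3 * ρ x + b x) + (-1) * ρ x := fun ρ b => by ext x; ring
  have hbρ := hE.bdd_sqrt ha₀
  have hnb : MemLp n ∞ (mu Ω) := by
    rw [hn, e (fun x => Real.sqrt (α x * γ x))]
    exact bdd_add (bdd_const_mul _ (bdd_add (bdd_const_mul 3 hbρ) hβ)) (bdd_const_mul _ hbρ)
  have hnb' : IsC1b Ω n' := by
    rw [hn', e]
    exact ((isC1b_const _).mul hΩ (((isC1b_const 3).mul hΩ hρ').add hΩ hβ')).add hΩ
      ((isC1b_const _).mul hΩ hρ')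
  have dn : ∀ᵐ x ∂(mu Ω), |n x - n' x| ≤ (6 * a₁ / a₀ + 1) * d := by
    filter_upwards [dβ, dρ] with x h2 h3
    rw [hn, hn']
    exact (abs_multiplier_sub_le (by linarith) (by norm_num) hs3 h3 h2).trans (le_of_eq (by ring))
  obtain ⟨B₁, hB₁⟩ := hα'.bound
  obtain ⟨B₂, hB₂⟩ := hβ'.bound
  obtain ⟨B₃, hB₃⟩ := hγ'.bound
  obtain ⟨B₄, hB₄⟩ := hnb'.bound
  set B := max (max B₁ B₂) (max B₃ (max B₄ 0))
  have l1 : B₁ ≤ B := (le_max_left _ _).trans (le_max_left _ _)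
  have l2 : B₂ ≤ B := (le_max_right _ _).trans (le_max_left _ _)
  have l3 : B₃ ≤ B := (le_max_left _ _).trans (le_max_right _ _)
  have l4 : B₄ ≤ B := ((le_max_left _ _).trans (le_max_right _ _)).trans (le_max_right _ _)
  have hB0 : 0 ≤ B := ((le_max_right _ _).trans (le_max_right _ _)).trans (le_max_right _ _)
  set C₁ : ℝ := B * (b * M + b * M) + b ^ 2 * B
  have hC₁ : 0 ≤ C₁ := by positivity
  obtain ⟨C₂, -, hC₂⟩ := exists_interpolation (ε := ε / 8) (4 * B) (by positivity)
  obtain ⟨C₃, -, hC₃⟩ := exists_interpolation (ε := ε / 8) (16 * C₁) (by positivity)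
  obtain ⟨C₄, hC₄⟩ := exists_form_oddPart_le hΩ ha₀ h1 hE b M (half_pos hε)
  refine ⟨C₂ + C₃ + C₄, fun φ hφ hA l F hF => ?_⟩
  have key := br_sharp_nonneg ha₀ h1 hδ hE hs hnb hn (hφ.bdd_grad hΩ) l F
  have hnull := (abs_le.1 (abs_br_hess_hess_le hΩ hnb hnb' dn
    (fun x hx i => ((hB₄ x hx).2 i).trans l4) hF)).2
  have wα := weight_mul_approx hΩ hα' dα
    (fun x hx => ⟨(hB₁ x hx).1.trans l1, fun i => ((hB₁ x hx).2 i).trans l1⟩) hφ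
  have wβ := weight_mul_approx hΩ hβ' dβ
    (fun x hx => ⟨(hB₂ x hx).1.trans l2, fun i => ((hB₂ x hx).2 i).trans l2⟩) hφ
  have wγ := weight_mul_approx hΩ hγ' dγ
    (fun x hx => ⟨(hB₃ x hx).1.trans l3, fun i => ((hB₃ x hx).2 i).trans l3⟩) hφ
  have hba : ∀ i j, MemLp (fun x => pd i φ x * pd j φ x) ∞ (mu Ω) := fun i j =>
    bdd_mul (hφ.bdd_grad hΩ i) (hφ.bdd_grad hΩ j)
  have hη0 : 0 ≤ b ^ 2 * d := by positivity
  have i1 := (abs_le.1 (abs_br_grad_grad_le hΩ (bdd_mul hα (hba 0 0)) (wα 0 0).1 (wα 0 0).2.1 hη0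
    hC₁ (wα 0 0).2.2 hF 0 0)).2
  have i2 := (abs_le.1 (abs_br_grad_grad_le hΩ (bdd_mul hβ (hba 0 0)) (wβ 0 0).1 (wβ 0 0).2.1 hη0
    hC₁ (wβ 0 0).2.2 hF 1 1)).2
  have i3 := (abs_le.1 (abs_br_grad_grad_le hΩ (bdd_mul hβ (hba 0 1)) (wβ 0 1).1 (wβ 0 1).2.1 hη0
    hC₁ (wβ 0 1).2.2 hF 0 1)).2
  have i4 := (abs_le.1 (abs_br_grad_grad_le hΩ (bdd_mul hβ (hba 1 1)) (wβ 1 1).1 (wβ 1 1).2.1 hη0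
    hC₁ (wβ 1 1).2.2 hF 0 0)).2
  have i5 := (abs_le.1 (abs_br_grad_grad_le hΩ (bdd_mul hγ (hba 1 1)) (wγ 1 1).1 (wγ 1 1).2.1 hη0
    hC₁ (wγ 1 1).2.2 hF 1 1)).2
  have hodd := hC₄ φ hφ l F hF
  rw [form_gradPart_re hα hβ hγ (hφ.bdd_grad hΩ)] at hodd
  rw [weightedForm_re hα hβ hγ, form_evenPart_re hα hβ hγ (hφ.bdd_grad hΩ)]
  have hAb : MemLp (fun x => symbolA α β γ x (pd 0 φ x) (pd 1 φ x)) ∞ (mu Ω) :=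
    have ha := hφ.bdd_grad hΩ
    bdd_add (bdd_add (bdd_mul hα (bdd_pow (ha 0) 4))
      (bdd_mul (bdd_mul (bdd_const_mul 2 hβ) (bdd_pow (ha 0) 2)) (bdd_pow (ha 1) 2)))
      (bdd_mul hγ (bdd_pow (ha 1) 4))
  have hAu := br_self_le hAb hA F.1
  rw [one_mul] at hAu
  have hAl : kStar Ω α β γ * (l ^ 4 * br (mu Ω)
      (fun x => symbolA α β γ x (pd 0 φ x) (pd 1 φ x)) F.1 F.1) ≤
      kStar Ω α β γ * (l ^ 4 * ‖F.1‖ ^ 2) := by gcongr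
  have hS := Real.sq_sqrt (hessSq_nonneg F.2.2)
  have n01 := norm_le_sqrt_hessSq hF 0 1
  have n11 := norm_le_sqrt_hessSq hF 1 1
  have hgr := grad_sq_le_sqrt_hessSq hΩ hF 0
  have hS0 : 0 ≤ Real.sqrt (hessSq F.2.2) := Real.sqrt_nonneg _
  have hu : 0 ≤ ‖F.1‖ := norm_nonneg _
  have hG2 := Real.sq_sqrt (mul_nonneg hu hS0)
  have hG0 := Real.sqrt_nonneg (‖F.1‖ * Real.sqrt (hessSq F.2.2))
  rw [← hS] at hnull hodd ⊢
  generalize Real.sqrt (‖F.1‖ * Real.sqrt (hessSq F.2.2)) = G at *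
  generalize Real.sqrt (hessSq F.2.2) = S at *
  have hz0 : 0 ≤ ‖F.2.1 0‖ := norm_nonneg _
  have hnull2 : B * ‖F.2.1 0‖ * (‖F.2.2 0 1‖ + ‖F.2.2 1 1‖) ≤
      B * ‖F.2.1 0‖ * ((S + l ^ 2 * ‖F.1‖) + (S + l ^ 2 * ‖F.1‖)) := by
    have : 0 ≤ l ^ 2 * ‖F.1‖ := by positivity
    gcongr <;> linarith
  have hy0 : 0 ≤ S + l ^ 2 * ‖F.1‖ := by positivity
  have huy : ‖F.1‖ * S ≤ ‖F.1‖ * (S + l ^ 2 * ‖F.1‖) := by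
    gcongr
    exact le_add_of_nonneg_right (by positivity)
  have c2 := hC₂ ‖F.1‖ (S + l ^ 2 * ‖F.1‖) ‖F.2.1 0‖ hu hy0 hz0 (hgr.trans huy)
  have c3 := hC₃ ‖F.1‖ (S + l ^ 2 * ‖F.1‖) G hu hy0 hG0 (hG2.le.trans huy)
  have hy2 : (S + l ^ 2 * ‖F.1‖) ^ 2 ≤ 2 * (S ^ 2 + l ^ 4 * ‖F.1‖ ^ 2) := by
    linarith only [sq_nonneg (S - l ^ 2 * ‖F.1‖)]
  have hls : l ^ 2 * (‖F.1‖ * S) ≤ (S ^ 2 + l ^ 4 * ‖F.1‖ ^ 2) / 2 := by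
    linarith only [sq_nonneg (S - l ^ 2 * ‖F.1‖)]
  have hi : l ^ 2 * (16 * (2 * (b ^ 2 * d) * (‖F.1‖ * S) + C₁ * (G * ‖F.1‖))) ≤
      16 * (b ^ 2 * d) * (S ^ 2 + l ^ 4 * ‖F.1‖ ^ 2) +
      16 * C₁ * (G * (S + l ^ 2 * ‖F.1‖)) := by
    have p1 := mul_le_mul_of_nonneg_left hls (mul_nonneg (by norm_num : (0:ℝ) ≤ 32) hη0)
    have p2 : 0 ≤ 16 * C₁ * (G * S) := by positivity
    linarith only [p1, p2]
  have hl2 : ∀ {x y : ℝ}, x ≤ y → l ^ 2 * x ≤ l ^ 2 * y := fun h =>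
    mul_le_mul_of_nonneg_left h (sq_nonneg l)
  have hI := hl2 (add_le_add (add_le_add (add_le_add (add_le_add
    (mul_le_mul_of_nonneg_left i1 (zero_le_four (α := ℝ)))
    (mul_le_mul_of_nonneg_left i2 (zero_le_two (α := ℝ))))
    (mul_le_mul_of_nonneg_left i3 (zero_le_four (α := ℝ))))
    (mul_le_mul_of_nonneg_left i4 (zero_le_two (α := ℝ))))
    (mul_le_mul_of_nonneg_left i5 (zero_le_four (α := ℝ))))
  have hΘ : 0 ≤ l ^ 4 * ‖F.1‖ ^ 2 := by positivity
  have hdΘ : 0 ≤ (6 * a₁ / a₀ + 1) * d * (l ^ 4 * ‖F.1‖ ^ 2) := by positivity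
  have hε8 := mul_le_mul_of_nonneg_left hy2 (show 0 ≤ ε / 8 by positivity)
  rw [hs2] at key
  linarith only [key, hnull, hnull2, hI, hi, hodd, hAl, c2, c3, hε8, hdΘ]

end Sharp

section UniformLowerBound

open scoped ENNReal

variable {Ω : Set Plane} {α β γ : Plane → ℝ} {a₀ a₁ δ : ℝ}

lemma distLip_nonneg (f : Plane → ℝ) : 0 ≤ distLip Ω f := Real.sInf_nonneg fun _ h => h.1

lemma constD_nonneg : 0 ≤ constD Ω α β γ := (distLip_nonneg α).trans (le_max_left _ _)

lemma ClassE.isWeight {M : ℝ} {φ : Plane → ℝ} (hφ : ClassE Ω α β γ M φ) (hΩ : IsOpen Ω)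
    (ha₀ : 0 < a₀) (hδ : 0 < δ) (hδ1 : δ ≤ 1) (hE : UniformlyElliptic a₀ a₁ δ Ω α β γ) :
    IsWeight Ω (1 + (δ * a₀)⁻¹) M φ :=
  ⟨⟨hφ.contDiff, hφ.bounded⟩, hφ.grad_le hΩ ha₀ hδ hδ1 hE, hφ.hessian_le⟩

/-- The sharp lower bound, combined with a small multiple of Gårding's inequality to absorb the
errors: the constant of `λ⁴` is `k^*`, up to `O(D + ε)`. -/
lemma exists_weighted_lower (ha₀ : 0 < a₀) (h1 : a₀ ≤ a₁) (hδ : 0 < δ) (hδ1 : δ ≤ 1) :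
    ∃ K D₁ ε₁ : ℝ, 0 < K ∧ 0 < D₁ ∧ 0 < ε₁ ∧ ∀ (Ω : Set Plane) (α β γ : Plane → ℝ), IsOpen Ω →
      Ω.Nonempty → UniformlyElliptic a₀ a₁ δ Ω α β γ → constD Ω α β γ < D₁ → ∀ ε : ℝ, 0 < ε →
      ε ≤ ε₁ → ∀ M : ℝ, 0 ≤ M → ∃ C : ℝ, ∀ φ, ClassE Ω α β γ M φ → ∀ l : ℝ, ∀ F ∈ H20 Ω,
        ε * hessSq F.2.2 - (kStar Ω α β γ + K * constD Ω α β γ + K * ε) * (l ^ 4 * ‖F.1‖ ^ 2) -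
          C * ‖F.1‖ ^ 2 ≤ (weightedForm Ω α β γ φ l F).re := by
  have ha1 : 0 < a₁ := ha₀.trans_le h1
  obtain ⟨κ, D₀, hκ, hD₀, hgard⟩ := exists_garding_of_constD_lt ha₀ h1 hδ
  set b : ℝ := 1 + (δ * a₀)⁻¹
  have hb : 0 ≤ b := by positivity
  obtain ⟨c, hc⟩ : ∃ c, c = 2 * (6 * a₁ / a₀ + 1) + 16 * b ^ 2 := ⟨_, rfl⟩
  obtain ⟨c', hc'⟩ : ∃ c', c' = 12 * a₁ + (6 * a₁ + (6 + 288) * a₁ * (8 * a₁ / κ)) * b ^ 4 :=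
    ⟨_, rfl⟩
  have hc0 : 0 < c := by rw [hc]; positivity
  have hc0' : 0 < c' := by rw [hc']; positivity
  refine ⟨(c + 2) * (1 + 2 * c' / κ), min D₀ (min (a₀ / 4) (κ / (4 * (c + 2)))),
    min (a₀ / 4) (κ / (4 * (c + 2))), by positivity, by positivity, by positivity,
    fun Ω α β γ hΩ hne hE hD ε hε hε1 M hM => ?_⟩
  set D := constD Ω α β γ
  have hD0 : 0 ≤ D := constD_nonneg
  have hDD₀ : D < D₀ := hD.trans_le (min_le_left _ _)
  have hDa : D < a₀ / 4 := hD.trans_le ((min_le_right _ _).trans (min_le_left _ _))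
  have hDκ : D < κ / (4 * (c + 2)) := hD.trans_le ((min_le_right _ _).trans (min_le_right _ _))
  have hεa : ε ≤ a₀ / 4 := hε1.trans (min_le_left _ _)
  have hεκ : ε ≤ κ / (4 * (c + 2)) := hε1.trans (min_le_right _ _)
  rw [lt_div_iff₀ (by positivity)] at hDκ
  rw [le_div_iff₀ (by positivity)] at hεκ
  obtain ⟨C₁, hC₁⟩ := hgard Ω α β γ hΩ hE hDD₀
  obtain ⟨C₂, hC₂⟩ := weighted_sharp hΩ hne ha₀ h1 hδ hE (d := D + ε) (lt_add_of_pos_right D hε)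
    (by linarith) b M hb hM hε
  refine ⟨|C₁ + 12 * a₁ * M ^ 4| + |C₂|, fun φ hφ l F hF => ?_⟩
  have hw := hφ.isWeight hΩ ha₀ hδ hδ1 hE
  have e1 := weighted_garding hΩ hw hF ha₀ h1 hE hκ (hC₁ F hF) l
  have e2 := hC₂ φ hw hφ.symbol_le l F hF
  rw [← hc] at e2
  rw [← hc'] at e1
  have hk := hE.eight_le_kStar ha₀ h1 hδ hΩ hne
  have hH := hessSq_nonneg F.2.2
  have hL : 0 ≤ l ^ 4 * ‖F.1‖ ^ 2 := by positivity
  have hU : 0 ≤ ‖F.1‖ ^ 2 := by positivity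
  generalize (weightedForm Ω α β γ φ l F).re = X at *
  generalize hessSq F.2.2 = H at *
  generalize l ^ 4 * ‖F.1‖ ^ 2 = L at *
  generalize ‖F.1‖ ^ 2 = U at *
  generalize C₁ + 12 * a₁ * M ^ 4 = C₁' at *
  -- the share of Gårding's inequality is such that `τ κ / 2` exceeds the error by `ε`
  obtain ⟨τ, hτ⟩ : ∃ τ, τ = 2 * (c * (D + ε) + ε + ε) / κ := ⟨_, rfl⟩
  have hτ0 : 0 ≤ τ := by rw [hτ]; positivity
  have hτ1 : τ ≤ 1 := by
    rw [hτ, div_le_one hκ]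
    nlinarith
  have hτκ : τ * (κ / 2) = c * (D + ε) + ε + ε := by rw [hτ]; field_simp
  have hτc : τ * c' = 2 * c' / κ * (c * (D + ε) + ε + ε) := by rw [hτ]; field_simp
  have m1 := mul_le_mul_of_nonneg_left e1 hτ0
  have m2 := mul_le_mul_of_nonneg_left e2 (sub_nonneg.2 hτ1)
  have hf : 0 ≤ 2 * c' / κ := by positivity
  have g1 : 0 ≤ τ * (kStar Ω α β γ * L) := mul_nonneg hτ0 (mul_nonneg (by linarith) hL)
  have g2 : 0 ≤ τ * ((c * (D + ε) + ε) * (H + L)) :=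
    mul_nonneg hτ0 (mul_nonneg (by positivity) (by linarith))
  have g3 : τ * (C₁' * U) ≤ |C₁'| * U := by
    have : τ * (C₁' * U) ≤ τ * (|C₁'| * U) := by gcongr; exact le_abs_self _
    have h2 : τ * (|C₁'| * U) ≤ 1 * (|C₁'| * U) := by gcongr
    linarith
  have g4 : (1 - τ) * (C₂ * U) ≤ |C₂| * U := by
    have : (1 - τ) * (C₂ * U) ≤ (1 - τ) * (|C₂| * U) := by
      have := sub_nonneg.2 hτ1
      gcongr
      exact le_abs_self _
    have h2 : (1 - τ) * (|C₂| * U) ≤ 1 * (|C₂| * U) := by gcongr; linarith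
    linarith
  have g5 : (c * (D + ε) + ε + τ * c') * L ≤ ((c + 2) * (1 + 2 * c' / κ) * (D + ε)) * L := by
    gcongr
    rw [hτc]
    have : c * (D + ε) + ε + ε ≤ (c + 2) * (D + ε) := by linarith
    have := mul_le_mul_of_nonneg_left this hf
    linarith
  have g6 : τ * (κ / 2 * H) = (c * (D + ε) + ε + ε) * H := by rw [← mul_assoc, hτκ]
  linarith

end UniformLowerBound

/-! ### The heat semigroup -/

section HeatFlow

open scoped ENNReal

variable {Ω : Set Plane} {α β γ : Plane → ℝ} {a₀ a₁ δ : ℝ}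

section

variable (hα : MemLp α ∞ (mu Ω)) (hβ : MemLp β ∞ (mu Ω)) (hγ : MemLp γ ∞ (mu Ω))

/-- The sesquilinear form `(x, y) ↦ Q(y, x) + ω ⟨x, y⟩` on `H²₀(Ω)`. -/
def shiftedForm (ω : ℝ) : H20 Ω →ₗ⋆[ℂ] H20 Ω →ₗ[ℂ] ℂ :=
  LinearMap.mk₂'ₛₗ (starRingEnd ℂ) (RingHom.id ℂ)
    (fun x y => form Ω α β γ y.1.2.2 x.1.2.2 + (ω : ℂ) * inner ℂ x.1.1 y.1.1)
    (fun x x' y => by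
      change form Ω α β γ y.1.2.2 (x.1.2.2 + x'.1.2.2) + (ω : ℂ) * inner ℂ (x.1.1 + x'.1.1) y.1.1 = _
      rw [form_add_right hα hβ hγ, inner_add_left]; ring)
    (fun c x y => by
      change form Ω α β γ y.1.2.2 (c • x.1.2.2) + (ω : ℂ) * inner ℂ (c • x.1.1) y.1.1 = _
      rw [form_smul_right hα hβ hγ, inner_smul_left, smul_eq_mul]; ring)
    (fun x y y' => by
      change form Ω α β γ (y.1.2.2 + y'.1.2.2) x.1.2.2 + (ω : ℂ) * inner ℂ x.1.1 (y.1.1 + y'.1.1) = _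
      rw [form_add_left hα hβ hγ, inner_add_right]; ring)
    (fun c x y => by
      change form Ω α β γ (c • y.1.2.2) x.1.2.2 + (ω : ℂ) * inner ℂ x.1.1 (c • y.1.1) = _
      rw [form_smul_left hα hβ hγ, inner_smul_right, RingHom.id_apply, smul_eq_mul]; ring)

lemma shiftedForm_apply (ω : ℝ) (x y : H20 Ω) : shiftedForm hα hβ hγ ω x y =
    form Ω α β γ y.1.2.2 x.1.2.2 + (ω : ℂ) * inner ℂ x.1.1 y.1.1 := rfl

lemma shiftedForm_self_re (ω : ℝ) (x : H20 Ω) : (shiftedForm hα hβ hγ ω x x).re =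
    (form Ω α β γ x.1.2.2 x.1.2.2).re + ω * ‖x.1.1‖ ^ 2 := by
  rw [shiftedForm_apply, Complex.add_re, Complex.re_ofReal_mul]
  congr 2
  exact (norm_sq_eq_re_inner (𝕜 := ℂ) x.1.1).symm

end

/-- The inclusion of `H²₀(Ω)` in `L²(Ω)`. -/
def inclL2 (Ω : Set Plane) : H20 Ω →L[ℂ] L2 Ω :=
  (ContinuousLinearMap.fst ℂ _ _).comp (H20 Ω).subtypeL

/-- A holomorphic extension of the heat semigroup to the right half-plane, with values in
`H²₀(Ω)` (given by the jets). -/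
structure IsHeatFlow (Ω : Set Plane) (α β γ : Plane → ℝ) (E : ℂ → L2 Ω →L[ℂ] JetL2 Ω) : Prop where
  mem : ∀ z f, E z f ∈ H20 Ω
  deriv : ∀ z : ℂ, 0 < z.re → ∀ f, ∃ u', HasDerivAt (fun z => (E z f).1) u' z ∧
    ∀ W ∈ H20 Ω, inner ℂ W.1 u' = -form Ω α β γ (E z f).2.2 W.2.2
  tendsto : ∀ f, Tendsto (fun z => (E z f).1) (𝓝[{z | 0 < z.re}] 0) (𝓝 f)
  symm : ∀ t : ℝ, 0 < t → ∀ f g, inner ℂ (E t f).1 g = inner ℂ f (E t g).1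
  add : ∀ s t : ℝ, 0 < s → 0 < t → ∀ f, (E ((s + t : ℝ) : ℂ) f).1 = (E s (E t f).1).1

/-- A closed form that is bounded below generates a holomorphic semigroup. -/
lemma FormClosed.exists_isHeatFlow (hFC : FormClosed Ω α β γ) (hΩ : IsOpen Ω) (ha₀ : 0 < a₀)
    (h1 : a₀ ≤ a₁) (hE : UniformlyElliptic a₀ a₁ δ Ω α β γ) :
    (∃ κ, 0 < κ ∧ Garding Ω α β γ κ) ∧ ∃ E : ℂ → L2 Ω →L[ℂ] JetL2 Ω, IsHeatFlow Ω α β γ E ∧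
      IsHeatSemigroup Ω α β γ fun t => if t ≤ 0 then ContinuousLinearMap.id ℂ (L2 Ω) else
        (ContinuousLinearMap.fst ℂ _ _).comp (E t) := by
  have hα := hE.bdd_α ha₀
  have hβ := hE.bdd_β
  have hγ := hE.bdd_γ ha₀
  obtain ⟨⟨ω₀, hω₀⟩, hcl⟩ := hFC
  obtain ⟨ω, hω⟩ : ∃ ω : ℝ, ω = ω₀ + 1 := ⟨_, rfl⟩
  set B := shiftedForm hα hβ hγ ω with hB
  have hpos : ∀ x : H20 Ω, ‖inclL2 Ω x‖ ^ 2 ≤ (B x x).re := fun x => by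
    have h2 := hω₀ x.1.1 x.1.2.1 x.1.2.2 ((inH20_iff _ _ _).2 x.2)
    rw [hB, shiftedForm_self_re, hω]
    change ‖x.1.1‖ ^ 2 ≤ _
    linarith
  have hsymm : ∀ x y, starRingEnd ℂ (B y x) = B x y := fun x y => by
    rw [hB, shiftedForm_apply, shiftedForm_apply, map_add, map_mul, form_conj, Complex.conj_ofReal,
      inner_conj_symm]
  have hbound : ∀ x : H20 Ω, (B x x).re ≤ (6 * a₁ + |ω|) * ‖x‖ ^ 2 := fun x => by
    have e1 := norm_form_le hE ha₀ h1 one_pos x.1.2.2 x.1.2.2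
    have e2 := mul_le_mul_of_nonneg_left (hessSq_le x.1) (ha₀.le.trans h1)
    have e3 := (Complex.re_le_norm _).trans e1
    have e4 : ω * ‖x.1.1‖ ^ 2 ≤ |ω| * ‖x.1‖ ^ 2 := by
      gcongr
      exacts [le_abs_self _, norm_jet_fst_le x.1]
    rw [hB, shiftedForm_self_re]
    rw [inv_one, one_mul] at e3
    change _ ≤ _ * ‖x.1‖ ^ 2
    linarith
  have hinj : ∀ x : H20 Ω, inclL2 Ω x = 0 → x = 0 := fun x hx => Subtype.ext (H20_ext hΩ x.2 hx)
  have hcomplete : ∀ x : ℕ → H20 Ω, (∀ ε : ℝ, 0 < ε → ∃ N, ∀ m ≥ N, ∀ n ≥ N,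
      (B (x m - x n) (x m - x n)).re < ε) →
      ∃ y, Tendsto (fun n => (B (x n - y) (x n - y)).re) atTop (𝓝 0) := by
    intro x hx
    have hcau : CauchySeq fun n => inclL2 Ω (x n) := by
      rw [Metric.cauchySeq_iff]
      intro ε hε
      obtain ⟨N, hN⟩ := hx (ε ^ 2) (by positivity)
      refine ⟨N, fun m hm n hn => ?_⟩
      rw [dist_eq_norm, ← map_sub]
      exact lt_of_pow_lt_pow_left₀ 2 hε.le ((hpos _).trans_lt (hN m hm n hn))
    obtain ⟨v, hv⟩ := cauchySeq_tendsto_of_complete hcau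
    have hform : ∀ y : H20 Ω, ‖form Ω α β γ y.1.2.2 y.1.2.2‖ ≤ (1 + |ω|) * (B y y).re := fun y => by
      have e1 := hpos y
      have e2 : (form Ω α β γ y.1.2.2 y.1.2.2).re = (B y y).re - ω * ‖inclL2 Ω y‖ ^ 2 := by
        rw [hB, shiftedForm_self_re]
        change _ = _ - ω * ‖y.1.1‖ ^ 2
        ring
      have e3 : |ω * ‖inclL2 Ω y‖ ^ 2| ≤ |ω| * (B y y).re := by
        rw [abs_mul, abs_of_nonneg (sq_nonneg ‖inclL2 Ω y‖)]
        gcongr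
      rw [form_self_ofReal, Complex.norm_real, Real.norm_eq_abs, e2]
      have e4 : 0 ≤ (B y y).re := (sq_nonneg _).trans e1
      rw [abs_le] at e3 ⊢
      constructor <;> linarith
    obtain ⟨g', h', hmem, hlim⟩ := hcl (fun n => (x n).1.1) (fun n => (x n).1.2.1)
      (fun n => (x n).1.2.2) v (fun n => (inH20_iff _ _ _).2 (x n).2) hv (by
        intro η hη
        obtain ⟨N, hN⟩ := hx (η / (1 + |ω|)) (by positivity)
        refine ⟨N, fun m hm n hn => ?_⟩
        refine (hform (x m - x n)).trans_lt ?_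
        have := hN m hm n hn
        rw [lt_div_iff₀ (by positivity)] at this
        linarith)
    refine ⟨⟨(v, g', h'), (inH20_iff _ _ _).1 hmem⟩, ?_⟩
    have e1 : Tendsto (fun n => (form Ω α β γ ((x n).1.2.2 - h') ((x n).1.2.2 - h')).re) atTop
        (𝓝 0) := by
      have := (Complex.continuous_re.tendsto _).comp hlim
      rwa [Complex.zero_re] at this
    have e2 : Tendsto (fun n => ω * ‖(x n).1.1 - v‖ ^ 2) atTop (𝓝 0) := by
      have := ((tendsto_iff_norm_sub_tendsto_zero.1 hv).pow 2).const_mul ω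
      rw [zero_pow two_ne_zero, mul_zero] at this
      exact this
    have e3 := e1.add e2
    rw [add_zero] at e3
    refine e3.congr fun n => ?_
    rw [hB, shiftedForm_self_re]
    rfl
  obtain ⟨⟨c, hc, hcoer⟩, R, hR⟩ := exists_resolvent (inclL2 Ω) B hsymm hbound hpos hinj hcomplete
  refine ⟨⟨c / 3, by positivity, ω, fun F hF => ?_⟩, ?_⟩
  · have e1 := hcoer ⟨F, hF⟩
    rw [hB, shiftedForm_self_re] at e1
    have e2 := mul_le_mul_of_nonneg_left (hessSq_le F) hc.le
    change c * ‖F‖ ^ 2 ≤ (form Ω α β γ F.2.2 F.2.2).re + ω * ‖F.1‖ ^ 2 at e1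
    linarith
  set R₀ : L2 Ω →L[ℂ] L2 Ω := (inclL2 Ω).comp R with hR₀
  have hin : ∀ f g, inner ℂ (R₀ f) g = B (R f) (R g) := fun f g => (hR (R f) g).symm
  have hdef : ∀ x y : H20 Ω, (∀ w, B w x = B w y) → x = y := fun x y h => by
    rw [← sub_eq_zero]
    apply hinj
    have e1 := hpos (x - y)
    have e2 : B (x - y) (x - y) = 0 := by rw [map_sub, h, sub_self]
    rw [e2, Complex.zero_re] at e1
    have : ‖inclL2 Ω (x - y)‖ ^ 2 = 0 := le_antisymm e1 (sq_nonneg _)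
    simpa using this
  have hres : IsResolvent R₀ := by
    refine ⟨?_, ?_, ?_⟩
    · rw [ContinuousLinearMap.nonneg_iff_isPositive, ContinuousLinearMap.isPositive_def']
      refine ⟨?_, fun f => ?_⟩
      · rw [ContinuousLinearMap.isSelfAdjoint_iff_isSymmetric]
        intro f g
        change inner ℂ (R₀ f) g = inner ℂ f (R₀ g)
        rw [← inner_conj_symm f, hin, hin, hsymm]
      · change 0 ≤ (inner ℂ (R₀ f) f : ℂ).re
        rw [hin]
        exact (sq_nonneg _).trans (hpos _)
    · refine ContinuousLinearMap.opNorm_le_bound _ zero_le_one fun f => ?_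
      have e1 : ‖R₀ f‖ ^ 2 ≤ (B (R f) (R f)).re := hpos (R f)
      rw [← hin] at e1
      have e2 := e1.trans ((Complex.re_le_norm _).trans (norm_inner_le_norm (R₀ f) f))
      rw [one_mul]
      rcases (norm_nonneg (R₀ f)).eq_or_lt with h0 | h0
      · rw [← h0]; exact norm_nonneg f
      · rw [pow_two] at e2
        exact le_of_mul_le_mul_left e2 h0
    · intro f hf
      have e1 : R f = 0 := hinj _ hf
      refine eq_zero_of_inner_test hΩ f fun ζ hζ => ?_
      have e2 := hR ⟨jet Ω ζ, jet_mem_H20 hζ⟩ f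
      rw [e1, map_zero] at e2
      exact e2.symm
  let E : ℂ → L2 Ω →L[ℂ] JetL2 Ω := fun z =>
    Complex.exp (ω * z) • ((H20 Ω).subtypeL.comp (R.comp (semi R₀ 1 z)))
  have hE1 : ∀ z : ℂ, 0 < z.re → ∀ f, (E z f).1 = Complex.exp (ω * z) • semi R₀ 0 z f := by
    intro z hz f
    rw [← mul_semi hres hz]
    rfl
  have hEt : ∀ t : ℝ, 0 < t → ∀ f, (E t f).1 = ((Real.exp (ω * t) : ℝ) : ℂ) • semi R₀ 0 t f := by
    intro t ht f
    rw [hE1 t (by simpa using ht)]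
    push_cast
    rfl
  have hop : ∀ u f, OperatorH Ω α β γ u f ↔ u = R₀ (f + (ω : ℂ) • u) := by
    intro u f
    constructor
    · rintro ⟨g, h, hu, hv⟩
      have e1 : (⟨(u, g, h), (inH20_iff _ _ _).1 hu⟩ : H20 Ω) = R (f + (ω : ℂ) • u) := by
        refine hdef _ _ fun w => ?_
        rw [hR, hB, shiftedForm_apply, inner_add_right, inner_smul_right]
        change form Ω α β γ h w.1.2.2 + _ = _
        rw [hv w.1.1 w.1.2.1 w.1.2.2 ((inH20_iff _ _ _).2 w.2)]
        rfl
      exact congrArg (inclL2 Ω) e1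
    · intro hu
      set U := R (f + (ω : ℂ) • u) with hU
      have hU1 : U.1.1 = u := hu.symm
      refine ⟨U.1.2.1, U.1.2.2, (inH20_iff _ _ _).2 (by rw [← hU1]; exact U.2), ?_⟩
      intro v g' h' hv
      have e1 := hR ⟨(v, g', h'), (inH20_iff _ _ _).1 hv⟩ (f + (ω : ℂ) • u)
      rw [← hU, hB, shiftedForm_apply, inner_add_right, inner_smul_right, hU1] at e1
      exact add_right_cancel e1
  refine ⟨E, ⟨?_, ?_, ?_, ?_, ?_⟩, ⟨?_, ?_, ?_, ?_⟩⟩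
  · intro z f
    exact (H20 Ω).smul_mem _ (R (semi R₀ 1 z f)).2
  · intro z hz f
    have e1 : HasDerivAt (fun z : ℂ => Complex.exp (ω * z)) (Complex.exp (ω * z) * ω) z := by
      have := ((hasDerivAt_id z).const_mul (ω : ℂ)).cexp
      simpa using this
    have e2 := (hasDerivAt_semi hres hz).clm_apply (hasDerivAt_const z f)
    have e3 := e1.smul e2
    refine ⟨_, e3.congr_of_eventuallyEq ?_, ?_⟩
    · have ho : IsOpen {w : ℂ | 0 < w.re} := isOpen_lt continuous_const Complex.continuous_re
      filter_upwards [ho.mem_nhds hz] with w hw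
      exact hE1 w hw f
    · intro W hW
      have e4 := hR ⟨W, hW⟩ (semi R₀ 1 z f)
      rw [hB, shiftedForm_apply] at e4
      change form Ω α β γ (R (semi R₀ 1 z f)).1.2.2 W.2.2 +
        (ω : ℂ) * inner ℂ W.1 (R₀ (semi R₀ 1 z f)) = inner ℂ W.1 (semi R₀ 1 z f) at e4
      have e5 : R₀ (semi R₀ 1 z f) = semi R₀ 0 z f := by rw [← mul_semi hres hz]; rfl
      have e6 : (E z f).2.2 = Complex.exp (ω * z) • (R (semi R₀ 1 z f)).1.2.2 := rfl
      rw [e6, form_smul_left hα hβ hγ]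
      rw [e5] at e4
      simp only [map_zero, add_zero, neg_apply, inner_add_right, inner_smul_right,
        inner_neg_right, ← e4]
      ring
  · intro f
    have e1 : Tendsto (fun z : ℂ => Complex.exp (ω * z)) (𝓝[{z | 0 < z.re}] 0) (𝓝 1) := by
      have : Continuous fun z : ℂ => Complex.exp (ω * z) := by fun_prop
      have h2 := this.tendsto 0
      rw [mul_zero, Complex.exp_zero] at h2
      exact h2.mono_left nhdsWithin_le_nhds
    have e2 := e1.smul (tendsto_semi hres f)
    rw [one_smul] at e2
    refine e2.congr' ?_
    filter_upwards [self_mem_nhdsWithin] with z hz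
    exact (hE1 z hz f).symm
  · intro t ht f g
    rw [hEt t ht, hEt t ht, inner_smul_left, inner_smul_right, Complex.conj_ofReal]
    congr 1
    exact (semi_isSelfAdjoint (R := R₀) t).isSymmetric f g
  · intro s t hs ht f
    rw [hEt _ (add_pos hs ht), hEt s hs, hEt t ht, map_smul, smul_smul, Complex.ofReal_add,
      semi_add hres (by simpa using hs) (by simpa using ht), mul_add, Real.exp_add,
      Complex.ofReal_mul]
    rfl
  · simp
  · intro s t hs ht
    rcases hs.eq_or_lt with rfl | hs
    · simp
    rcases ht.eq_or_lt with rfl | ht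
    · simp
    ext1 f
    simp only [hs.not_ge, ht.not_ge, (add_pos hs ht).not_ge, if_false]
    change (E ((s + t : ℝ) : ℂ) f).1 = (E s (E t f).1).1
    rw [hEt _ (add_pos hs ht), hEt s hs, hEt t ht, map_smul, smul_smul, Complex.ofReal_add,
      semi_add hres (by simpa using hs) (by simpa using ht), mul_add, Real.exp_add,
      Complex.ofReal_mul]
    rfl
  · intro f
    have e1 : Tendsto (fun t : ℝ => (t : ℂ)) (𝓝[>] 0) (𝓝[{z | 0 < z.re}] 0) := by
      refine tendsto_nhdsWithin_iff.2 ⟨?_, ?_⟩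
      · exact (Complex.continuous_ofReal.tendsto 0).mono_left nhdsWithin_le_nhds
      · filter_upwards [self_mem_nhdsWithin] with t ht
        simpa using ht
    have e2 := (tendsto_semi hres f).comp e1
    have e3 : Tendsto (fun t : ℝ => ((Real.exp (ω * t) : ℝ) : ℂ)) (𝓝[>] 0) (𝓝 1) := by
      have : Continuous fun t : ℝ => ((Real.exp (ω * t) : ℝ) : ℂ) := by fun_prop
      have h2 := this.tendsto 0
      rw [mul_zero, Real.exp_zero, Complex.ofReal_one] at h2
      exact h2.mono_left nhdsWithin_le_nhds
    have e4 := e3.smul e2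
    rw [one_smul] at e4
    refine e4.congr' ?_
    filter_upwards [self_mem_nhdsWithin] with t ht
    have ht' : ¬ t ≤ 0 := not_le.2 ht
    simp only [ht', if_false]
    exact (hEt t ht f).symm
  · intro u f
    rw [hop, semi_generator hres]
    refine tendsto_congr' ?_
    filter_upwards [self_mem_nhdsWithin] with t ht
    have ht' : ¬ t ≤ 0 := not_le.2 ht
    simp only [ht', if_false]
    rw [← hEt t ht u]
    rfl

end HeatFlow

/-! ### Conjugation by exponential weights -/

section ExpWeight

open scoped ENNReal

variable {Ω : Set Plane} {α β γ : Plane → ℝ} {a₀ a₁ δ : ℝ}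

/-- The weight `e^{λ φ}`. -/
def expWeight (l : ℝ) (φ : Plane → ℝ) (x : Plane) : ℝ := Real.exp (l * φ x)

lemma expWeight_mul_neg (l : ℝ) (φ : Plane → ℝ) (x : Plane) :
    expWeight l φ x * expWeight (-l) φ x = 1 := by
  rw [expWeight, expWeight, ← Real.exp_add, neg_mul, add_neg_cancel, Real.exp_zero]

variable {φ : Plane → ℝ} (hΩ : IsOpen Ω) (hφ : IsC2b Ω φ) (l : ℝ)
include hΩ hφ

lemma pd_expWeight {x : Plane} (hx : x ∈ Ω) (i : Fin 2) :
    pd i (expWeight l φ) x = expWeight l φ x * (l * pd i φ x) := by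
  have hd : DifferentiableAt ℝ φ x :=
    ContDiffOn.differentiableAt_of_isOpen hΩ hφ.isC1b.contDiffOn hx
  have h := ((hd.hasFDerivAt.const_mul l).exp).fderiv
  have e : expWeight l φ = fun y => Real.exp (l * φ y) := rfl
  rw [pd, e, h]
  simp [pd]

lemma pd_pd_expWeight {x : Plane} (hx : x ∈ Ω) (i j : Fin 2) :
    pd i (pd j (expWeight l φ)) x =
      expWeight l φ x * (l * pd i (pd j φ) x + l ^ 2 * (pd i φ x * pd j φ x)) := by
  have e : pd j (expWeight l φ) =ᶠ[𝓝 x] fun y => expWeight l φ y * (l * pd j φ y) := by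
    filter_upwards [hΩ.mem_nhds hx] with y hy using pd_expWeight hΩ hφ l hy j
  have hd : DifferentiableAt ℝ φ x :=
    ContDiffOn.differentiableAt_of_isOpen hΩ hφ.isC1b.contDiffOn hx
  have hd' : DifferentiableAt ℝ (pd j φ) x :=
    ContDiffOn.differentiableAt_of_isOpen hΩ (hφ.isC1b_pd hΩ j).contDiffOn hx
  have hde : DifferentiableAt ℝ (expWeight l φ) x := (hd.const_mul l).exp
  rw [pd_congr e, pd_mul hde (hd'.const_mul l), pd_expWeight hΩ hφ l hx,
    pd_mul (f := fun _ => l) (differentiableAt_const l) hd']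
  have e0 : pd i (fun _ : Plane => l) x = 0 := by simp [pd]
  rw [e0]
  ring

lemma isC2b_expWeight : IsC2b Ω (expWeight l φ) := by
  refine ⟨(contDiffOn_const.mul hφ.contDiffOn).exp, ?_⟩
  obtain ⟨C, hC⟩ := hφ.bound
  refine ⟨Real.exp (|l| * C) * (1 + |l| * C + l ^ 2 * (C * C)), fun x hx => ?_⟩
  obtain ⟨h1, h2, h3⟩ := hC x hx
  have hC0 : 0 ≤ C := (abs_nonneg _).trans h1
  have he : |expWeight l φ x| ≤ Real.exp (|l| * C) := by
    rw [expWeight, abs_of_pos (Real.exp_pos _)]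
    refine Real.exp_le_exp.2 ((le_abs_self _).trans ?_)
    rw [abs_mul]
    gcongr
  have e1 : 0 ≤ |l| * C := by positivity
  have e2 : 0 ≤ l ^ 2 * (C * C) := by positivity
  refine ⟨he.trans (le_mul_of_one_le_right (Real.exp_pos _).le (by linarith)), fun i => ?_,
    fun i j => ?_⟩
  · rw [pd_expWeight hΩ hφ l hx, abs_mul]
    gcongr
    rw [abs_mul]
    have : |l| * |pd i φ x| ≤ |l| * C := by gcongr; exact h2 i
    linarith
  · rw [pd_pd_expWeight hΩ hφ l hx, abs_mul]
    gcongr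
    refine (abs_add_le _ _).trans ?_
    rw [abs_mul, abs_mul, abs_mul, abs_of_nonneg (sq_nonneg l)]
    have e3 : |l| * |pd i (pd j φ) x| ≤ |l| * C := by gcongr; exact h3 i j
    have e4 : l ^ 2 * (|pd i φ x| * |pd j φ x|) ≤ l ^ 2 * (C * C) := by
      gcongr
      exacts [h2 i, h2 j]
    linarith

lemma bdd_expWeight : MemLp (expWeight l φ) ∞ (mu Ω) :=
  (isC2b_expWeight hΩ hφ l).isC1b.bdd hΩ

lemma mulOp_expWeight_cancel (f : L2 Ω) :
    mulOp (mu Ω) (expWeight l φ) (mulOp (mu Ω) (expWeight (-l) φ) f) = f := by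
  rw [mulOp_mulOp (bdd_expWeight hΩ hφ l) (bdd_expWeight hΩ hφ (-l))]
  simp only [expWeight_mul_neg]
  exact mulOp_one f

omit hφ in
lemma mulOp_congr_on {m n : Plane → ℝ} (hm : MemLp m ∞ (mu Ω)) (hn : MemLp n ∞ (mu Ω))
    (h : ∀ x ∈ Ω, m x = n x) (f : L2 Ω) : mulOp (mu Ω) m f = mulOp (mu Ω) n f :=
  mulOp_congr hm hn ((ae_restrict_iff' hΩ.measurableSet).2 (Eventually.of_forall h)) f

lemma mulJet_expWeight_hess (F : JetL2 Ω) (i j : Fin 2) : (mulJet (expWeight l φ) F).2.2 i j =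
    mulOp (mu Ω) (expWeight l φ) ((evenPart φ l F + oddPart φ l F) i j) := by
  have hb := bdd_expWeight hΩ hφ l
  have hg := fun i => hφ.isC1b.bdd_pd hΩ i
  have h1 : ∀ i f, mulOp (mu Ω) (pd i (expWeight l φ)) f =
      mulOp (mu Ω) (expWeight l φ) ((l : ℂ) • mulOp (mu Ω) (pd i φ) f) := fun i f => by
    rw [← mulOp_const_mul l (hg i), mulOp_mulOp hb (bdd_const_mul l (hg i))]
    exact mulOp_congr_on hΩ ((isC2b_expWeight hΩ hφ l).isC1b.bdd_pd hΩ i)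
      (bdd_mul hb (bdd_const_mul l (hg i))) (fun x hx => pd_expWeight hΩ hφ l hx i) f
  have h2 : mulOp (mu Ω) (pd i (pd j (expWeight l φ))) F.1 = mulOp (mu Ω) (expWeight l φ)
      ((l : ℂ) • mulOp (mu Ω) (pd i (pd j φ)) F.1 +
        ((l ^ 2 : ℝ) : ℂ) • mulOp (mu Ω) (fun x => pd i φ x * pd j φ x) F.1) := by
    have h3 := bdd_mul (hg i) (hg j)
    have h4 := hφ.bdd_pd_pd hΩ i j
    rw [← mulOp_const_mul l h4, ← mulOp_const_mul _ h3,
      ← mulOp_add_left (bdd_const_mul l h4) (bdd_const_mul _ h3),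
      mulOp_mulOp hb (bdd_add (bdd_const_mul l h4) (bdd_const_mul _ h3))]
    exact mulOp_congr_on hΩ ((isC2b_expWeight hΩ hφ l).bdd_pd_pd hΩ i j)
      (bdd_mul hb (bdd_add (bdd_const_mul l h4) (bdd_const_mul _ h3)))
      (fun x hx => pd_pd_expWeight hΩ hφ l hx i j) F.1
  change mulOp (mu Ω) (expWeight l φ) (F.2.2 i j) +
    (mulOp (mu Ω) (pd i (expWeight l φ)) (F.2.1 j) +
      mulOp (mu Ω) (pd j (expWeight l φ)) (F.2.1 i)) +
      mulOp (mu Ω) (pd i (pd j (expWeight l φ))) F.1 = _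
  rw [h1, h1, h2, ← map_add, ← map_add, ← map_add]
  congr 1
  simp only [Pi.add_apply, evenPart, oddPart, gradPart, zeroPart, Pi.smul_apply]
  module

omit hΩ hφ in
lemma evenPart_add_oddPart_neg (F : JetL2 Ω) :
    evenPart φ (-l) F + oddPart φ (-l) F = evenPart φ l F - oddPart φ l F := by
  have h1 : evenPart φ (-l) F = evenPart φ l F := by
    rw [evenPart_eq, evenPart_eq, neg_sq]
  rw [h1, oddPart, oddPart, Complex.ofReal_neg, neg_smul, sub_eq_add_neg]

omit hΩ hφ in
lemma inner_mulOp_left {m : Plane → ℝ} (hm : MemLp m ∞ (mu Ω)) (f g : L2 Ω) :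
    inner ℂ (mulOp (mu Ω) m g) f = inner ℂ g (mulOp (mu Ω) m f) := by
  rw [← inner_conj_symm, (inner_mulOp hm g f).2, (inner_mulOp hm f g).2, ← integral_conj]
  congr 1
  ext x
  simp only [map_mul, Complex.conj_ofReal, Complex.conj_conj]
  ring

/-- `Q(e^ψ u, e^{-ψ} u)` is the weighted form. -/
lemma weightedForm_eq (hα : MemLp α ∞ (mu Ω)) (hβ : MemLp β ∞ (mu Ω)) (hγ : MemLp γ ∞ (mu Ω))
    (F : JetL2 Ω) : form Ω α β γ (mulJet (expWeight l φ) F).2.2 (mulJet (expWeight (-l) φ) F).2.2 =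
      weightedForm Ω α β γ φ l F := by
  have key : ∀ {m : Plane → ℝ}, MemLp m ∞ (mu Ω) → ∀ f g : L2 Ω,
      inner ℂ (mulOp (mu Ω) (expWeight (-l) φ) g) (mulOp (mu Ω) m (mulOp (mu Ω) (expWeight l φ) f)) =
      inner ℂ g (mulOp (mu Ω) m f) := by
    intro m hm f g
    have hb := bdd_expWeight hΩ hφ l
    have hb' := bdd_expWeight hΩ hφ (-l)
    rw [inner_mulOp_left hb', mulOp_mulOp hm hb, mulOp_mulOp hb' (bdd_mul hm hb)]
    have e : (fun x => expWeight (-l) φ x * (m x * expWeight l φ x)) = m := by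
      ext x
      have := expWeight_mul_neg l φ x
      linear_combination m x * this
    rw [e]
  rw [weightedForm, form_eq hα hβ hγ, form_eq hα hβ hγ]
  simp only [mulJet_expWeight_hess hΩ hφ, evenPart_add_oddPart_neg]
  rw [key hα, key hβ, key hγ]

lemma mulJet_expWeight_cancel {F : JetL2 Ω} (hF : F ∈ H20 Ω) :
    mulJet (expWeight l φ) (mulJet (expWeight (-l) φ) F) = F := by
  have h1 := mulJet_mem hΩ (isC2b_expWeight hΩ hφ l)
    (mulJet_mem hΩ (isC2b_expWeight hΩ hφ (-l)) hF)
  rw [← sub_eq_zero]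
  exact H20_ext hΩ ((H20 Ω).sub_mem h1 hF)
    (sub_eq_zero.2 (mulOp_expWeight_cancel hΩ hφ l F.1))

end ExpWeight

/-! ### Weighted estimates for the semigroup -/

section WeightedFlow

open scoped ENNReal

variable {Ω : Set Plane} {α β γ : Plane → ℝ}

/-- The lower bounds for a weighted form that control the weighted semigroup: up to the shift `m`,
the form takes its values in a sector of aperture given by `τ`, and it dominates the second
derivatives. -/
structure IsControlled (Ω : Set Plane) (α β γ φ : Plane → ℝ) (l κ τ m : ℝ) : Prop where
  sector : ∀ F ∈ H20 Ω, τ * ‖weightedForm Ω α β γ φ l F‖ - m * ‖F.1‖ ^ 2 ≤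
    (weightedForm Ω α β γ φ l F).re
  lower : ∀ F ∈ H20 Ω, κ * hessSq F.2.2 - m * ‖F.1‖ ^ 2 ≤ (weightedForm Ω α β γ φ l F).re

/-- The jet of `e^{-λφ} e^{-zH} e^{λφ} f`. -/
def weightedFlow (E : ℂ → L2 Ω →L[ℂ] JetL2 Ω) (φ : Plane → ℝ) (l : ℝ) (f : L2 Ω) (z : ℂ) :
    JetL2 Ω :=
  mulJet (expWeight (-l) φ) (E z (mulOp (mu Ω) (expWeight l φ) f))

variable {E : ℂ → L2 Ω →L[ℂ] JetL2 Ω} (hE : IsHeatFlow Ω α β γ E) (hΩ : IsOpen Ω)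
  {φ : Plane → ℝ} (hφ : IsC2b Ω φ) (l : ℝ) (f : L2 Ω)
include hE hΩ hφ

lemma weightedFlow_mem (z : ℂ) : weightedFlow E φ l f z ∈ H20 Ω :=
  mulJet_mem hΩ (isC2b_expWeight hΩ hφ (-l)) (hE.mem z _)

lemma exists_hasDerivAt_weightedFlow (hα : MemLp α ∞ (mu Ω)) (hβ : MemLp β ∞ (mu Ω))
    (hγ : MemLp γ ∞ (mu Ω)) {z : ℂ} (hz : 0 < z.re) : ∃ w',
      HasDerivAt (fun z => (weightedFlow E φ l f z).1) w' z ∧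
      inner ℂ (weightedFlow E φ l f z).1 w' = -weightedForm Ω α β γ φ l (weightedFlow E φ l f z) := by
  obtain ⟨u', hu, hu'⟩ := hE.deriv z hz (mulOp (mu Ω) (expWeight l φ) f)
  refine ⟨mulOp (mu Ω) (expWeight (-l) φ) u',
    (mulOp (mu Ω) (expWeight (-l) φ)).hasFDerivAt.comp_hasDerivAt z hu, ?_⟩
  have hW := weightedFlow_mem hE hΩ hφ l f z
  rw [← inner_mulOp_left (bdd_expWeight hΩ hφ (-l)), ← weightedForm_eq hΩ hφ l hα hβ hγ]
  have h1 := hu' _ (mulJet_mem hΩ (isC2b_expWeight hΩ hφ (-l)) hW)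
  have h2 := mulJet_expWeight_cancel hΩ hφ l (hE.mem z (mulOp (mu Ω) (expWeight l φ) f))
  rw [← h2] at h1
  exact h1

lemma tendsto_weightedFlow : Tendsto (fun z => (weightedFlow E φ l f z).1)
    (𝓝[{z | 0 < z.re}] 0) (𝓝 f) := by
  have h1 := ((mulOp (mu Ω) (expWeight (-l) φ)).continuous.tendsto _).comp
    (hE.tendsto (mulOp (mu Ω) (expWeight l φ) f))
  have h2 := mulOp_expWeight_cancel hΩ hφ (-l) f
  rw [neg_neg] at h2
  rw [h2] at h1
  exact h1

variable (hα : MemLp α ∞ (mu Ω)) (hβ : MemLp β ∞ (mu Ω)) (hγ : MemLp γ ∞ (mu Ω))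
  {κ τ m : ℝ} (hτ : 0 < τ) (hτ1 : τ < 1) (hm : 0 ≤ m) (hc : IsControlled Ω α β γ φ l κ τ m)
include hα hβ hγ hτ hτ1 hm hc

omit hτ hm in
/-- The energy estimate along the ray through `ζ` gives the growth of the weighted semigroup in a
sector. -/
lemma norm_weightedFlow_le {ζ : ℂ} (hζ : ‖ζ - 1‖ ≤ τ) {t : ℝ} (ht : 0 < t) :
    ‖(weightedFlow E φ l f (t * ζ)).1‖ ≤ Real.exp (m * t) * ‖f‖ := by
  have hζre : 0 < ζ.re := by
    have h1 := (abs_le.1 ((Complex.abs_re_le_norm (ζ - 1)).trans hζ)).1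
    rw [Complex.sub_re, Complex.one_re] at h1
    linarith
  have hre : ∀ r : ℝ, 0 < r → 0 < ((r : ℂ) * ζ).re := fun r hr => by
    rw [Complex.re_ofReal_mul]; positivity
  set w : ℝ → L2 Ω := fun r => (weightedFlow E φ l f (r * ζ)).1 with hw
  set N : ℝ → ℝ := fun r => Real.exp (-(2 * m) * r) * ‖w r‖ ^ 2 with hN
  have hder : ∀ r : ℝ, 0 < r → ∃ n', HasDerivAt N n' r ∧ n' ≤ 0 := by
    intro r hr
    obtain ⟨w', hw', hin⟩ :=
      exists_hasDerivAt_weightedFlow hE hΩ hφ l f hα hβ hγ (hre r hr)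
    have h1 : HasDerivAt (fun r : ℝ => (r : ℂ) * ζ) ζ r := by
      simpa using (Complex.ofRealCLM.hasDerivAt (x := r)).mul_const ζ
    have h2 : HasDerivAt w (ζ • w') r :=
      HasDerivAt.scomp (g₁ := fun z => (weightedFlow E φ l f z).1) (g₁' := w') r hw' h1
    have h3 := h2.inner ℂ h2
    have h4 := (Complex.reCLM.hasFDerivAt.comp_hasDerivAt r h3)
    have h5 : HasDerivAt (fun r => ‖w r‖ ^ 2) (2 * (inner ℂ (w r) (ζ • w')).re) r := by
      refine (h4.congr_of_eventuallyEq (Eventually.of_forall fun s => ?_)).congr_deriv ?_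
      · exact norm_sq_eq_re_inner (𝕜 := ℂ) (w s)
      · change (inner ℂ (w r) (ζ • w') + inner ℂ (ζ • w') (w r)).re = _
        rw [Complex.add_re, ← inner_conj_symm (ζ • w'), Complex.conj_re]
        ring
    have h6 : HasDerivAt (fun r : ℝ => Real.exp (-(2 * m) * r))
        (Real.exp (-(2 * m) * r) * -(2 * m)) r := by
      simpa using ((hasDerivAt_id r).const_mul (-(2 * m))).exp
    refine ⟨_, h6.mul h5, ?_⟩
    have h7 := hc.sector _ (weightedFlow_mem hE hΩ hφ l f (r * ζ))
    change τ * _ - m * ‖w r‖ ^ 2 ≤ _ at h7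
    rw [inner_smul_right]
    change inner ℂ (w r) w' = _ at hin
    rw [hin]
    generalize weightedForm Ω α β γ φ l (weightedFlow E φ l f (r * ζ)) = Q at h7
    have h8 : -(τ * ‖Q‖) ≤ ((ζ - 1) * Q).re := by
      have := (abs_le.1 ((Complex.abs_re_le_norm ((ζ - 1) * Q)))).1
      rw [norm_mul] at this
      have h9 : ‖ζ - 1‖ * ‖Q‖ ≤ τ * ‖Q‖ := by gcongr
      linarith
    have h9 : (ζ * -Q).re = -(Q.re + ((ζ - 1) * Q).re) := by
      rw [← Complex.add_re, ← Complex.neg_re]; congr 1; ring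
    rw [h9]
    have h10 := Real.exp_pos (-(2 * m) * r)
    have h11 : Real.exp (-(2 * m) * r) * (2 * (-(m * ‖w r‖ ^ 2) -
      (Q.re + ((ζ - 1) * Q).re))) ≤ 0 :=
      mul_nonpos_of_nonneg_of_nonpos h10.le (by linarith)
    refine le_of_eq_of_le ?_ h11
    ring
  have hanti : AntitoneOn N (Ioi 0) := by
    refine antitoneOn_of_deriv_nonpos (convex_Ioi 0) ?_ ?_ ?_
    · intro r hr
      obtain ⟨n', h1, -⟩ := hder r hr
      exact h1.continuousAt.continuousWithinAt
    · rw [interior_Ioi]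
      intro r hr
      obtain ⟨n', h1, -⟩ := hder r hr
      exact h1.differentiableAt.differentiableWithinAt
    · rw [interior_Ioi]
      intro r hr
      obtain ⟨n', h1, h2⟩ := hder r hr
      rw [h1.deriv]
      exact h2
  have hlim : Tendsto N (𝓝[>] 0) (𝓝 (‖f‖ ^ 2)) := by
    have h1 : Tendsto (fun r : ℝ => (r : ℂ) * ζ) (𝓝[>] 0) (𝓝[{z | 0 < z.re}] 0) := by
      refine tendsto_nhdsWithin_iff.2 ⟨?_, ?_⟩
      · have : Continuous fun r : ℝ => (r : ℂ) * ζ := by fun_prop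
        have h2 := this.tendsto 0
        rw [Complex.ofReal_zero, zero_mul] at h2
        exact h2.mono_left nhdsWithin_le_nhds
      · filter_upwards [self_mem_nhdsWithin] with r hr using hre r hr
    have h2 := (((tendsto_weightedFlow hE hΩ hφ l f).comp h1).norm).pow 2
    have h3 : Tendsto (fun r : ℝ => Real.exp (-(2 * m) * r)) (𝓝[>] 0) (𝓝 1) := by
      have : Continuous fun r : ℝ => Real.exp (-(2 * m) * r) := by fun_prop
      have h4 := this.tendsto 0
      rw [mul_zero, Real.exp_zero] at h4
      exact h4.mono_left nhdsWithin_le_nhds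
    have h4 := h3.mul h2
    rw [one_mul] at h4
    exact h4
  have hle : N t ≤ ‖f‖ ^ 2 := by
    refine ge_of_tendsto hlim ?_
    filter_upwards [Ioo_mem_nhdsGT ht] with r hr
    exact hanti hr.1 ht hr.2.le
  have h1 : ‖w t‖ ^ 2 ≤ (Real.exp (m * t) * ‖f‖) ^ 2 := by
    have e : (Real.exp (m * t) * ‖f‖) ^ 2 = Real.exp (2 * m * t) * ‖f‖ ^ 2 := by
      rw [mul_pow, ← Real.exp_nat_mul]; congr 2; push_cast; ring
    have e2 : ‖w t‖ ^ 2 = Real.exp (2 * m * t) * N t := by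
      rw [hN]
      change _ = Real.exp (2 * m * t) * (Real.exp (-(2 * m) * t) * ‖w t‖ ^ 2)
      rw [← mul_assoc, ← Real.exp_add]
      simp
    rw [e, e2]
    gcongr
  exact le_of_sq_le_sq h1 (by positivity)

/-- The Cauchy estimate for the derivative turns the growth in a sector into a bound for the
second derivatives. -/
lemma hessSq_weightedFlow_le {t : ℝ} (ht : 0 < t) :
    κ * hessSq (weightedFlow E φ l f t).2.2 ≤
      (1 / (τ * t) + m) * (Real.exp (m * t) * ‖f‖) ^ 2 := by
  have htc : (t : ℂ) ≠ 0 := by exact_mod_cast ht.ne'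
  have hball : ∀ z ∈ Metric.closedBall (t : ℂ) (τ * t), 0 < z.re ∧
      ‖(weightedFlow E φ l f z).1‖ ≤ Real.exp (m * t) * ‖f‖ := by
    intro z hz
    rw [Metric.mem_closedBall, dist_eq_norm] at hz
    have hζ : ‖z / t - 1‖ ≤ τ := by
      have : z / t - 1 = (z - t) / t := by field_simp
      rw [this, norm_div, Complex.norm_real, Real.norm_of_nonneg ht.le, div_le_iff₀ ht]
      exact hz
    have h1 := norm_weightedFlow_le hE hΩ hφ l f hα hβ hγ hτ1 hc hζ ht
    rw [mul_div_cancel₀ _ htc] at h1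
    refine ⟨?_, h1⟩
    have h2 := (abs_le.1 ((Complex.abs_re_le_norm (z - t)).trans hz)).1
    rw [Complex.sub_re, Complex.ofReal_re] at h2
    nlinarith
  have hR : 0 < τ * t := by positivity
  obtain ⟨w', hw', hin⟩ := exists_hasDerivAt_weightedFlow hE hΩ hφ l f hα hβ hγ
    (z := (t : ℂ)) (by simpa using ht)
  have hd : DiffContOnCl ℂ (fun z => (weightedFlow E φ l f z).1) (Metric.ball (t : ℂ) (τ * t)) := by
    have h1 : DifferentiableOn ℂ (fun z => (weightedFlow E φ l f z).1)
        (Metric.closedBall (t : ℂ) (τ * t)) := fun z hz => by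
      obtain ⟨v, hv, -⟩ := exists_hasDerivAt_weightedFlow hE hΩ hφ l f hα hβ hγ (hball z hz).1
      exact hv.differentiableAt.differentiableWithinAt
    exact h1.diffContOnCl_ball le_rfl
  have h1 := Complex.norm_deriv_le_of_forall_mem_sphere_norm_le hR hd
    fun z hz => (hball z (Metric.sphere_subset_closedBall hz)).2
  rw [hw'.deriv] at h1
  have h2 := (hball t (Metric.mem_closedBall_self hR.le)).2
  have h3 := hc.lower _ (weightedFlow_mem hE hΩ hφ l f t)
  have h4 : (weightedForm Ω α β γ φ l (weightedFlow E φ l f t)).re ≤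
      ‖(weightedFlow E φ l f t).1‖ * ‖w'‖ := by
    have h5 := (Complex.abs_re_le_norm (inner ℂ (weightedFlow E φ l f t).1 w')).trans
      (norm_inner_le_norm _ _)
    rw [hin, Complex.neg_re, abs_neg] at h5
    exact (le_abs_self _).trans h5
  have h5 : ‖(weightedFlow E φ l f t).1‖ * ‖w'‖ ≤
      (Real.exp (m * t) * ‖f‖) * (Real.exp (m * t) * ‖f‖ / (τ * t)) := by gcongr
  have h6 : m * ‖(weightedFlow E φ l f t).1‖ ^ 2 ≤ m * (Real.exp (m * t) * ‖f‖) ^ 2 := by gcongr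
  have e : (1 / (τ * t) + m) * (Real.exp (m * t) * ‖f‖) ^ 2 =
      (Real.exp (m * t) * ‖f‖) * (Real.exp (m * t) * ‖f‖ / (τ * t)) +
        m * (Real.exp (m * t) * ‖f‖) ^ 2 := by ring
  linarith

end WeightedFlow

/-! ### The heat kernel -/

section Kernel

open scoped ENNReal

variable {Ω : Set Plane} {α β γ : Plane → ℝ}

/-- The value at `x` of the continuous representative of an element of `H²₀(Ω)`. -/
def ptEval (x : Plane) (F : JetL2 Ω) : ℂ :=
  open Classical in if h : F ∈ H20 Ω then (exists_rep h).choose x else 0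

section

variable {F G : JetL2 Ω} (hF : F ∈ H20 Ω)
include hF

lemma ptEval_ae : (fun x => ptEval x F) =ᵐ[mu Ω] F.1 := by
  simp only [ptEval, dif_pos hF]
  exact (exists_rep hF).choose_spec.1

lemma norm_ptEval_sq_le (x : Plane) : ‖ptEval x F‖ ^ 2 ≤ supBound F := by
  simp only [ptEval, dif_pos hF]
  exact (exists_rep hF).choose_spec.2.1 x

lemma norm_ptEval_sub_le (x y : Plane) :
    ‖ptEval x F - ptEval y F‖ ≤ 3 * Real.sqrt (dist x y) * ‖F‖ := by
  simp only [ptEval, dif_pos hF]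
  exact (exists_rep hF).choose_spec.2.2 x y

lemma norm_ptEval_le (x : Plane) : ‖ptEval x F‖ ≤ 2 * ‖F‖ := by
  refine le_of_sq_le_sq ((norm_ptEval_sq_le hF x).trans ((supBound_le F).trans_eq ?_))
    (by positivity)
  ring

lemma continuous_ptEval : Continuous fun x => ptEval x F := by
  rw [continuous_iff_continuousAt]
  intro x
  rw [ContinuousAt, tendsto_iff_norm_sub_tendsto_zero]
  refine squeeze_zero (fun _ => norm_nonneg _) (fun y => norm_ptEval_sub_le hF y x) ?_
  have : Continuous fun y => 3 * Real.sqrt (dist y x) * ‖F‖ := by fun_prop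
  have h := this.tendsto x
  simpa using h

lemma eq_ptEval (hΩ : IsOpen Ω) {w : Plane → ℂ} (hw : ContinuousOn w Ω) (h : w =ᵐ[mu Ω] F.1)
    {x : Plane} (hx : x ∈ Ω) : w x = ptEval x F := by
  have h1 := abs_le_of_ae_le hΩ (f := fun y => ‖w y - ptEval y F‖) (a := 0)
    (hw.sub (continuous_ptEval hF).continuousOn).norm (by
      filter_upwards [h, ptEval_ae hF] with y e1 e2
      have e3 : ptEval y F = F.1 y := e2
      rw [e1, e3, sub_self]; simp) x hx
  rw [abs_of_nonneg (norm_nonneg _)] at h1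
  exact sub_eq_zero.1 (norm_le_zero_iff.1 h1)

lemma ptEval_add (hΩ : IsOpen Ω) (hG : G ∈ H20 Ω) {x : Plane} (hx : x ∈ Ω) :
    ptEval x (F + G) = ptEval x F + ptEval x G := by
  refine (eq_ptEval (w := fun x => ptEval x F + ptEval x G) ((H20 Ω).add_mem hF hG) hΩ
    ((continuous_ptEval hF).add (continuous_ptEval hG)).continuousOn ?_ hx).symm
  filter_upwards [ptEval_ae hF, ptEval_ae hG, Lp.coeFn_add F.1 G.1] with y e1 e2 e3
  change _ = (F.1 + G.1 : L2 Ω) y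
  rw [e3, Pi.add_apply, ← e1, ← e2]

lemma ptEval_smul (hΩ : IsOpen Ω) (c : ℂ) {x : Plane} (hx : x ∈ Ω) :
    ptEval x (c • F) = c * ptEval x F := by
  refine (eq_ptEval (w := fun x => c * ptEval x F) ((H20 Ω).smul_mem c hF) hΩ
    (continuous_const.mul (continuous_ptEval hF)).continuousOn ?_ hx).symm
  filter_upwards [ptEval_ae hF, Lp.coeFn_smul c F.1] with y e1 e3
  change _ = (c • F.1 : L2 Ω) y
  rw [e3, Pi.smul_apply, ← e1, smul_eq_mul]

lemma ptEval_mulJet (hΩ : IsOpen Ω) {χ : Plane → ℝ} (hχ : IsC2b Ω χ) {x : Plane} (hx : x ∈ Ω) :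
    ptEval x (mulJet χ F) = χ x * ptEval x F := by
  refine (eq_ptEval (w := fun x => χ x * ptEval x F) (mulJet_mem hΩ hχ hF) hΩ
    ((Complex.continuous_ofReal.comp_continuousOn hχ.contDiffOn.continuousOn).mul
      (continuous_ptEval hF).continuousOn) ?_ hx).symm
  filter_upwards [ptEval_ae hF, mulOp_ae (hχ.isC1b.bdd hΩ) F.1] with y e1 e3
  change _ = (mulOp (mu Ω) χ F.1) y
  rw [e3, ← e1]

end

lemma supBound_le_sqrt (hΩ : IsOpen Ω) {F : JetL2 Ω} (hF : F ∈ H20 Ω) :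
    supBound F ≤ 4 * (‖F.1‖ * Real.sqrt (hessSq F.2.2)) := by
  have h1 := grad_sq_le_sqrt_hessSq hΩ hF 0
  have h2 := grad_sq_le_sqrt_hessSq hΩ hF 1
  have h3 : ‖F.1‖ * ‖F.2.2 0 1‖ ≤ ‖F.1‖ * Real.sqrt (hessSq F.2.2) := by
    gcongr; exact norm_le_sqrt_hessSq hF 0 1
  unfold supBound
  nlinarith [sq_nonneg (‖F.2.1 0‖ - ‖F.2.1 1‖)]

/-- The vector `k` with `⟨k, f⟩ = (e^{-tH} f)(x)`. -/
def kernelVec (E : ℂ → L2 Ω →L[ℂ] JetL2 Ω) (t : ℝ) (x : Plane) : L2 Ω :=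
  open Classical in
  if h : ∃ k : L2 Ω, ∀ f, inner ℂ k f = ptEval x (E t f) then h.choose else 0

/-- The kernel of `e^{-tH}`, as the composition of two kernels of `e^{-tH/2}`. -/
def heatKernel (E : ℂ → L2 Ω →L[ℂ] JetL2 Ω) (x y : Plane) (t : ℝ) : ℂ :=
  inner ℂ (kernelVec E (t / 2) x) (kernelVec E (t / 2) y)

variable {E : ℂ → L2 Ω →L[ℂ] JetL2 Ω} (hE : IsHeatFlow Ω α β γ E) (hΩ : IsOpen Ω)
include hE hΩ

lemma inner_kernelVec (t : ℝ) {x : Plane} (hx : x ∈ Ω) (f : L2 Ω) :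
    inner ℂ (kernelVec E t x) f = ptEval x (E t f) := by
  have h : ∃ k : L2 Ω, ∀ f, inner ℂ k f = ptEval x (E t f) := by
    let A : L2 Ω →L[ℂ] ℂ := LinearMap.mkContinuous
      { toFun := fun f => ptEval x (E t f)
        map_add' := fun f g => by
          rw [map_add, ptEval_add (hE.mem _ _) hΩ (hE.mem _ _) hx]
        map_smul' := fun c f => by
          rw [map_smul, ptEval_smul (hE.mem _ _) hΩ c hx]; rfl } (2 * ‖E t‖) fun f => by
        change ‖ptEval x (E t f)‖ ≤ _
        have := (E t).le_opNorm f
        linarith [norm_ptEval_le (hE.mem t f) x]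
    exact ⟨(InnerProductSpace.toDual ℂ (L2 Ω)).symm A, fun f =>
      InnerProductSpace.toDual_symm_apply⟩
  rw [kernelVec, dif_pos h]
  exact h.choose_spec f

lemma continuousOn_kernelVec (t : ℝ) : ContinuousOn (kernelVec E t) Ω := by
  have key : ∀ x ∈ Ω, ∀ y ∈ Ω,
      ‖kernelVec E t x - kernelVec E t y‖ ≤ 3 * Real.sqrt (dist x y) * ‖E t‖ := by
    intro x hx y hy
    set k := kernelVec E t x - kernelVec E t y with hk
    have h1 : inner ℂ k k = ptEval x (E t k) - ptEval y (E t k) := by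
      nth_rw 1 [hk]
      rw [inner_sub_left, inner_kernelVec hE hΩ t hx, inner_kernelVec hE hΩ t hy]
    have h2 : ‖k‖ ^ 2 ≤ 3 * Real.sqrt (dist x y) * (‖E t‖ * ‖k‖) := by
      have h3 : ‖(inner ℂ k k : ℂ)‖ = ‖k‖ ^ 2 := by
        rw [inner_self_eq_norm_sq_to_K, norm_pow]; simp
      rw [← h3, h1]
      refine (norm_ptEval_sub_le (hE.mem t k) x y).trans ?_
      gcongr
      exact (E t).le_opNorm k
    rcases (norm_nonneg k).eq_or_lt with h0 | h0
    · rw [← h0]; positivity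
    · refine le_of_mul_le_mul_right ?_ h0
      linarith
  intro x hx
  rw [ContinuousWithinAt, tendsto_iff_norm_sub_tendsto_zero]
  have h1 : Tendsto (fun y => 3 * Real.sqrt (dist y x) * ‖E t‖) (𝓝[Ω] x) (𝓝 0) := by
    have : Continuous fun y => 3 * Real.sqrt (dist y x) * ‖E t‖ := by fun_prop
    have h := this.tendsto x
    rw [dist_self, Real.sqrt_zero, mul_zero, zero_mul] at h
    exact h.mono_left nhdsWithin_le_nhds
  refine squeeze_zero' (Eventually.of_forall fun _ => norm_nonneg _) ?_ h1
  filter_upwards [self_mem_nhdsWithin] with y hy using key y hy x hx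

lemma isHeatKernel_heatKernel (hT : IsHeatSemigroup Ω α β γ fun t => if t ≤ 0 then
      ContinuousLinearMap.id ℂ (L2 Ω) else (ContinuousLinearMap.fst ℂ _ _).comp (E t)) :
    IsHeatKernel Ω α β γ (heatKernel E) := by
  refine ⟨_, hT, fun t ht => ⟨?_, fun f => ?_⟩⟩
  · have h := continuousOn_kernelVec hE hΩ (t / 2)
    exact (h.comp continuousOn_fst fun p hp => hp.1).inner
      (h.comp continuousOn_snd fun p hp => hp.2)
  have ht2 : 0 < t / 2 := half_pos ht
  have h1 : ∀ g : L2 Ω, (E t g).1 = (E ((t / 2 : ℝ) : ℂ) (E ((t / 2 : ℝ) : ℂ) g).1).1 := by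
    intro g
    have := hE.add (t / 2) (t / 2) ht2 ht2 g
    rwa [add_halves] at this
  simp only [ht.not_ge, if_false]
  filter_upwards [ptEval_ae (hE.mem t f), ae_restrict_mem hΩ.measurableSet] with x e1 hx
  set k := kernelVec E (t / 2) x with hk
  set v := (E ((t / 2 : ℝ) : ℂ) k).1 with hv
  -- `e^{-tH/2} k` is the complex conjugate of `G(x, ·, t)`
  have h2 : (fun y => heatKernel E x y t) =ᵐ[mu Ω] fun y => starRingEnd ℂ (v y) := by
    filter_upwards [ptEval_ae (hE.mem ((t / 2 : ℝ) : ℂ) k), ae_restrict_mem hΩ.measurableSet]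
      with y e2 hy
    rw [hv, ← e2, ← inner_kernelVec hE hΩ (t / 2) hy, inner_conj_symm]
    rfl
  have h3 : (fun y => heatKernel E x y t * f y) =ᵐ[mu Ω] fun y => (inner ℂ (v y) (f y) : ℂ) := by
    filter_upwards [h2] with y e2
    rw [e2, RCLike.inner_apply, mul_comm]
  have hcont : ContinuousOn (fun y => ptEval y (E t f)) Ω := (continuous_ptEval (hE.mem t f)).continuousOn
  refine ⟨(L2.integrable_inner v f).congr h3.symm, ?_⟩
  change (E t f).1 x = _
  rw [← e1, integral_congr_ae h3, ← L2.inner_def, hv, hE.symm _ ht2,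
    inner_kernelVec hE hΩ (t / 2) hx]
  refine eq_ptEval (w := fun y => ptEval y (E t f)) (hE.mem _ _) hΩ hcont ?_ hx
  rw [← h1]
  exact ptEval_ae (hE.mem t f)

section Bound

variable {φ : Plane → ℝ} (hφ : IsC2b Ω φ) (hα : MemLp α ∞ (mu Ω)) (hβ : MemLp β ∞ (mu Ω))
  (hγ : MemLp γ ∞ (mu Ω)) {κ τ m : ℝ} (hκ : 0 < κ) (hτ : 0 < τ) (hτ1 : τ < 1) (hm : 0 ≤ m)
include hφ hα hβ hγ hκ hτ hτ1 hm

/-- The weighted kernel vector is tested against itself: `‖e^ψ k‖²` is the value at `x` of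
`e^ψ e^{-ψ} e^{-tH} e^{ψ} (e^ψ k)`, which the weighted estimates and the Sobolev embedding bound. -/
lemma norm_mulOp_kernelVec_sq_le {l : ℝ} (hc : IsControlled Ω α β γ φ l κ τ m) {t : ℝ} (ht : 0 < t)
    {x : Plane} (hx : x ∈ Ω) : ‖mulOp (mu Ω) (expWeight l φ) (kernelVec E t x)‖ ^ 2 ≤
      4 * (Real.exp (2 * (m * t)) * Real.sqrt ((1 / (τ * t) + m) / κ)) * expWeight l φ x ^ 2 := by
  set k := mulOp (mu Ω) (expWeight l φ) (kernelVec E t x) with hk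
  have hmem := weightedFlow_mem hE hΩ hφ l k t
  have h1 : inner ℂ k k = (expWeight l φ x : ℂ) * ptEval x (weightedFlow E φ l k t) := by
    nth_rw 1 [hk]
    rw [inner_mulOp_left (bdd_expWeight hΩ hφ l), inner_kernelVec hE hΩ t hx, weightedFlow,
      ptEval_mulJet (hE.mem _ _) hΩ (isC2b_expWeight hΩ hφ (-l)) hx, ← mul_assoc,
      ← Complex.ofReal_mul, expWeight_mul_neg, Complex.ofReal_one, one_mul]
  have h2 : ‖(inner ℂ k k : ℂ)‖ = ‖k‖ ^ 2 := by
    rw [inner_self_eq_norm_sq_to_K, norm_pow]; simp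
  have h3 := norm_ptEval_sq_le hmem x
  have h4 := h3.trans (supBound_le_sqrt hΩ hmem)
  have h5 := norm_weightedFlow_le hE hΩ hφ l k hα hβ hγ hτ1 hc (ζ := 1) (by simp [hτ.le]) ht
  rw [mul_one] at h5
  have h6 := hessSq_weightedFlow_le hE hΩ hφ l k hα hβ hγ hτ hτ1 hm hc ht
  have h7 : Real.sqrt (hessSq (weightedFlow E φ l k t).2.2) ≤
      Real.sqrt ((1 / (τ * t) + m) / κ) * (Real.exp (m * t) * ‖k‖) := by
    have h8 : 0 ≤ (1 / (τ * t) + m) / κ := by positivity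
    refine Real.sqrt_le_iff.2 ⟨by positivity, ?_⟩
    rw [mul_pow, Real.sq_sqrt h8, div_mul_eq_mul_div, le_div_iff₀ hκ]
    linarith
  have h8 : ‖ptEval x (weightedFlow E φ l k t)‖ ^ 2 ≤
      4 * ((Real.exp (m * t) * ‖k‖) * (Real.sqrt ((1 / (τ * t) + m) / κ) *
        (Real.exp (m * t) * ‖k‖))) := h4.trans (by gcongr)
  have h9 : (‖k‖ ^ 2) ^ 2 ≤ expWeight l φ x ^ 2 *
      (4 * ((Real.exp (m * t) * ‖k‖) * (Real.sqrt ((1 / (τ * t) + m) / κ) *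
        (Real.exp (m * t) * ‖k‖)))) := by
    rw [← h2, h1, norm_mul, mul_pow, Complex.norm_real, Real.norm_eq_abs, sq_abs]
    gcongr
  rcases (norm_nonneg k).eq_or_lt with h0 | h0
  · rw [← h0, zero_pow two_ne_zero]; positivity
  · refine le_of_mul_le_mul_right ?_ (pow_pos h0 2)
    have e : Real.exp (2 * (m * t)) = Real.exp (m * t) * Real.exp (m * t) := by
      rw [← Real.exp_add]; congr 1; ring
    rw [e]
    linarith

/-- Davies' bound for the heat kernel. -/
lemma norm_heatKernel_le {l : ℝ} (hc : IsControlled Ω α β γ φ l κ τ m)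
    (hc' : IsControlled Ω α β γ φ (-l) κ τ m) {t : ℝ} (ht : 0 < t)
    {x y : Plane} (hx : x ∈ Ω) (hy : y ∈ Ω) : ‖heatKernel E x y t‖ ≤
      4 * (Real.exp (m * t) * Real.sqrt ((2 / (τ * t) + m) / κ)) * Real.exp (l * (φ x - φ y)) := by
  have ht2 : 0 < t / 2 := half_pos ht
  have h1 := norm_mulOp_kernelVec_sq_le hE hΩ hφ hα hβ hγ hκ hτ hτ1 hm hc ht2 hx
  have h2 := norm_mulOp_kernelVec_sq_le hE hΩ hφ hα hβ hγ hκ hτ hτ1 hm hc' ht2 hy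
  set u := mulOp (mu Ω) (expWeight l φ) (kernelVec E (t / 2) x)
  set v := mulOp (mu Ω) (expWeight (-l) φ) (kernelVec E (t / 2) y) with hv
  have e1 : heatKernel E x y t = inner ℂ u v := by
    rw [inner_mulOp_left (bdd_expWeight hΩ hφ l), hv, mulOp_expWeight_cancel hΩ hφ l]
    rfl
  have e2 : 2 * (m * (t / 2)) = m * t := by ring
  have e3 : 1 / (τ * (t / 2)) = 2 / (τ * t) := by field_simp
  rw [e2, e3] at h1 h2
  set B := 4 * (Real.exp (m * t) * Real.sqrt ((2 / (τ * t) + m) / κ))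
  have hB : 0 ≤ B := by positivity
  rw [e1]
  refine (norm_inner_le_norm u v).trans (le_of_sq_le_sq ?_ (by positivity))
  have e4 : (B * Real.exp (l * (φ x - φ y))) ^ 2 =
      (B * expWeight l φ x ^ 2) * (B * expWeight (-l) φ y ^ 2) := by
    rw [mul_sub, sub_eq_add_neg, Real.exp_add, ← neg_mul]
    unfold expWeight
    ring
  rw [mul_pow, e4]
  gcongr

end Bound

end Kernel

/-! ### Optimisation of the exponential weight -/

/-- The singularity at `t = 0` is `t^{-1/2}`; the growth in `m` is absorbed by a small part of the
exponential. -/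
lemma sqrt_prefactor_le {κ τ m t η : ℝ} (hκ : 0 < κ) (hτ : 0 < τ) (hτ1 : τ < 1) (hm : 0 ≤ m)
    (ht : 0 < t) (hη : 0 < η) (hη1 : η ≤ 1 / 2) :
    4 * (Real.exp (m * t) * Real.sqrt ((2 / (τ * t) + m) / κ)) ≤
      4 * Real.sqrt (1 / (τ * κ * η)) * t ^ (-(1 / 2) : ℝ) * Real.exp ((1 + η) * m * t) := by
  have hy : 0 ≤ m * t := by positivity
  have hs : (t ^ (-(1 / 2) : ℝ)) ^ 2 = 1 / t := by
    rw [← Real.rpow_natCast, ← Real.rpow_mul ht.le]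
    norm_num [Real.rpow_neg_one]
  have h1 : Real.sqrt ((2 / (τ * t) + m) / κ) ≤
      Real.sqrt (1 / (τ * κ * η)) * t ^ (-(1 / 2) : ℝ) * Real.exp (η * (m * t)) := by
    refine Real.sqrt_le_iff.2 ⟨by positivity, ?_⟩
    rw [mul_pow, mul_pow, hs, Real.sq_sqrt (by positivity), ← Real.exp_nat_mul]
    have h2 := Real.add_one_le_exp ((2 : ℕ) * (η * (m * t)))
    push_cast at h2 ⊢
    -- `2η (1 + y) ≤ 1 + 2η y ≤ exp (2η y)` with `y = m t`
    have h3 : η * (2 + τ * (m * t)) ≤ Real.exp (2 * (η * (m * t))) := by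
      have h4 : τ * (m * t) ≤ 1 * (m * t) := mul_le_mul_of_nonneg_right hτ1.le hy
      have h5 := mul_le_mul_of_nonneg_left h4 hη.le
      have h6 := mul_nonneg hη.le hy
      linarith
    have e1 : (2 / (τ * t) + m) / κ = 1 / (τ * κ * η) * (1 / t) * (η * (2 + τ * (m * t))) := by
      field_simp
    rw [e1]
    gcongr
  have e2 : Real.exp ((1 + η) * m * t) = Real.exp (m * t) * Real.exp (η * (m * t)) := by
    rw [← Real.exp_add]; congr 1; ring
  rw [e2]
  calc _ ≤ 4 * (Real.exp (m * t) * (Real.sqrt (1 / (τ * κ * η)) * t ^ (-(1 / 2) : ℝ) *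
        Real.exp (η * (m * t)))) := by gcongr
    _ = _ := by ring

/-- The Legendre transform of `λ ↦ A t λ⁴`, at `r ≥ 0`. -/
lemma exists_optimal_exponent {A t : ℝ} (hA : 0 < A) (ht : 0 < t) (r : ℝ) :
    ∃ l : ℝ, A * l ^ 4 * t - l * r =
      -(3 / 4 * (1 / (4 * A)) ^ (1 / 3 : ℝ)) * (max r 0 ^ (4 / 3 : ℝ) / t ^ (1 / 3 : ℝ)) := by
  rcases le_total r 0 with hr | hr
  · refine ⟨0, ?_⟩
    rw [max_eq_right hr, Real.zero_rpow (by norm_num)]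
    simp
  -- the stationary point is given by `4 A t λ³ = r`
  refine ⟨(1 / (4 * A)) ^ (1 / 3 : ℝ) * (r ^ (1 / 3 : ℝ) / t ^ (1 / 3 : ℝ)), ?_⟩
  rw [max_eq_left hr]
  have cube : ∀ x : ℝ, 0 ≤ x → (x ^ (1 / 3 : ℝ)) ^ 3 = x := fun x hx => by
    rw [← Real.rpow_natCast, ← Real.rpow_mul hx]
    norm_num
  have e1 := cube (1 / (4 * A)) (by positivity)
  have e2 := cube r hr
  have e3 := cube t ht.le
  have e4 : r ^ (4 / 3 : ℝ) = r * r ^ (1 / 3 : ℝ) := by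
    rw [show (4 / 3 : ℝ) = 1 + 1 / 3 by norm_num, Real.rpow_add_of_nonneg hr (by norm_num)
      (by norm_num), Real.rpow_one]
  have hτ : 0 < t ^ (1 / 3 : ℝ) := by positivity
  rw [e4]
  generalize (1 / (4 * A)) ^ (1 / 3 : ℝ) = a at *
  generalize r ^ (1 / 3 : ℝ) = p at *
  generalize t ^ (1 / 3 : ℝ) = q at *
  have e5 : A * (a * (p / q)) ^ 4 * t = A * a ^ 3 * (a * (p / q)) * (p ^ 3) * (t / q ^ 3) := by
    field_simp
  rw [e5, e1, e2, e3, div_self ht.ne']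
  field_simp
  ring

/-- `σ ↦ (3/4) (4σ)^{-1/3}` is Lipschitz on `[8, ∞)`. -/
lemma sub_le_rpow_third {k y η : ℝ} (hk : 8 ≤ k) (hy : 0 ≤ y) (hη : 0 ≤ η) :
    3 / 4 * (1 / (4 * k)) ^ (1 / 3 : ℝ) - y - η ≤
      3 / 4 * (1 / (4 * ((1 + η) * (k + y)))) ^ (1 / 3 : ℝ) := by
  obtain ⟨w, hw⟩ : ∃ w, w = (1 + η) * (1 + y / k) := ⟨_, rfl⟩
  have hk0 : 0 < k := by linarith
  have hyk : 0 ≤ y / k := by positivity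
  have hyk' : y / k ≤ y := div_le_self hy (by linarith)
  have hw1 : 1 ≤ w := by rw [hw]; nlinarith
  have hw0 : 0 < w := by linarith
  have e : 1 / (4 * ((1 + η) * (k + y))) = 1 / (4 * k) * (1 / w) := by
    rw [hw]; field_simp
  rw [e, Real.mul_rpow (by positivity) (by positivity)]
  have hs0 : 0 ≤ (1 / (4 * k)) ^ (1 / 3 : ℝ) := by positivity
  have hs1 : (1 / (4 * k)) ^ (1 / 3 : ℝ) ≤ 1 :=
    Real.rpow_le_one (by positivity) (by rw [div_le_one (by positivity)]; linarith) (by norm_num)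
  have h1 : 1 / w ≤ (1 / w) ^ (1 / 3 : ℝ) := by
    have h := Real.rpow_le_rpow_of_exponent_ge (x := 1 / w) (y := 1) (z := 1 / 3) (by positivity)
      (by rw [div_le_one hw0]; exact hw1) (by norm_num)
    rwa [Real.rpow_one] at h
  have h2 : 1 - y - η ≤ 1 / w := by
    rw [le_div_iff₀ hw0, hw]
    nlinarith [mul_nonneg hη hyk, mul_nonneg hy hyk, mul_nonneg hη hη, mul_nonneg hy hη,
      mul_nonneg hy (mul_nonneg hη hyk), mul_nonneg hη (mul_nonneg hη hyk)]
  have h3 := mul_le_mul_of_nonneg_left (h2.trans h1) hs0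
  nlinarith

variable {Ω : Set Plane} {α β γ : Plane → ℝ} {a₀ a₁ δ : ℝ}

lemma classE_zero {M : ℝ} (hM : 0 ≤ M) : ClassE Ω α β γ M fun _ => 0 := by
  have h : ∀ i, pd i (fun _ : Plane => (0 : ℝ)) = fun _ => 0 := fun i => by
    funext x; simp [pd]
  refine ⟨contDiffOn_const, ⟨0, fun x _ => ⟨by simp, fun i => by simp [h], fun i j => ?_⟩⟩, ?_,
    fun x _ i j => ?_⟩
  · simp [h]
  · exact Eventually.of_forall fun y => by simp [h, symbolA]
  · simpa [h] using hM

/-- A bound that holds for every weight of the class holds for their supremum `d_M`, also under the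
convention that the supremum of an unbounded set is zero. -/
lemma dM_mem_of_forall {M : ℝ} (hM : 0 ≤ M) {x x' : Plane} {S : Set ℝ} (hS : IsClosed S)
    (h : ∀ φ, ClassE Ω α β γ M φ → max (φ x' - φ x) 0 ∈ S) : dM Ω α β γ M x x' ∈ S := by
  have h0 : (0 : ℝ) ∈ {r : ℝ | ∃ φ : Plane → ℝ, ClassE Ω α β γ M φ ∧ r = φ x' - φ x} :=
    ⟨_, classE_zero hM, by simp⟩
  unfold dM
  by_cases hb : BddAbove {r : ℝ | ∃ φ : Plane → ℝ, ClassE Ω α β γ M φ ∧ r = φ x' - φ x}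
  · have h1 := closure_minimal (t := (fun r : ℝ => max r 0) ⁻¹' S)
      (by rintro _ ⟨φ, hφ, rfl⟩; exact h φ hφ) (hS.preimage (by fun_prop))
      (csSup_mem_closure ⟨0, h0⟩ hb)
    rwa [mem_preimage, max_eq_left (le_csSup hb h0)] at h1
  · rw [Real.sSup_of_not_bddAbove hb]
    simpa using h _ (classE_zero hM)

lemma dM_nonneg {M : ℝ} (hM : 0 ≤ M) (x x' : Plane) : 0 ≤ dM Ω α β γ M x x' :=
  dM_mem_of_forall (S := Ici 0) hM isClosed_Ici fun _ _ => mem_Ici.2 (le_max_right _ _)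

/-- A lower bound for the weighted forms with constant `A` of `λ⁴` gives a kernel bound with
the exponent of the Legendre transform of `A λ⁴`. -/
lemma exists_bound_of_weighted_lower {E : ℂ → L2 Ω →L[ℂ] JetL2 Ω} (hE : IsHeatFlow Ω α β γ E)
    (hΩ : IsOpen Ω) (ha₀ : 0 < a₀) (h1 : a₀ ≤ a₁) (hδ : 0 < δ) (hδ1 : δ ≤ 1)
    (hell : UniformlyElliptic a₀ a₁ δ Ω α β γ) {κ A η : ℝ} (hκ : 0 < κ) (hA : 0 ≤ A) (hη : 0 < η)
    (hη1 : η ≤ 1 / 2)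
    (hlow : ∀ M : ℝ, 0 ≤ M → ∃ C : ℝ, ∀ φ, ClassE Ω α β γ M φ → ∀ l : ℝ, ∀ F ∈ H20 Ω,
      κ * hessSq F.2.2 - A * (l ^ 4 * ‖F.1‖ ^ 2) - C * ‖F.1‖ ^ 2 ≤
        (weightedForm Ω α β γ φ l F).re) :
    ∃ B : ℝ, 0 < B ∧ ∀ M : ℝ, 0 ≤ M → ∃ C : ℝ, 0 < C ∧ ∀ x ∈ Ω, ∀ x' ∈ Ω, ∀ t : ℝ, 0 < t →
      ‖heatKernel E x x' t‖ ≤ B * t ^ (-(1 / 2) : ℝ) *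
        Real.exp (-(3 / 4 * (1 / (4 * ((1 + η) * (A + κ)))) ^ (1 / 3 : ℝ)) *
          (dM Ω α β γ M x x' ^ (4 / 3 : ℝ) / t ^ (1 / 3 : ℝ)) + C * t) := by
  have ha1 : 0 < a₁ := ha₀.trans_le h1
  set b : ℝ := 1 + (δ * a₀)⁻¹
  have hb : 0 ≤ b := by positivity
  obtain ⟨N, hN⟩ : ∃ N, N = 4 * a₁ * (3 + (6 * b ^ 4 + 144 * b ^ 4 + 6)) := ⟨_, rfl⟩
  have hN0 : 0 < N := by rw [hN]; positivity
  -- the sector of the weighted forms: `τ N ≤ κ`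
  obtain ⟨τ, hτ⟩ : ∃ τ, τ = min (κ / N) (1 / 2) := ⟨_, rfl⟩
  have hτ0 : 0 < τ := by rw [hτ]; exact lt_min (by positivity) (by norm_num)
  have hτ1 : τ < 1 := by rw [hτ]; exact (min_le_right _ _).trans_lt (by norm_num)
  have hτN : τ * N ≤ κ := by
    rw [← le_div_iff₀ hN0, hτ]; exact min_le_left _ _
  refine ⟨4 * Real.sqrt (1 / (τ * κ * η)), by positivity, fun M hM => ?_⟩
  obtain ⟨C₁, hC₁⟩ := hlow M hM
  obtain ⟨C, hC⟩ : ∃ C, C = |C₁| + 24 * a₁ * M ^ 4 + 1 := ⟨_, rfl⟩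
  have hC0 : 0 < C := by rw [hC]; positivity
  refine ⟨(1 + η) * C, by positivity, fun x hx x' hx' t ht => ?_⟩
  have hcontrol : ∀ φ, ClassE Ω α β γ M φ → ∀ l : ℝ,
      IsControlled Ω α β γ φ l κ τ ((A + κ) * l ^ 4 + C) := by
    intro φ hφ l
    have key : ∀ F ∈ H20 Ω, κ * hessSq F.2.2 - A * (l ^ 4 * ‖F.1‖ ^ 2) - |C₁| * ‖F.1‖ ^ 2 ≤
        (weightedForm Ω α β γ φ l F).re := fun F hF => by
      have h2 := mul_le_mul_of_nonneg_right (le_abs_self C₁) (sq_nonneg ‖F.1‖)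
      linarith [hC₁ φ hφ l F hF]
    refine ⟨fun F hF => ?_, fun F hF => ?_⟩
    · have h2 := norm_weightedForm_le hΩ (hφ.isWeight hΩ ha₀ hδ hδ1 hell) hF ha₀ h1 hell l
      have h3 := mul_le_mul_of_nonneg_left h2 hτ0.le
      have h4 := key F hF
      have hH := hessSq_nonneg F.2.2
      have hU : 0 ≤ ‖F.1‖ ^ 2 := by positivity
      have hL : 0 ≤ l ^ 4 * ‖F.1‖ ^ 2 := by positivity
      have h5 := mul_le_mul_of_nonneg_right hτN (add_nonneg hH hL)
      have h6 : τ * (24 * a₁ * M ^ 4 * ‖F.1‖ ^ 2) ≤ 24 * a₁ * M ^ 4 * ‖F.1‖ ^ 2 :=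
        mul_le_of_le_one_left (by positivity) hτ1.le
      rw [hN] at h5
      rw [hC]
      linarith
    · have h4 := key F hF
      have hU : 0 ≤ ‖F.1‖ ^ 2 := by positivity
      have hL : 0 ≤ κ * (l ^ 4 * ‖F.1‖ ^ 2) := by positivity
      have hM4 : 0 ≤ 24 * a₁ * M ^ 4 * ‖F.1‖ ^ 2 := by positivity
      rw [hC]
      linarith
  have hcl : IsClosed {d : ℝ | ‖heatKernel E x x' t‖ ≤ 4 * Real.sqrt (1 / (τ * κ * η)) *
      t ^ (-(1 / 2) : ℝ) * Real.exp (-(3 / 4 * (1 / (4 * ((1 + η) * (A + κ)))) ^ (1 / 3 : ℝ)) *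
        (d ^ (4 / 3 : ℝ) / t ^ (1 / 3 : ℝ)) + (1 + η) * C * t)} := by
    refine isClosed_le continuous_const ?_
    have : Continuous fun d : ℝ => d ^ (4 / 3 : ℝ) :=
      Real.continuous_rpow_const (by norm_num)
    fun_prop
  refine dM_mem_of_forall hM hcl fun φ hφ => ?_
  obtain ⟨l, hl⟩ := exists_optimal_exponent (A := (1 + η) * (A + κ)) (by positivity) ht
    (φ x' - φ x)
  have hm : 0 ≤ (A + κ) * l ^ 4 + C := by positivity
  have hc' : IsControlled Ω α β γ φ (-l) κ τ ((A + κ) * l ^ 4 + C) := by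
    have := hcontrol φ hφ (-l)
    rwa [show (-l) ^ 4 = l ^ 4 by ring] at this
  have h2 := norm_heatKernel_le hE hΩ (hφ.isWeight hΩ ha₀ hδ hδ1 hell).isC2b (hell.bdd_α ha₀)
    hell.bdd_β (hell.bdd_γ ha₀) hκ hτ0 hτ1 hm (hcontrol φ hφ l) hc' ht hx hx'
  have h3 := mul_le_mul_of_nonneg_right (sqrt_prefactor_le hκ hτ0 hτ1 hm ht hη hη1)
    (Real.exp_pos (l * (φ x - φ x'))).le
  refine (h2.trans h3).trans_eq ?_
  rw [mul_assoc, ← Real.exp_add, ← hl]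
  congr 2
  ring

/-- The heat kernel bound, with a constant that depends only on the ellipticity constants. -/
lemma exists_const_heatKernel_bound (ha₀ : 0 < a₀) (h1 : a₀ ≤ a₁) (hδ : 0 < δ) (hδ1 : δ ≤ 1) :
    ∃ c : ℝ, 0 < c ∧ ∀ (Ω : Set Plane) (α β γ : Plane → ℝ) (κ : ℝ) (E : ℂ → L2 Ω →L[ℂ] JetL2 Ω),
      IsOpen Ω → Ω.Nonempty → UniformlyElliptic a₀ a₁ δ Ω α β γ → 0 < κ → Garding Ω α β γ κ →
      IsHeatFlow Ω α β γ E → ∀ ε : ℝ, 0 < ε → ∃ B : ℝ, 0 < B ∧ ∀ M : ℝ, 0 ≤ M →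
        ∃ C : ℝ, 0 < C ∧ ∀ x ∈ Ω, ∀ x' ∈ Ω, ∀ t : ℝ, 0 < t →
          ‖heatKernel E x x' t‖ ≤ B * t ^ (-(1 / 2) : ℝ) *
            Real.exp (-(sigmaStar Ω α β γ - c * constD Ω α β γ - ε) *
              (dM Ω α β γ M x x' ^ (4 / 3 : ℝ) / t ^ (1 / 3 : ℝ)) + C * t) := by
  have ha1 : 0 < a₁ := ha₀.trans_le h1
  obtain ⟨K, D₁, ε₁, hK, hD₁, hε₁, hlow⟩ := exists_weighted_lower ha₀ h1 hδ hδ1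
  refine ⟨max K (1 / D₁), lt_max_of_lt_left hK,
    fun Ω α β γ κ E hΩ hne hell hκ hG hE ε hε => ?_⟩
  have hk := hell.eight_le_kStar ha₀ h1 hδ hΩ hne
  have hD0 : 0 ≤ constD Ω α β γ := constD_nonneg
  -- it is enough to reach some exponent that is not smaller
  obtain ⟨κ', A, η, hκ', hA, hη, hη1, hlow', hσ⟩ : ∃ κ' A η : ℝ, 0 < κ' ∧ 0 ≤ A ∧ 0 < η ∧
      η ≤ 1 / 2 ∧ (∀ M : ℝ, 0 ≤ M → ∃ C : ℝ, ∀ φ, ClassE Ω α β γ M φ → ∀ l : ℝ, ∀ F ∈ H20 Ω,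
        κ' * hessSq F.2.2 - A * (l ^ 4 * ‖F.1‖ ^ 2) - C * ‖F.1‖ ^ 2 ≤
          (weightedForm Ω α β γ φ l F).re) ∧
      sigmaStar Ω α β γ - max K (1 / D₁) * constD Ω α β γ - ε ≤
        3 / 4 * (1 / (4 * ((1 + η) * (A + κ')))) ^ (1 / 3 : ℝ) := by
    rcases lt_or_ge (constD Ω α β γ) D₁ with hD | hD
    · obtain ⟨ε', hε'⟩ : ∃ ε', ε' = min ε₁ (min (1 / 2) (ε / (K + 2))) := ⟨_, rfl⟩
      have hε0 : 0 < ε' := by rw [hε']; positivity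
      have hεK : ε' * (K + 2) ≤ ε := by
        rw [← le_div_iff₀ (by positivity), hε']
        exact (min_le_right _ _).trans (min_le_right _ _)
      refine ⟨ε', kStar Ω α β γ + K * constD Ω α β γ + K * ε', ε', hε0, by positivity, hε0, ?_,
        hlow Ω α β γ hΩ hne hell hD ε' hε0 (by rw [hε']; exact min_le_left _ _), ?_⟩
      · rw [hε']; exact (min_le_right _ _).trans (min_le_left _ _)
      have h2 := sub_le_rpow_third hk
        (y := K * constD Ω α β γ + K * ε' + ε') (by positivity) hε0.le
      have h3 := mul_le_mul_of_nonneg_right (le_max_left K (1 / D₁)) hD0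
      rw [show kStar Ω α β γ + K * constD Ω α β γ + K * ε' + ε' =
        kStar Ω α β γ + (K * constD Ω α β γ + K * ε' + ε') by ring]
      unfold sigmaStar
      linarith
    -- for large `D` the claimed exponent is nonpositive, and every weighted bound is sufficient
    · obtain ⟨C, hC⟩ := hG
      refine ⟨κ / 2, 12 * a₁ + (6 * a₁ + (6 + 288) * a₁ * (8 * a₁ / κ)) *
        (1 + (δ * a₀)⁻¹) ^ 4, 1 / 2, half_pos hκ, by positivity, by norm_num, le_rfl,
        fun M hM => ⟨C + 12 * a₁ * M ^ 4, fun φ hφ l F hF => ?_⟩, ?_⟩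
      · exact weighted_garding hΩ (hφ.isWeight hΩ ha₀ hδ hδ1 hell) hF ha₀ h1 hell hκ (hC F hF) l
      · refine le_trans ?_ (by positivity : (0 : ℝ) ≤ _)
        have h2 : (1 / (4 * kStar Ω α β γ)) ^ (1 / 3 : ℝ) ≤ 1 :=
          Real.rpow_le_one (by positivity) (by rw [div_le_one (by positivity)]; linarith)
            (by norm_num)
        have h3 : 1 ≤ max K (1 / D₁) * constD Ω α β γ :=
          calc (1 : ℝ) = 1 / D₁ * D₁ := by field_simp
            _ ≤ _ := by gcongr; exact le_max_right _ _
        unfold sigmaStar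
        linarith
  obtain ⟨B, hB, h⟩ := exists_bound_of_weighted_lower hE hΩ ha₀ h1 hδ hδ1 hell hκ' hA hη hη1 hlow'
  refine ⟨B, hB, fun M hM => ?_⟩
  obtain ⟨C, hC, h⟩ := h M hM
  refine ⟨C, hC, fun x hx x' hx' t ht => (h x hx x' hx' t ht).trans ?_⟩
  have hd := dM_nonneg (Ω := Ω) (α := α) (β := β) (γ := γ) hM x x'
  gcongr

end HeatKernelPlanar

end

theorem theorem1 (a₀ a₁ δ : ℝ) (ha₀ : 0 < a₀) (hδ : 0 < δ) :
    ∃ c D₀ : ℝ, 0 < c ∧ 0 < D₀ ∧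
      ∀ (Ω : Set HeatKernelPlanar.Plane) (α β γ : HeatKernelPlanar.Plane → ℝ),
        IsOpen Ω → IsConnected Ω →
        HeatKernelPlanar.UniformlyElliptic a₀ a₁ δ Ω α β γ →
        -- the form is closed if `D` is small or `β ≥ 0`
        ((HeatKernelPlanar.constD Ω α β γ < D₀ ∨ ∀ᵐ x ∂(HeatKernelPlanar.mu Ω), 0 ≤ β x) →
          HeatKernelPlanar.FormClosed Ω α β γ) ∧
        -- whenever the form is closed, the heat kernel exists and satisfies the estimate
        (HeatKernelPlanar.FormClosed Ω α β γ →
          ∃ G : HeatKernelPlanar.Plane → HeatKernelPlanar.Plane → ℝ → ℂ,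
            HeatKernelPlanar.IsHeatKernel Ω α β γ G ∧
            ∃ M₀ : ℝ, 0 < M₀ ∧
              ∀ ε : ℝ, 0 < ε → ε < 1 → ∃ cε : ℝ, 0 < cε ∧
                ∀ M : ℝ, M₀ ≤ M → ∃ cεM : ℝ, 0 < cεM ∧
                  ∀ x ∈ Ω, ∀ x' ∈ Ω, ∀ t : ℝ, 0 < t →
                    ‖G x x' t‖ ≤ cε * t ^ (-(1 / 2) : ℝ) *
                      Real.exp (-(HeatKernelPlanar.sigmaStar Ω α β γ
                            - c * HeatKernelPlanar.constD Ω α β γ - ε)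
                          * (HeatKernelPlanar.dM Ω α β γ M x x' ^ (4 / 3 : ℝ)
                            / t ^ (1 / 3 : ℝ)) + cεM * t)) := by
  have h1 : a₀ ≤ max a₁ a₀ := le_max_right _ _
  have hδ' : 0 < min δ 1 := lt_min hδ one_pos
  obtain ⟨κ, D₀, hκ, hD₀, hgard⟩ := HeatKernelPlanar.exists_garding_of_constD_lt ha₀ h1 hδ'
  obtain ⟨c, hc, hbound⟩ := HeatKernelPlanar.exists_const_heatKernel_bound ha₀ h1 hδ' (min_le_right δ 1)
  refine ⟨c, D₀, hc, hD₀, fun Ω α β γ hΩ hconn hE => ?_⟩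
  have hE' := hE.mono (le_max_left a₁ a₀) (min_le_left δ 1)
  refine ⟨fun h => ?_, fun hFC => ?_⟩
  · rcases h with h | h
    · exact (hgard Ω α β γ hΩ hE' h).formClosed hκ hΩ ha₀ h1 hE'
    · exact (HeatKernelPlanar.garding_of_nonneg ha₀ hΩ hE' h).formClosed (by positivity) hΩ ha₀ h1 hE'
  · obtain ⟨⟨κ', hκ', hG⟩, E, hflow, hT⟩ := hFC.exists_isHeatFlow hΩ ha₀ h1 hE'
    refine ⟨HeatKernelPlanar.heatKernel E, HeatKernelPlanar.isHeatKernel_heatKernel hflow hΩ hT, 1, one_pos, fun ε hε _ => ?_⟩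
    obtain ⟨B, hB, h⟩ := hbound Ω α β γ κ' E hΩ hconn.nonempty hE' hκ' hG hflow ε hε
    exact ⟨B, hB, fun M hM => h M (zero_le_one.trans hM)⟩
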